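/- Let $n\ge 1$ and, for $i=1,2,3$, let $(M_i,g_i)$ be a smooth compact $n$-dimensional Riemannian manifold with boundary (smooth up to the boundary), let $f_i\in C^\infty(M_i)$, and let $\varphi\in C^\infty(\mathbb R)$. Suppose the three manifolds have a common boundary: there are a smooth $(n-1)$-manifold $B$ and smooth embeddings $j_i:B\to M_i$ with image $\partial M_i$ such that $j_1^*g_1=j_2^*g_2=j_3^*g_3$. Suppose that $$\nabla^2 f_1+\varphi(f_1)\,g_1=0 \ \text{ in } M_1,\qquad \nabla^2 f_2+\varphi(f_2)\,g_2=0\ \text{ in } M_2,$$ where $\nabla^2$ is the Hessian of the respective metric, and that $f_1$ and $f_2$ have the same Dirichlet data and the same nowhere vanishing Neumann data: for every $b\in B$, $$f_1(j_1(b))=f_2(j_2(b)),\qquad \frac{\partial f_1}{\partial\nu_1}(j_1(b))=\frac{\partial f_2}{\partial\nu_2}(j_2(b))\neq 0,$$ where $\nu_i$ is the outward unit normal of $\partial M_i$. Then $(M_1,g_1,f_1)$ can be smoothly glued to $(M_3,g_3,f_3)$ across the boundary if and only if $(M_2,g_2,f_2)$ can be smoothly glued to $(M_3,g_3,f_3)$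 across the boundary. Here $(M_i,g_i,f_i)$ can be smoothly glued to $(M_3,g_3,f_3)$ across the boundary if the topological space $M_i\cup_B M_3$, obtained from $M_i\sqcup M_3$ by identifying $j_i(b)$ with $j_3(b)$ for all $b\in B$, admits the structure of a smooth manifold without boundary, with a smooth Riemannian metric $G$ and a smooth function $F$, such that the natural maps of $M_i$ and $M_3$ into it are smooth, pull $G$ back to $g_i$ and $g_3$, and pull $F$ back to $f_i$ and $f_3$. -/

import Mathlib

open scoped Manifold ContDiff
open Set

noncomputable section

namespace Gluing

/-- Euclidean space of dimension `n`. -/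
abbrev Euc (n : ℕ) : Type := EuclideanSpace ℝ (Fin n)

section General

variable {n : ℕ} {H : Type*} [TopologicalSpace H] (I : ModelWithCorners ℝ (Euc n) H)
  (M : Type*) [TopologicalSpace M] [ChartedSpace H M] [IsManifold I ∞ M]

/-- A smooth Riemannian metric on a smooth `n`-dimensional manifold (possibly with boundary;
smoothness is then understood up to the boundary). -/
abbrev Metric : Type _ :=
  Bundle.ContMDiffRiemannianMetric I ∞ (Euc n) (fun x : M => TangentSpace I x)

variable {I M}

/-- The pullback `(ι^* g)_x (v, w) = g_{ι x} (dι_x v, dι_x w)` of a Riemannian metric `g` on `M`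
along a map `ι : P → M`. -/
def pullback {k : ℕ} {K : Type*} [TopologicalSpace K] (J : ModelWithCorners ℝ (Euc k) K)
    {P : Type*} [TopologicalSpace P] [ChartedSpace K P]
    (g : Metric I M) (ι : P → M) (x : P) (v w : TangentSpace J x) : ℝ :=
  g.inner (ι x) (mfderiv J I ι x v) (mfderiv J I ι x w)

/-- Partial derivative `∂ᵢ F (y)` of a function on the range of the model (for example on a
half-space, where it is one-sided in the normal direction at boundary points). -/
def partialDeriv (I : ModelWithCorners ℝ (Euc n) H) (i : Fin n) (F : Euc n → ℝ) (y : Euc n) : ℝ :=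
  fderivWithin ℝ F (range I) y (EuclideanSpace.single i 1)

/-- The coordinate vector field `∂/∂xⁱ` of the chart `e`, at the point with coordinates `y`. -/
def coordVector (I : ModelWithCorners ℝ (Euc n) H) (e : OpenPartialHomeomorph M H) (i : Fin n)
    (y : Euc n) : TangentSpace I ((e.extend I).symm y) :=
  mfderivWithin 𝓘(ℝ, Euc n) I (e.extend I).symm (range I) y
    ((NormedSpace.fromTangentSpace y).symm (EuclideanSpace.single i (1 : ℝ)))

/-- The components `g_{ij} = g(∂/∂xⁱ, ∂/∂xʲ)` of the metric in the chart `e`, as functions of the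
coordinates `y`. -/
def metricCoord (g : Metric I M) (e : OpenPartialHomeomorph M H) (i j : Fin n) (y : Euc n) : ℝ :=
  g.inner ((e.extend I).symm y) (coordVector I e i y) (coordVector I e j y)

/-- The components `g^{ij}` of the inverse matrix. -/
def invMetricCoord (g : Metric I M) (e : OpenPartialHomeomorph M H) (i j : Fin n) (y : Euc n) :
    ℝ :=
  (Matrix.of fun a b => metricCoord g e a b y)⁻¹ i j

/-- The Christoffel symbols
`Γ^k_{ij} = ½ ∑ₗ g^{kl} (∂ᵢ g_{jl} + ∂ⱼ g_{il} - ∂ₗ g_{ij})` of the Levi-Civita connection of `g` in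
the chart `e`. -/
def christoffel (g : Metric I M) (e : OpenPartialHomeomorph M H) (k i j : Fin n) (y : Euc n) : ℝ :=
  (1 / 2) * ∑ l, invMetricCoord g e k l y *
    (partialDeriv I i (metricCoord g e j l) y + partialDeriv I j (metricCoord g e i l) y
      - partialDeriv I l (metricCoord g e i j) y)

/-- The components `(∇²f)_{ij} = ∂ᵢ∂ⱼ f - ∑ₖ Γ^k_{ij} ∂ₖ f` of the Hessian of `f` in the
chart `e`. -/
def hessianCoord (g : Metric I M) (f : M → ℝ) (e : OpenPartialHomeomorph M H) (i j : Fin n)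
    (y : Euc n) : ℝ :=
  partialDeriv I i (partialDeriv I j (f ∘ (e.extend I).symm)) y
    - ∑ k, christoffel g e k i j y * partialDeriv I k (f ∘ (e.extend I).symm) y

/-- `f` solves `∇²f + φ(f) g = 0` on all of `M` (boundary points included). The equation is
tensorial; it is expressed through its components in the charts of `M`. -/
def SolvesObata (g : Metric I M) (φ : ℝ → ℝ) (f : M → ℝ) : Prop :=
  ∀ e ∈ IsManifold.maximalAtlas I ∞ M, ∀ y ∈ (e.extend I).target, ∀ i j : Fin n,
    hessianCoord g f e i j y + φ (f ((e.extend I).symm y)) * metricCoord g e i j y = 0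

end General

section Boundary

variable {d : ℕ} {M : Type*} [TopologicalSpace M] [ChartedSpace (EuclideanHalfSpace (d + 1)) M]

/-- The differential at `p` of the first coordinate of the preferred chart at `p`. Since the model
half-space is `{x | 0 ≤ x 0}`, at a boundary point `p` a tangent vector is tangent to the boundary,
respectively points out of `M`, if and only if its image is zero, respectively negative. -/
def dx0 (p : M) (v : TangentSpace (𝓡∂ (d + 1)) p) : ℝ :=
  mvfderiv (𝓡∂ (d + 1)) (extChartAt (𝓡∂ (d + 1)) p) p v 0

variable [IsManifold (𝓡∂ (d + 1)) ∞ M]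

/-- `ν` is the outward unit normal of `∂M` at the boundary point `p`. -/
structure IsOutwardUnitNormal (g : Metric (𝓡∂ (d + 1)) M) (p : M)
    (ν : TangentSpace (𝓡∂ (d + 1)) p) : Prop where
  mem_boundary : p ∈ (𝓡∂ (d + 1)).boundary M
  unit : g.inner p ν ν = 1
  normal : ∀ w : TangentSpace (𝓡∂ (d + 1)) p, dx0 p w = 0 → g.inner p ν w = 0
  outward : dx0 p ν < 0

/-- The outward normal derivative `∂f/∂ν` at the boundary point `p` equals `c`. -/
def HasNormalDeriv (g : Metric (𝓡∂ (d + 1)) M) (f : M → ℝ) (p : M) (c : ℝ) : Prop :=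
  ∃ ν : TangentSpace (𝓡∂ (d + 1)) p, IsOutwardUnitNormal g p ν ∧
    mvfderiv (𝓡∂ (d + 1)) f p ν = c

end Boundary

/-- `j : B → M` identifies the `d`-dimensional manifold `B` with the boundary of the
`(d + 1)`-dimensional manifold with boundary `M`: it is a smooth embedding with image `∂M`. -/
structure IsBoundaryInclusion (d : ℕ) {B M : Type*}
    [TopologicalSpace B] [ChartedSpace (Euc d) B]
    [TopologicalSpace M] [ChartedSpace (EuclideanHalfSpace (d + 1)) M] (j : B → M) : Prop where
  embedding : Manifold.IsSmoothEmbedding (𝓡 d) (𝓡∂ (d + 1)) ∞ j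
  range_eq : range j = (𝓡∂ (d + 1)).boundary M

section Glue

variable {B M M' : Type*} [TopologicalSpace M] [TopologicalSpace M']

/-- The space `M ∪_B M'` obtained from the disjoint union of `M` and `M'` by identifying `j b` with
`j' b` for all `b`, with the quotient topology. -/
def GluedSpace (j : B → M) (j' : B → M') : Type _ :=
  Quot (fun s t : M ⊕ M' => ∃ b, s = Sum.inl (j b) ∧ t = Sum.inr (j' b))

instance (j : B → M) (j' : B → M') : TopologicalSpace (GluedSpace j j') :=
  inferInstanceAs (TopologicalSpace (Quot _))

/-- The natural map `M → M ∪_B M'`. -/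
def glueLeft (j : B → M) (j' : B → M') (x : M) : GluedSpace j j' := Quot.mk _ (Sum.inl x)

/-- The natural map `M' → M ∪_B M'`. -/
def glueRight (j : B → M) (j' : B → M') (x : M') : GluedSpace j j' := Quot.mk _ (Sum.inr x)

variable {d : ℕ}
  [ChartedSpace (EuclideanHalfSpace (d + 1)) M] [IsManifold (𝓡∂ (d + 1)) ∞ M]
  [ChartedSpace (EuclideanHalfSpace (d + 1)) M'] [IsManifold (𝓡∂ (d + 1)) ∞ M']

/-- `(M, g, f)` and `(M', g', f')` can be smoothly glued across their boundaries, identified through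
`j` and `j'`: the glued space `M ∪_B M'` carries a structure of smooth manifold without boundary, a
smooth Riemannian metric `G` and a smooth function `F`, such that the natural maps of `M` and `M'`
into it are smooth, `G` restricts to `g` and `g'`, and `F` restricts to `f` and `f'`. -/
def SmoothlyGlues (j : B → M) (g : Metric (𝓡∂ (d + 1)) M) (f : M → ℝ)
    (j' : B → M') (g' : Metric (𝓡∂ (d + 1)) M') (f' : M' → ℝ) : Prop :=
  ∃ (_ : ChartedSpace (Euc (d + 1)) (GluedSpace j j'))
    (_ : IsManifold (𝓡 (d + 1)) ∞ (GluedSpace j j'))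
    (G : Metric (𝓡 (d + 1)) (GluedSpace j j')) (F : GluedSpace j j' → ℝ),
    ContMDiff (𝓡 (d + 1)) 𝓘(ℝ, ℝ) ∞ F ∧
    ContMDiff (𝓡∂ (d + 1)) (𝓡 (d + 1)) ∞ (glueLeft j j') ∧
    ContMDiff (𝓡∂ (d + 1)) (𝓡 (d + 1)) ∞ (glueRight j j') ∧
    (∀ x v w, pullback (𝓡∂ (d + 1)) G (glueLeft j j') x v w = g.inner x v w) ∧
    (∀ x v w, pullback (𝓡∂ (d + 1)) G (glueRight j j') x v w = g'.inner x v w) ∧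
    (∀ x, F (glueLeft j j' x) = f x) ∧
    (∀ x, F (glueRight j j' x) = f' x)

end Glue

end Gluing

end

/-!
Near a point of the common boundary, `(M₁, g₁, f₁)` and `(M₂, g₂, f₂)` are isometric, by an isometry
that matches `f₁` with `f₂` and the two boundary inclusions. Such an isometry, extended by the
identity of `M₃`, identifies `M₂ ∪ M₃` with `M₁ ∪ M₃` near the boundary, and any smooth structure on
one of these spaces can be transported to the other. As the hypotheses are symmetric in `M₁` and
`M₂`, one implication suffices.

**Local isometries.** Let `σ = ±1` be opposite to the sign of the Neumann data, so that `σ ∇f`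
points into the manifold along the boundary. Its flow lines issuing from the boundary, together with
a chart of `B`, give a collar chart (`IsCollarChart`, `exists_collarChart`), in which
`σ ∇f = ∂/∂x⁰`. Symmetry of second derivatives turns the Hessian equation in this chart into
`∂₀ g = -2 σ φ(f) g` (`fderivWithin_coordMetric_of_obata`), and the choice of the chart means
`∂₀ f = σ g₀₀`. Along each normal line this is an ordinary differential equation for `(f, g)`. Its
initial values are given by the metric of `B`, the Dirichlet data and the Neumann data
(`form_eq_of_boundary_data`), so `f` and the metric coefficients are the same functions of the collar
coordinates on both manifolds (`IsCollarChart.data_eq`). Composing one collar chart with the inverse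
of the other is the local isometry. Two collar charts of the same manifold differ near the boundary
only by a change of charts of `B`, since both straighten the same vector field; hence the germs of the
local isometries at boundary points do not depend on the charts (`exists_local_isometries`).

**Collar charts.** Vector fields and charts are smooth only up to the boundary of the half-space, and
are not extended across it. The Picard map of a vector field that points inwards preserves curves in
the half-space, its fixed point depends smoothly on the initial point
(`exists_halfSpace_flow`, on the Banach space of continuous curves), and a one-sided inverse function
theorem (`exists_halfSpace_localInverse`) turns the flow into a flow box of the half-space
(`exists_halfSpace_flowBox`).

**Transfer of the gluing.** The local isometries extend to partial homeomorphisms from `M₂ ∪ M₃` to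
`M₁ ∪ M₃` (`IsGlueable.homeo`), along which charts of `M₁ ∪ M₃` are transported; two charts
obtained in this way are compatible at the boundary because the germs agree. Charts of the interiors
cover the rest. Every chart in this collection carries a metric which pulls back to `g₂` and `g₃`;
away from the boundary this makes `M₂` and `M₃` locally diffeomorphic to the charts and the transition
maps smooth (`IsIsometricIn.contDiffAt_transition`), and it determines the metrics uniquely, so that
they fit together (`exists_riemannian_structure`, `SmoothlyGlues.of_local_isometries`).
-/

noncomputable section

namespace Gluing

open Filter Topology

/-! ### Smooth right inverses -/

section InverseSmooth

variable {X W : Type*} [NormedAddCommGroup X] [NormedSpace ℝ X] [NormedAddCommGroup W]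
  [NormedSpace ℝ W] [CompleteSpace X]

/-- A continuous right inverse `g` of a map `f` that is smooth on an arbitrary set `s`, with
invertible derivative along `g`, is smooth. No openness of `s` or `t` is needed, so this applies on
half-spaces. -/
theorem contDiffOn_right_inverse {f : X → W} {f' : X → X →L[ℝ] W} {g : W → X} {s : Set X}
    {t : Set W} (hf : ∀ x ∈ s, HasFDerivWithinAt f (f' x) s x) (hf' : ContDiffOn ℝ ∞ f' s)
    (hg : ContinuousOn g t) (hgs : MapsTo g t s) (hfg : ∀ y ∈ t, f (g y) = y)
    (hinv : ∀ y ∈ t, (f' (g y)).IsInvertible) : ContDiffOn ℝ ∞ g t := by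
  have hder : ∀ y ∈ t, HasFDerivWithinAt g (f' (g y)).inverse t y := by
    intro y hy
    obtain ⟨e, he⟩ := hinv y hy
    rw [← he, ContinuousLinearMap.inverse_equiv]
    refine HasFDerivWithinAt.of_local_left_inverse (t := s) (f := f) ?_ ?_ hy ?_
    · exact tendsto_nhdsWithin_iff.2 ⟨hg y hy, eventually_nhdsWithin_of_forall hgs⟩
    · rw [he]; exact hf _ (hgs hy)
    · exact eventually_nhdsWithin_of_forall hfg
  rw [contDiffOn_infty]
  intro n
  induction n with
  | zero => exact contDiffOn_zero.2 hg
  | succ n ih =>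
    push_cast
    rw [contDiffOn_succ_iff_hasFDerivWithinAt (by simp)]
    intro y hy
    refine ⟨t, ?_, by simp, fun y ↦ (f' (g y)).inverse, hder, ?_⟩
    · rw [insert_eq_of_mem hy]; exact self_mem_nhdsWithin
    · have h1 : ContDiffOn ℝ n (fun y ↦ f' (g y)) t := (hf'.of_le (by exact_mod_cast le_top)).comp ih hgs
      intro z hz
      obtain ⟨e, he⟩ := hinv z hz
      have := contDiffAt_map_inverse (𝕜 := ℝ) (n := n) e
      rw [he] at this
      exact this.comp_contDiffWithinAt z (h1 z hz)

end InverseSmooth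

/-! ### Superposition operators on continuous curves -/

section Nemytskii

variable {K : Type*} [TopologicalSpace K] [CompactSpace K]

/-- The superposition operator `u ↦ Y ∘ u` on continuous maps, with the junk value `0` where
`Y ∘ u` is not continuous. -/
def superposition {E F : Type*} [TopologicalSpace E] [TopologicalSpace F] [Zero F] (Y : E → F)
    (u : C(K, E)) : C(K, F) :=
  open Classical in if h : Continuous (Y ∘ u) then ⟨Y ∘ u, h⟩ else 0

omit [CompactSpace K] in
theorem superposition_apply {E F : Type*} [TopologicalSpace E] [TopologicalSpace F] [Zero F]
    {Y : E → F} {S : Set E} (hY : ContinuousOn Y S) {u : C(K, E)} (hu : ∀ t, u t ∈ S) (t : K) :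
    superposition Y u t = Y (u t) := by
  have h : Continuous (Y ∘ u) := hY.comp_continuous u.continuous hu
  simp [superposition, h]

variable {E F : Type*} [NormedAddCommGroup E] [NormedSpace ℝ E] [NormedAddCommGroup F]
  [NormedSpace ℝ F]

variable (K E F) in
/-- Pointwise application of a continuous family of linear maps, as a bounded operator. -/
def pointwiseApply : C(K, E →L[ℝ] F) →L[ℝ] C(K, E) →L[ℝ] C(K, F) :=
  LinearMap.mkContinuous₂
    (LinearMap.mk₂ ℝ (fun (A : C(K, E →L[ℝ] F)) (v : C(K, E)) ↦ (⟨fun t ↦ A t (v t), by fun_prop⟩ : C(K, F)))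
      (fun _ _ _ ↦ by ext; simp) (fun _ _ _ ↦ by ext; simp) (fun _ _ _ ↦ by ext; simp)
      (fun _ _ _ ↦ by ext; simp)) 1 (fun (A : C(K, E →L[ℝ] F)) (v : C(K, E)) ↦ by
        rw [one_mul, ContinuousMap.norm_le _ (by positivity)]
        intro t
        exact (A t).le_of_opNorm_le_of_le (A.norm_coe_le_norm t) (v.norm_coe_le_norm t))

@[simp] theorem pointwiseApply_apply (A : C(K, E →L[ℝ] F)) (v : C(K, E)) (t : K) :
    pointwiseApply K E F A v t = A t (v t) := rfl

/-- The superposition operator of a `C¹` map on a convex set `S` is differentiable within the set of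
curves in `S`, without any regularity of `Y` beyond `S`: by compactness, the derivative of `Y` is
uniformly continuous at the points of the curve. -/
theorem hasFDerivWithinAt_superposition {Y : E → F} {Y' : E → E →L[ℝ] F} {S : Set E}
    (hS : Convex ℝ S) (hY : ∀ x ∈ S, HasFDerivWithinAt Y (Y' x) S x) (hY' : ContinuousOn Y' S)
    {u : C(K, E)} (hu : ∀ t, u t ∈ S) :
    HasFDerivWithinAt (superposition Y) (pointwiseApply K E F (superposition Y' u))
      {v : C(K, E) | ∀ t, v t ∈ S} u := by
  have hYc : ContinuousOn Y S := fun x hx ↦ (hY x hx).continuousWithinAt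
  rw [hasFDerivWithinAt_iff_isLittleO, Asymptotics.isLittleO_iff]
  intro ε hε
  obtain ⟨δ, hδ, hδ'⟩ : ∃ δ > 0, ∀ t, ∀ x ∈ S, dist (u t) x < δ → ‖Y' x - Y' (u t)‖ ≤ ε := by
    let v : K → S := fun t ↦ ⟨u t, hu t⟩
    have hv : Continuous v := by fun_prop
    have h := (isCompact_range hv).uniformContinuousAt_of_continuousAt (S.domRestrict Y')
      (fun a _ ↦ (continuousOn_iff_continuous_domRestrict.1 hY').continuousAt)
      (Metric.dist_mem_uniformity hε)
    obtain ⟨δ, hδ, h⟩ := Metric.mem_uniformity_dist.1 h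
    refine ⟨δ, hδ, fun t x hx hd ↦ ?_⟩
    have := h (a := v t) (b := ⟨x, hx⟩) hd (mem_range_self t)
    rw [← dist_eq_norm, dist_comm]
    exact le_of_lt this
  filter_upwards [self_mem_nhdsWithin, mem_nhdsWithin_of_mem_nhds (Metric.ball_mem_nhds u hδ)]
    with v hv hvu
  rw [ContinuousMap.norm_le _ (by positivity)]
  intro t
  have hd : ∀ t, dist (v t) (u t) < δ := fun t ↦
    lt_of_le_of_lt (ContinuousMap.dist_apply_le_dist t) hvu
  have key := (hS.inter (convex_ball (u t) δ)).norm_image_sub_le_of_norm_hasFDerivWithin_le'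
    (f := Y) (f' := Y') (C := ε) (φ := Y' (u t)) (x := u t) (y := v t)
    (fun x hx ↦ (hY x hx.1).mono inter_subset_left)
    (fun x hx ↦ hδ' t x hx.1 (by rw [dist_comm]; exact hx.2))
    ⟨hu t, Metric.mem_ball_self hδ⟩ ⟨hv t, hd t⟩
  simp only [ContinuousMap.sub_apply, pointwiseApply_apply, superposition_apply hYc hv,
    superposition_apply hYc hu, superposition_apply hY' hu]
  refine key.trans ?_
  gcongr
  exact (v - u).norm_coe_le_norm t

end Nemytskii

section NemytskiiSmooth

universe u
variable {K : Type*} [TopologicalSpace K] [CompactSpace K]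
  {E F : Type u} [NormedAddCommGroup E] [NormedSpace ℝ E] [NormedAddCommGroup F]
  [NormedSpace ℝ F]

theorem continuousOn_superposition {E F : Type*} [NormedAddCommGroup E] [NormedAddCommGroup F]
    {Y : E → F} {S : Set E} (hY : ContinuousOn Y S) :
    ContinuousOn (superposition (K := K) Y) {v : C(K, E) | ∀ t, v t ∈ S} := by
  intro u hu
  rw [ContinuousWithinAt, Metric.tendsto_nhds]
  intro ε hε
  let v : K → S := fun t ↦ ⟨u t, hu t⟩
  have hv : Continuous v := by fun_prop
  have h := (isCompact_range hv).uniformContinuousAt_of_continuousAt (S.domRestrict Y)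
      (fun a _ ↦ (continuousOn_iff_continuous_domRestrict.1 hY).continuousAt)
      (Metric.dist_mem_uniformity (half_pos hε))
  obtain ⟨δ, hδ, h⟩ := Metric.mem_uniformity_dist.1 h
  filter_upwards [self_mem_nhdsWithin, mem_nhdsWithin_of_mem_nhds (Metric.ball_mem_nhds u hδ)]
    with w hw hwu
  refine lt_of_le_of_lt ((ContinuousMap.dist_le (half_pos hε).le).2 fun t ↦ ?_) (half_lt_self hε)
  rw [superposition_apply hY hw, superposition_apply hY hu, dist_comm]
  refine le_of_lt (h (a := v t) (b := ⟨w t, hw t⟩) ?_ (mem_range_self t))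
  change dist (u t) (w t) < δ
  rw [dist_comm]
  exact lt_of_le_of_lt (ContinuousMap.dist_apply_le_dist t) hwu

/-- The superposition operator of a map that is smooth on a convex set with nonempty interior is
smooth on the set of curves with values in that set. -/
theorem contDiffOn_superposition {S : Set E} (hS : Convex ℝ S) (hS' : (interior S).Nonempty)
    {Y : E → F} (hY : ContDiffOn ℝ ∞ Y S) :
    ContDiffOn ℝ ∞ (superposition (K := K) Y) {v : C(K, E) | ∀ t, v t ∈ S} := by
  have hU := uniqueDiffOn_convex hS hS'
  rw [contDiffOn_infty]
  intro n
  induction n generalizing F with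
  | zero => exact contDiffOn_zero.2 (continuousOn_superposition hY.continuousOn)
  | succ n ih =>
    push_cast
    have hd := hY.fderivWithin (m := ∞) hU (by simp)
    rw [contDiffOn_succ_iff_hasFDerivWithinAt (by simp)]
    intro y hy
    refine ⟨_, ?_, by simp, fun u ↦ pointwiseApply K E F (superposition (fderivWithin ℝ Y S) u),
      fun u hu ↦ hasFDerivWithinAt_superposition hS (fun x hx ↦
        ((hY.differentiableOn (by simp)) x hx).hasFDerivWithinAt) hd.continuousOn hu, ?_⟩
    · rw [insert_eq_of_mem hy]; exact self_mem_nhdsWithin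
    · exact (pointwiseApply K E F).contDiff.comp_contDiffOn (ih hd)

theorem contDiffOn_pointwiseApply_superposition {S : Set E} (hS : Convex ℝ S)
    (hS' : (interior S).Nonempty) {A : E → E →L[ℝ] F} (hA : ContDiffOn ℝ ∞ A S) :
    ContDiffOn ℝ ∞ (fun v ↦ pointwiseApply K E F (superposition A v))
      {v : C(K, E) | ∀ t, v t ∈ S} := by
  have h := contDiffOn_superposition (K := K) hS hS' hA
  exact (pointwiseApply K E F).contDiff.comp_contDiffOn h

end NemytskiiSmooth

/-! ### Flows into a half-space -/

section Integration

variable {E : Type*} [NormedAddCommGroup E] [NormedSpace ℝ E]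

/-- The primitive vanishing at `0`, as a bounded operator on curves `[0, 1] → E`. -/
def primitive (E : Type*) [NormedAddCommGroup E] [NormedSpace ℝ E] :
    C(unitInterval, E) →L[ℝ] C(unitInterval, E) :=
  LinearMap.mkContinuous
    { toFun := fun u ↦ ⟨fun t ↦ ∫ x in (0 : ℝ)..t, IccExtend zero_le_one u x,
        (intervalIntegral.continuous_primitive
          (fun a b ↦ (u.continuous.Icc_extend').intervalIntegrable a b) 0).comp
            continuous_subtype_val⟩
      map_add' := fun u v ↦ by
        ext t
        exact intervalIntegral.integral_add (u.continuous.Icc_extend'.intervalIntegrable _ _)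
          (v.continuous.Icc_extend'.intervalIntegrable _ _)
      map_smul' := fun c u ↦ by
        ext t
        exact intervalIntegral.integral_smul c _ } 1 (fun u ↦ by
    rw [one_mul, ContinuousMap.norm_le _ (norm_nonneg _)]
    intro t
    refine (intervalIntegral.norm_integral_le_of_norm_le_const (C := ‖u‖)
      fun x _ ↦ u.norm_coe_le_norm _).trans ?_
    rw [sub_zero, abs_of_nonneg t.2.1]
    exact mul_le_of_le_one_right (norm_nonneg _) t.2.2)

theorem primitive_apply (u : C(unitInterval, E)) (t : unitInterval) :
    primitive E u t = ∫ x in (0 : ℝ)..t, IccExtend zero_le_one u x := rfl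

theorem norm_primitive_le (u : C(unitInterval, E)) : ‖primitive E u‖ ≤ ‖u‖ := by
  simpa using LinearMap.mkContinuous_norm_le _ zero_le_one _ |> fun h ↦
    (primitive E).le_of_opNorm_le h u

theorem map_primitive_nonneg [CompleteSpace E] (ℓ : E →L[ℝ] ℝ) {u : C(unitInterval, E)}
    (hu : ∀ t, 0 ≤ ℓ (u t)) (t : unitInterval) : 0 ≤ ℓ (primitive E u t) := by
  rw [primitive_apply, ← ContinuousLinearMap.intervalIntegral_comp_comm _
    (u.continuous.Icc_extend'.intervalIntegrable _ _)]
  exact intervalIntegral.integral_nonneg t.2.1 fun x _ ↦ hu _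

end Integration

section FixedPoint

variable {P Z : Type*} [NormedAddCommGroup P] [NormedSpace ℝ P] [CompleteSpace P]
  [NormedAddCommGroup Z] [NormedSpace ℝ Z] [CompleteSpace Z]

/-- Smooth dependence on `p` of a fixed point of `z = a p + σ p • J (N z)`, where `N` need only be
smooth on an arbitrary set `𝒮` that contains the fixed points. -/
theorem contDiffOn_fixedPoint (σ : P →L[ℝ] ℝ) (J : Z →L[ℝ] Z) {D U : Set P} (hU : IsOpen U)
    (hDU : D ⊆ U) {𝒮 : Set Z} {a : P → Z} (ha : ContDiffOn ℝ ∞ a U) {N : Z → Z}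
    {N' : Z → Z →L[ℝ] Z} (hNd : ∀ z ∈ 𝒮, HasFDerivWithinAt N (N' z) 𝒮 z)
    (hNs : ContDiffOn ℝ ∞ N 𝒮) (hN's : ContDiffOn ℝ ∞ N' 𝒮) {ζ : P → Z} (hζc : ContinuousOn ζ D)
    (hζ𝒮 : ∀ p ∈ D, ζ p ∈ 𝒮) (hfix : ∀ p ∈ D, a p + σ p • J (N (ζ p)) = ζ p)
    (hsmall : ∀ p ∈ D, ‖σ p • (J ∘L N' (ζ p))‖ < 1) : ContDiffOn ℝ ∞ ζ D := by
  -- `(p, ζ p)` is the inverse image of `(p, 0)` under `f`, whose derivative is invertible by `hsmall`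
  let f : P × Z → P × Z := fun x ↦ (x.1, x.2 - (a x.1 + σ x.1 • J (N x.2)))
  let Q : P × Z → Z →L[ℝ] Z := fun x ↦ σ x.1 • (J ∘L N' x.2)
  let B : P × Z → P →L[ℝ] Z := fun x ↦ fderiv ℝ a x.1 + σ.smulRight (J (N x.2))
  let f' : P × Z → P × Z →L[ℝ] P × Z := fun x ↦
    (ContinuousLinearMap.fst ℝ P Z).prod (ContinuousLinearMap.snd ℝ P Z -
        (Q x ∘L ContinuousLinearMap.snd ℝ P Z + B x ∘L ContinuousLinearMap.fst ℝ P Z))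
  have hfd : ∀ x ∈ D ×ˢ 𝒮, HasFDerivWithinAt f (f' x) (D ×ˢ 𝒮) x := by
    rintro ⟨p, z⟩ ⟨hp, hz⟩
    have h1 : HasFDerivWithinAt (fun x : P × Z ↦ a x.1)
        (fderiv ℝ a p ∘L ContinuousLinearMap.fst ℝ P Z) (D ×ˢ 𝒮) (p, z) :=
      (((ha.contDiffAt (hU.mem_nhds (hDU hp))).differentiableAt (by simp)).hasFDerivAt.comp
        (p, z) hasFDerivAt_fst).hasFDerivWithinAt
    have h0 : HasFDerivWithinAt (fun x : P × Z ↦ N x.2)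
        (N' z ∘L ContinuousLinearMap.snd ℝ P Z) (D ×ˢ 𝒮) (p, z) :=
      HasFDerivWithinAt.comp (g := N) (t := 𝒮) (p, z) (hNd z hz) hasFDerivWithinAt_snd
        fun x hx ↦ hx.2
    have h2 : HasFDerivWithinAt (fun x : P × Z ↦ J (N x.2))
        (J ∘L N' z ∘L ContinuousLinearMap.snd ℝ P Z) (D ×ˢ 𝒮) (p, z) :=
      J.hasFDerivAt.comp_hasFDerivWithinAt (p, z) h0
    have h3 : HasFDerivWithinAt (fun x : P × Z ↦ σ x.1)
        (σ ∘L ContinuousLinearMap.fst ℝ P Z) (D ×ˢ 𝒮) (p, z) :=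
      (σ ∘L ContinuousLinearMap.fst ℝ P Z).hasFDerivWithinAt
    have h4 := hasFDerivWithinAt_fst.prodMk (hasFDerivWithinAt_snd.sub (h1.add (h3.smul h2)))
    refine h4.congr_fderiv ?_
    ext x <;> simp [f', Q, B]
  have hf's : ContDiffOn ℝ ∞ f' (D ×ˢ 𝒮) := by
    have h1 : ContDiffOn ℝ ∞ (fun x : P × Z ↦ N x.2) (D ×ˢ 𝒮) :=
      hNs.comp contDiffOn_snd fun x hx ↦ hx.2
    have h2 : ContDiffOn ℝ ∞ (fun x : P × Z ↦ N' x.2) (D ×ˢ 𝒮) :=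
      hN's.comp contDiffOn_snd fun x hx ↦ hx.2
    have h3 : ContDiffOn ℝ ∞ (fun x : P × Z ↦ fderiv ℝ a x.1) (D ×ˢ 𝒮) :=
      (ha.fderiv_of_isOpen (m := ∞) hU (by simp)).comp contDiffOn_fst fun x hx ↦ hDU hx.1
    have h4 : ContDiffOn ℝ ∞ (fun x : P × Z ↦ σ x.1) (D ×ˢ 𝒮) :=
      σ.contDiff.comp_contDiffOn contDiffOn_fst
    have hQ : ContDiffOn ℝ ∞ Q (D ×ˢ 𝒮) := h4.smul (contDiffOn_const.clm_comp h2)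
    have hB : ContDiffOn ℝ ∞ B (D ×ˢ 𝒮) := h3.add
      (contDiffOn_const.smulRight (J.contDiff.comp_contDiffOn h1))
    have h5 : ContDiffOn ℝ ∞ (fun x ↦ ContinuousLinearMap.snd ℝ P Z -
        (Q x ∘L ContinuousLinearMap.snd ℝ P Z +
          B x ∘L ContinuousLinearMap.fst ℝ P Z)) (D ×ˢ 𝒮) :=
      contDiffOn_const.sub ((hQ.clm_comp contDiffOn_const).add (hB.clm_comp contDiffOn_const))
    exact (ContinuousLinearMap.prodₗᵢ ℝ (𝕜 := ℝ) (E := P × Z) (F := P)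
      (G := Z)).contDiff.comp_contDiffOn
        ((contDiffOn_const (c := ContinuousLinearMap.fst ℝ P Z)).prodMk h5)
  have hg := contDiffOn_right_inverse (f := f) (f' := f')
    (g := fun x : P × Z ↦ (x.1, ζ x.1)) (s := D ×ˢ 𝒮) (t := D ×ˢ {0}) hfd hf's
    (continuousOn_fst.prodMk (hζc.comp continuousOn_fst fun x hx ↦ hx.1))
    (fun x hx ↦ ⟨hx.1, hζ𝒮 _ hx.1⟩) ?_ ?_
  · have h1 : ContDiffOn ℝ ∞ (fun p : P ↦ (p, (0 : Z))) D := contDiffOn_id.prodMk contDiffOn_const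
    exact contDiff_snd.comp_contDiffOn (hg.comp h1 fun p hp ↦ ⟨hp, rfl⟩)
  · rintro ⟨p, z⟩ ⟨hp, hz⟩
    obtain rfl : z = 0 := hz
    simp only [f, hfix p hp, sub_self]
  · rintro ⟨p, z⟩ ⟨hp, hz⟩
    let A := ContinuousLinearEquiv.unitsEquiv ℝ _ (Units.oneSub (Q (p, ζ p)) (hsmall p hp))
    refine ⟨(ContinuousLinearEquiv.refl ℝ P).skewProd A (-B (p, ζ p)), ?_⟩
    ext x <;> simp [f', A]

end FixedPoint

section Flow

universe u
variable {E P : Type u} [NormedAddCommGroup E] [NormedSpace ℝ E] [CompleteSpace E]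
  [NormedAddCommGroup P] [NormedSpace ℝ P] [CompleteSpace P]

omit [CompleteSpace E] in
/-- A vector field on a half-space that points strictly inwards at `x₀` is bounded and Lipschitz, has
bounded derivative and points weakly inwards on a small half-ball, which is convex with nonempty
interior. -/
theorem exists_ball_halfSpace_lipschitz (ℓ : E →L[ℝ] ℝ) {O : Set E} (hO : IsOpen O) {Y : E → E}
    (hY : ContDiffOn ℝ ∞ Y ({x | 0 ≤ ℓ x} ∩ O)) {x₀ : E} (hx₀ : x₀ ∈ {x | 0 ≤ ℓ x} ∩ O)
    (hpos : 0 < ℓ (Y x₀)) :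
    ∃ r > 0, Metric.ball x₀ r ⊆ O ∧ ∃ K : NNReal, ∃ C : ℝ, 0 ≤ C ∧
      LipschitzOnWith K Y ({x | 0 ≤ ℓ x} ∩ Metric.ball x₀ r) ∧
      (∀ x ∈ {x | 0 ≤ ℓ x} ∩ Metric.ball x₀ r, ‖fderivWithin ℝ Y ({x | 0 ≤ ℓ x} ∩ Metric.ball x₀ r) x‖ ≤ K) ∧
      (∀ x ∈ {x | 0 ≤ ℓ x} ∩ Metric.ball x₀ r, ‖Y x‖ ≤ C ∧ 0 ≤ ℓ (Y x)) ∧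
      Convex ℝ ({x | 0 ≤ ℓ x} ∩ Metric.ball x₀ r) ∧
      (interior ({x | 0 ≤ ℓ x} ∩ Metric.ball x₀ r)).Nonempty := by
  have hH : Convex ℝ {x | 0 ≤ ℓ x} := (convex_Ici 0).linear_preimage ℓ.toLinearMap
  have hint : ∀ r > 0, (interior ({x | 0 ≤ ℓ x} ∩ Metric.ball x₀ r)).Nonempty := by
    intro r hr
    have h1 : Tendsto (fun t : ℝ ↦ x₀ + t • Y x₀) (𝓝[>] 0) (𝓝 x₀) := by
      have : Continuous (fun t : ℝ ↦ x₀ + t • Y x₀) := by fun_prop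
      simpa using (this.tendsto 0).mono_left nhdsWithin_le_nhds
    obtain ⟨t, ht1, ht2⟩ := ((h1.eventually (Metric.ball_mem_nhds x₀ hr)).and
      self_mem_nhdsWithin).exists
    refine ⟨x₀ + t • Y x₀, mem_interior.2 ⟨{x | 0 < ℓ x} ∩ Metric.ball x₀ r, ?_, ?_, ?_, ht1⟩⟩
    · exact inter_subset_inter_left _ fun x (hx : 0 < ℓ x) ↦ hx.le
    · exact (isOpen_lt continuous_const ℓ.continuous).inter Metric.isOpen_ball
    · have h1 := hx₀.1
      have h2 : 0 < t * ℓ (Y x₀) := mul_pos ht2 hpos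
      simp only [mem_ofPred_eq, map_add, map_smul, smul_eq_mul] at h1 ⊢
      linarith
  obtain ⟨r₀, hr₀, hr₀O⟩ := Metric.isOpen_iff.1 hO x₀ hx₀.2
  set S₀ := {x | 0 ≤ ℓ x} ∩ Metric.ball x₀ r₀ with hS₀
  have hYS : ContDiffOn ℝ ∞ Y S₀ := hY.mono (inter_subset_inter_right _ hr₀O)
  have hx₀S : x₀ ∈ S₀ := ⟨hx₀.1, Metric.mem_ball_self hr₀⟩
  have hU₀ := uniqueDiffOn_convex (hH.inter (convex_ball x₀ r₀)) (hint r₀ hr₀)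
  have hD := (hYS.fderivWithin (m := ∞) hU₀ (by simp)).continuousOn x₀ hx₀S
  have hYc := hYS.continuousOn x₀ hx₀S
  have e1 := hD.norm.eventually (Iio_mem_nhds (lt_add_one _))
  have e2 := hYc.norm.eventually (Iio_mem_nhds (lt_add_one _))
  have e3 := (ℓ.continuous.continuousAt.comp_continuousWithinAt hYc).eventually
    (Ioi_mem_nhds hpos)
  obtain ⟨r₁, hr₁, hr₁'⟩ := Metric.mem_nhdsWithin_iff.1 (e1.and (e2.and e3))
  set r := min r₀ r₁
  have hr : 0 < r := lt_min hr₀ hr₁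
  have hsub : {x | 0 ≤ ℓ x} ∩ Metric.ball x₀ r ⊆ Metric.ball x₀ r₁ ∩ S₀ := fun x hx ↦
    ⟨Metric.ball_subset_ball (min_le_right _ _) hx.2, hx.1,
      Metric.ball_subset_ball (min_le_left _ _) hx.2⟩
  have hconv := hH.inter (convex_ball x₀ r)
  have hU := uniqueDiffOn_convex hconv (hint r hr)
  have hder : ∀ x ∈ {x | 0 ≤ ℓ x} ∩ Metric.ball x₀ r,
      ‖fderivWithin ℝ Y ({x | 0 ≤ ℓ x} ∩ Metric.ball x₀ r) x‖ ≤ ‖fderivWithin ℝ Y S₀ x₀‖ + 1 := by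
    intro x hx
    rw [fderivWithin_subset (fun y hy ↦ (hsub hy).2) (hU x hx)
      ((hYS.differentiableOn (by simp)) x (hsub hx).2)]
    exact (hr₁' (hsub hx)).1.le
  have hK : 0 ≤ ‖fderivWithin ℝ Y S₀ x₀‖ + 1 := by positivity
  refine ⟨r, hr, (Metric.ball_subset_ball (min_le_left _ _)).trans hr₀O, ⟨_, hK⟩, ‖Y x₀‖ + 1,
    by positivity, ?_, hder, fun x hx ↦ ?_, hconv, hint r hr⟩
  · refine hconv.lipschitzOnWith_of_nnnorm_fderivWithin_le (𝕜 := ℝ) (fun x hx ↦ ?_) fun x hx ↦ hder x hx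
    exact (((hYS.differentiableOn (by simp)) x (hsub hx).2).mono fun y hy ↦ (hsub hy).2)
  · have := hr₁' (hsub hx)
    exact ⟨this.2.1.le, le_of_lt this.2.2⟩

/-- Forward flow from a hypersurface into a half-space. The curve `z` through the parameter `p` is
the fixed point of `z = β (p - σ p • e) + σ p • ∫ Y z`; this Picard map preserves curves with values
in the half-space `{0 ≤ ℓ}`, so the vector field need not be extended across its boundary. -/
theorem exists_halfSpace_flow (ℓ : E →L[ℝ] ℝ) (σ : P →L[ℝ] ℝ) {e : P} (he : σ e = 1)
    {O : Set E} (hO : IsOpen O) {Y : E → E} (hY : ContDiffOn ℝ ∞ Y ({x | 0 ≤ ℓ x} ∩ O))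
    {U : Set P} (hU : IsOpen U) {β : P → E} (hβ : ContDiffOn ℝ ∞ β U) (hβℓ : ∀ p ∈ U, 0 ≤ ℓ (β p))
    {p₀ : P} (hp₀ : p₀ ∈ U) (hσ₀ : σ p₀ = 0) (hβO : β p₀ ∈ O) (hpos : 0 < ℓ (Y (β p₀))) :
    ∃ V : Set P, IsOpen V ∧ p₀ ∈ V ∧ (∀ p ∈ V, p - σ p • e ∈ U) ∧ ∃ Ψ : P → E,
      ContDiffOn ℝ ∞ Ψ ({p | 0 ≤ σ p} ∩ V) ∧
      (∀ p ∈ {p | 0 ≤ σ p} ∩ V, Ψ p ∈ {x | 0 ≤ ℓ x} ∩ O) ∧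
      (∀ p ∈ V, σ p = 0 → Ψ p = β p) ∧
      ∀ p ∈ {p | 0 ≤ σ p} ∩ V, fderivWithin ℝ Ψ ({p | 0 ≤ σ p} ∩ V) p e = Y (Ψ p) := by
  obtain ⟨r, hr, hrO, K, C, hC, hLip, hDK, hYC, hSconv, hSint⟩ := exists_ball_halfSpace_lipschitz ℓ hO hY
    ⟨hβℓ p₀ hp₀, hβO⟩ hpos
  set S := {x | 0 ≤ ℓ x} ∩ Metric.ball (β p₀) r with hS
  have hYS : ContDiffOn ℝ ∞ Y S := hY.mono (inter_subset_inter_right _ hrO)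
  -- the time bound making the Picard map a contraction of ratio `1 / 2` preserving a smaller ball
  obtain ⟨ε, hε, hεK, hεC⟩ : ∃ ε : ℝ, 0 < ε ∧ ε * K ≤ 1 / 2 ∧ ε * C ≤ r / 4 := by
    have hr' : 0 < r := hr
    refine ⟨min (1 / 2 / (K + 1)) (r / 4 / (C + 1)), by positivity, ?_, ?_⟩
    · calc _ ≤ (1 / 2 / ((K : ℝ) + 1)) * ((K : ℝ) + 1) := by
            gcongr
            · exact min_le_left _ _
            · simp
        _ = 1 / 2 := by field_simp
    · calc _ ≤ (r / 4 / (C + 1)) * (C + 1) := by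
            gcongr
            · exact min_le_right _ _
            · linarith
        _ = r / 4 := by field_simp
  obtain ⟨V₀, hV₀, hp₀V₀, hV₀U, hV₀β⟩ : ∃ V₀ : Set P, IsOpen V₀ ∧ p₀ ∈ V₀ ∧ V₀ ⊆ U ∧
      ∀ p ∈ V₀, dist (β p) (β p₀) ≤ r / 4 := by
    have h1 := (hβ.continuousOn.continuousAt (hU.mem_nhds hp₀)).eventually
      (Metric.closedBall_mem_nhds (β p₀) (by positivity : 0 < r / 4))
    obtain ⟨V₀, h2, h3, h4⟩ := mem_nhds_iff.1 (h1.and (hU.mem_nhds hp₀))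
    exact ⟨V₀, h3, h4, fun p hp ↦ (h2 hp).2, fun p hp ↦ (h2 hp).1⟩
  -- the initial point of the curve through `p` depends only on the projection of `p` along `e`
  let pr : P →L[ℝ] P := ContinuousLinearMap.id ℝ P - σ.smulRight e
  have hpr : ∀ p, pr p = p - σ p • e := fun p ↦ by simp [pr]
  let V : Set P := pr ⁻¹' V₀ ∩ {p | σ p < ε}
  have hV : IsOpen V := (hV₀.preimage pr.continuous).inter
    (isOpen_lt σ.continuous continuous_const)
  have hp₀V : p₀ ∈ V := by
    refine ⟨?_, ?_⟩
    · simpa [hpr, hσ₀] using hp₀V₀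
    · simpa [hσ₀] using hε
  let D : Set P := {p | 0 ≤ σ p} ∩ V
  -- `𝒮` is the domain of the Picard map, `𝒵` a closed subset of it that contains its values
  let 𝒮 : Set C(unitInterval, E) := {z | ∀ t, z t ∈ S}
  let 𝒵 : Set C(unitInterval, E) := {z | ∀ t, 0 ≤ ℓ (z t) ∧ dist (z t) (β p₀) ≤ r / 2}
  have h𝒵𝒮 : 𝒵 ⊆ 𝒮 := fun z hz t ↦ ⟨(hz t).1, lt_of_le_of_lt (hz t).2 (half_lt_self hr)⟩
  let N : C(unitInterval, E) → C(unitInterval, E) := superposition Y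
  have hN : ∀ z ∈ 𝒮, ∀ t, N z t = Y (z t) := fun z hz t ↦
    superposition_apply hYS.continuousOn hz t
  let T : P → C(unitInterval, E) → C(unitInterval, E) := fun p z ↦
    ContinuousMap.const _ (β (pr p)) + σ p • primitive E (N z)
  have hNb : ∀ z ∈ 𝒮, ‖N z‖ ≤ C := fun z hz ↦ (ContinuousMap.norm_le _ hC).2 fun t ↦ by
    rw [hN z hz]; exact (hYC _ (hz t)).1
  have hNLip : ∀ z ∈ 𝒮, ∀ w ∈ 𝒮, ‖N z - N w‖ ≤ K * ‖z - w‖ := fun z hz w hw ↦ by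
    refine (ContinuousMap.norm_le _ (by positivity)).2 fun t ↦ ?_
    rw [ContinuousMap.sub_apply, hN z hz, hN w hw, ← dist_eq_norm]
    refine (hLip.dist_le_mul _ (hz t) _ (hw t)).trans ?_
    rw [dist_eq_norm]
    gcongr
    exact (z - w).norm_coe_le_norm t
  have hT𝒵 : ∀ p ∈ D, ∀ z ∈ 𝒮, T p z ∈ 𝒵 := by
    intro p hp z hz t
    have hp1 : 0 ≤ σ p := hp.1
    have hp3 : pr p ∈ V₀ := hp.2.1
    have hp4 : σ p < ε := hp.2.2
    constructor
    · have h1 := hβℓ _ (hV₀U hp3)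
      have h2 := map_primitive_nonneg ℓ (u := N z) (fun t ↦ by rw [hN z hz]; exact (hYC _ (hz t)).2) t
      simp only [T, ContinuousMap.add_apply, ContinuousMap.const_apply, ContinuousMap.smul_apply,
        map_add, map_smul, smul_eq_mul]
      positivity
    · have h1 := hV₀β _ hp3
      have h2 : ‖σ p • primitive E (N z) t‖ ≤ r / 4 := by
        rw [norm_smul, Real.norm_of_nonneg hp1]
        refine le_trans ?_ hεC
        gcongr
        exact ((primitive E (N z)).norm_coe_le_norm t).trans ((norm_primitive_le _).trans (hNb z hz))
      calc dist (T p z t) (β p₀) ≤ dist (T p z t) (β (pr p)) + dist (β (pr p)) (β p₀) :=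
            dist_triangle _ _ _
        _ ≤ r / 4 + r / 4 := by
            gcongr
            rw [dist_eq_norm]
            simpa [T] using h2
        _ = r / 2 := by ring
  have hTc : ∀ p ∈ D, ∀ z ∈ 𝒮, ∀ w ∈ 𝒮, ‖T p z - T p w‖ ≤ 1 / 2 * ‖z - w‖ := by
    intro p hp z hz w hw
    have hp1 : 0 ≤ σ p := hp.1
    have hp4 : σ p < ε := hp.2.2
    have : T p z - T p w = σ p • primitive E (N z - N w) := by simp [T, smul_sub]
    rw [this, norm_smul, Real.norm_of_nonneg hp1]
    calc σ p * ‖primitive E (N z - N w)‖ ≤ ε * (K * ‖z - w‖) := by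
          gcongr
          exact (norm_primitive_le _).trans (hNLip z hz w hw)
      _ = (ε * K) * ‖z - w‖ := by ring
      _ ≤ _ := by gcongr
  have h𝒵closed : IsClosed 𝒵 := by
    have : 𝒵 = ⋂ t, {z | 0 ≤ ℓ (z t) ∧ dist (z t) (β p₀) ≤ r / 2} := by ext; simp [𝒵]
    rw [this]
    refine isClosed_iInter fun t ↦ ?_
    have hev : Continuous fun z : C(unitInterval, E) ↦ z t := continuous_eval_const t
    exact (isClosed_le continuous_const (ℓ.continuous.comp hev)).inter
      (isClosed_le (hev.dist continuous_const) continuous_const)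
  have hex : ∀ p ∈ D, ∃ z ∈ 𝒵, T p z = z := by
    intro p hp
    have hmaps : MapsTo (T p) 𝒵 𝒵 := fun z hz ↦ hT𝒵 p hp z (h𝒵𝒮 hz)
    have hcon : ContractingWith (1 / 2 : NNReal) (hmaps.restrict (T p) 𝒵 𝒵) := by
      refine ⟨by norm_num, LipschitzWith.of_dist_le_mul fun z w ↦ ?_⟩
      rw [Subtype.dist_eq, Subtype.dist_eq, dist_eq_norm, dist_eq_norm]
      simpa using hTc p hp z (h𝒵𝒮 z.2) w (h𝒵𝒮 w.2)
    have hz₀ : ContinuousMap.const _ (β p₀) ∈ 𝒵 := fun t ↦ ⟨hβℓ p₀ hp₀, by simpa using (half_pos hr).le⟩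
    obtain ⟨z, hz, hfix, -⟩ := hcon.exists_fixedPoint' h𝒵closed.isComplete hmaps hz₀
      (edist_ne_top _ _)
    exact ⟨z, hz, hfix⟩
  choose! Z hZ𝒵 hZfix using hex
  have hZ𝒮 : ∀ p ∈ D, Z p ∈ 𝒮 := fun p hp ↦ h𝒵𝒮 (hZ𝒵 p hp)
  have huniq : ∀ p ∈ D, ∀ z ∈ 𝒮, T p z = z → z = Z p := by
    intro p hp z hz hzf
    have := hTc p hp z hz (Z p) (hZ𝒮 p hp)
    rw [hzf, hZfix p hp] at this
    have h0 : ‖z - Z p‖ ≤ 0 := by linarith [norm_nonneg (z - Z p)]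
    exact sub_eq_zero.1 (norm_le_zero_iff.1 h0)
  have hβc : ContinuousOn (fun p ↦ β (pr p)) D := hβ.continuousOn.comp pr.continuous.continuousOn
    fun p hp ↦ hV₀U hp.2.1
  have hZc : ContinuousOn Z D := by
    intro p hp
    rw [ContinuousWithinAt, tendsto_iff_norm_sub_tendsto_zero]
    have hlim : Tendsto (fun q ↦ 2 * (‖β (pr q) - β (pr p)‖ + |σ q - σ p| * C)) (𝓝[D] p) (𝓝 0) := by
      have h1 := tendsto_iff_norm_sub_tendsto_zero.1 (hβc p hp)
      have h2 : Tendsto (fun q ↦ |σ q - σ p|) (𝓝[D] p) (𝓝 0) := by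
        have : Continuous fun q ↦ |σ q - σ p| := by fun_prop
        simpa using (this.tendsto p).mono_left nhdsWithin_le_nhds
      simpa using (h1.add (h2.mul_const C)).const_mul 2
    refine squeeze_zero' (Eventually.of_forall fun _ ↦ norm_nonneg _) ?_ hlim
    filter_upwards [self_mem_nhdsWithin] with q hq
    have h1 : Z q - Z p = (T q (Z q) - T q (Z p)) + (T q (Z p) - T p (Z p)) := by
      rw [hZfix q hq, hZfix p hp]; abel
    have h2 := hTc q hq (Z q) (hZ𝒮 q hq) (Z p) (hZ𝒮 p hp)
    have h3 : ‖T q (Z p) - T p (Z p)‖ ≤ ‖β (pr q) - β (pr p)‖ + |σ q - σ p| * C := by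
      have : T q (Z p) - T p (Z p) = ContinuousMap.const _ (β (pr q) - β (pr p)) +
          (σ q - σ p) • primitive E (N (Z p)) := by
        ext t
        simp only [T, ContinuousMap.sub_apply, ContinuousMap.add_apply, ContinuousMap.const_apply,
          ContinuousMap.smul_apply, sub_smul]
        abel
      rw [this]
      refine (norm_add_le _ _).trans (add_le_add ?_ ?_)
      · exact (ContinuousMap.norm_le _ (norm_nonneg _)).2 fun t ↦ le_rfl
      · rw [norm_smul, Real.norm_eq_abs]
        gcongr
        exact (norm_primitive_le _).trans (hNb _ (hZ𝒮 p hp))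
    have h4 : ‖Z q - Z p‖ ≤ ‖T q (Z q) - T q (Z p)‖ + ‖T q (Z p) - T p (Z p)‖ := by
      conv_lhs => rw [h1]
      exact norm_add_le _ _
    linarith
  -- smoothness in the parameter
  let a : P → C(unitInterval, E) := fun p ↦ ContinuousMap.const _ (β (pr p))
  let U' : Set P := pr ⁻¹' U
  have hU' : IsOpen U' := hU.preimage pr.continuous
  have ha : ContDiffOn ℝ ∞ a U' := by
    have h1 : ContDiffOn ℝ ∞ (fun p ↦ β (pr p)) U' :=
      hβ.comp pr.contDiff.contDiffOn fun p hp ↦ hp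
    exact (ContinuousLinearMap.const ℝ unitInterval (M := E)).contDiff.comp_contDiffOn h1
  have hDU' : D ⊆ U' := fun p hp ↦ hV₀U hp.2.1
  let Y' : E → E →L[ℝ] E := fderivWithin ℝ Y S
  have hUS := uniqueDiffOn_convex hSconv hSint
  have hY'S : ContDiffOn ℝ ∞ Y' S := hYS.fderivWithin hUS (by simp)
  let N' : C(unitInterval, E) → C(unitInterval, E) →L[ℝ] C(unitInterval, E) := fun z ↦
    pointwiseApply _ E E (superposition Y' z)
  have hNd : ∀ z ∈ 𝒮, HasFDerivWithinAt N (N' z) 𝒮 z := fun z hz ↦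
    hasFDerivWithinAt_superposition hSconv (fun x hx ↦
        ((hYS.differentiableOn (by simp)) x hx).hasFDerivWithinAt) hY'S.continuousOn hz
  have hNs : ContDiffOn ℝ ∞ N 𝒮 := contDiffOn_superposition hSconv hSint hYS
  have hN's : ContDiffOn ℝ ∞ N' 𝒮 := contDiffOn_pointwiseApply_superposition hSconv hSint hY'S
  have hZs : ContDiffOn ℝ ∞ Z D := by
    refine contDiffOn_fixedPoint σ (primitive E) hU' hDU' ha hNd hNs hN's hZc hZ𝒮 hZfix ?_
    intro p hp
    have hp1 : 0 ≤ σ p := hp.1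
    have hp4 : σ p < ε := hp.2.2
    refine lt_of_le_of_lt (ContinuousLinearMap.opNorm_le_bound _
      (by norm_num : (0 : ℝ) ≤ 1 / 2) fun v ↦ ?_) (by norm_num : (1 / 2 : ℝ) < 1)
    have h1 : ‖N' (Z p) v‖ ≤ K * ‖v‖ := by
      refine (ContinuousMap.norm_le _ (by positivity)).2 fun t ↦ ?_
      simp only [N', pointwiseApply_apply,
        superposition_apply hY'S.continuousOn (hZ𝒮 p hp)]
      exact ContinuousLinearMap.le_of_opNorm_le_of_le _ (hDK _ (hZ𝒮 p hp t))
        (v.norm_coe_le_norm t)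
    calc ‖(σ p • (primitive E ∘L N' (Z p))) v‖ = σ p * ‖primitive E (N' (Z p) v)‖ := by
          rw [smul_apply, norm_smul, Real.norm_of_nonneg hp1]; rfl
      _ ≤ ε * (K * ‖v‖) := by
          gcongr
          exact (norm_primitive_le _).trans h1
      _ = ε * K * ‖v‖ := by ring
      _ ≤ 1 / 2 * ‖v‖ := by gcongr
  let Ψ : P → E := fun p ↦ Z p 1
  have hΨ : ContDiffOn ℝ ∞ Ψ D := by
    change ContDiffOn ℝ ∞ (fun p ↦ ContinuousMap.evalCLM ℝ (1 : unitInterval) (Z p)) D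
    exact (ContinuousMap.evalCLM ℝ (1 : unitInterval)).contDiff.comp_contDiffOn hZs
  have hfix : ∀ p ∈ D, ∀ t, Z p t = β (pr p) + σ p • ∫ x in (0 : ℝ)..t,
      IccExtend zero_le_one (N (Z p)) x := by
    intro p hp t
    conv_lhs => rw [← hZfix p hp]
    rfl
  have hpre : pr e = 0 := by simp [hpr, he]
  -- the initial piece of the curve through `p`, reparametrised to `[0, 1]`, is the curve through an
  -- earlier point of the line `p + ℝ e`: both are fixed points of the same Picard map
  have hshift : ∀ p ∈ D, ∀ t : unitInterval, p - ((1 - (t : ℝ)) * σ p) • e ∈ D ∧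
      Ψ (p - ((1 - (t : ℝ)) * σ p) • e) = Z p t := by
    intro p hp t
    have hp1 : 0 ≤ σ p := hp.1
    have hp4 : σ p < ε := hp.2.2
    have e1 : pr (p - ((1 - (t : ℝ)) * σ p) • e) = pr p := by simp [hpre]
    have e2 : σ (p - ((1 - (t : ℝ)) * σ p) • e) = t * σ p := by simp [he]; ring
    have hmem : p - ((1 - (t : ℝ)) * σ p) • e ∈ D := by
      refine ⟨?_, ?_, ?_⟩
      · change 0 ≤ σ _
        rw [e2]; exact mul_nonneg t.2.1 hp1
      · change pr _ ∈ V₀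
        rw [e1]; exact hp.2.1
      · change σ _ < ε
        rw [e2]; exact lt_of_le_of_lt (mul_le_of_le_one_left hp1 t.2.2) hp4
    refine ⟨hmem, ?_⟩
    let w : C(unitInterval, E) := (Z p).comp ⟨fun x ↦ t * x, by fun_prop⟩
    have hw : w ∈ 𝒮 := fun x ↦ hZ𝒮 p hp _
    have hwT : T (p - ((1 - (t : ℝ)) * σ p) • e) w = w := by
      ext x
      have h1 : w x = Z p (t * x) := rfl
      rw [h1, hfix p hp]
      simp only [T, ContinuousMap.add_apply, ContinuousMap.const_apply, ContinuousMap.smul_apply,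
        e1, e2, primitive_apply]
      congr 1
      rw [mul_comm, mul_smul]
      congr 1
      have h2 := intervalIntegral.smul_integral_comp_mul_left (a := 0) (b := x)
        (IccExtend zero_le_one (N (Z p))) (t : ℝ)
      rw [mul_zero] at h2
      rw [show ((t * x : unitInterval) : ℝ) = t * x from rfl, ← h2]
      congr 1
      refine intervalIntegral.integral_congr fun y hy ↦ ?_
      rw [uIcc_of_le x.2.1] at hy
      have hy1 : y ∈ Icc (0 : ℝ) 1 := ⟨hy.1, hy.2.trans x.2.2⟩
      have hy2 : (t : ℝ) * y ∈ Icc (0 : ℝ) 1 := (t * ⟨y, hy1⟩ : unitInterval).2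
      simp only [IccExtend_of_mem _ _ hy1, IccExtend_of_mem _ _ hy2]
      rw [hN w hw, hN _ (hZ𝒮 p hp)]
      rfl
    have := huniq _ hmem w hw hwT
    simp only [Ψ, ← this]
    simp [w]
  have hUD : UniqueDiffOn ℝ D := by
    refine UniqueDiffOn.inter (uniqueDiffOn_convex
      ((convex_Ici 0).linear_preimage σ.toLinearMap) ⟨e, mem_interior.2
        ⟨{p | 0 < σ p}, fun x (hx : 0 < σ x) ↦ hx.le, isOpen_lt continuous_const σ.continuous, ?_⟩⟩) hV
    change 0 < σ e
    rw [he]; exact zero_lt_one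
  -- by `hshift` the derivative of `Ψ` along `e`, scaled by `σ p`, is that of the curve at time `1`
  have hderpos : ∀ p ∈ D, 0 < σ p → fderivWithin ℝ Ψ D p e = Y (Ψ p) := by
    intro p hp hp0
    have h1 : HasDerivWithinAt (fun t : ℝ ↦ Ψ (p - ((1 - t) * σ p) • e))
        (fderivWithin ℝ Ψ D p (σ p • e)) (Icc 0 1) 1 := by
      have h2 : HasDerivWithinAt (fun t : ℝ ↦ p - ((1 - t) * σ p) • e) (σ p • e) (Icc 0 1) 1 := by
        have : HasDerivAt (fun t : ℝ ↦ p - ((1 - t) * σ p) • e) (-((-1 * σ p) • e)) 1 :=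
          ((((hasDerivAt_id (1 : ℝ)).const_sub 1).mul_const (σ p)).smul_const e).const_sub p
        simpa using this.hasDerivWithinAt
      have h3 : HasFDerivWithinAt Ψ (fderivWithin ℝ Ψ D p) D (p - ((1 - (1 : ℝ)) * σ p) • e) := by
        simpa using ((hΨ.differentiableOn (by simp)) p hp).hasFDerivWithinAt
      exact h3.comp_hasDerivWithinAt (1 : ℝ) h2 fun t ht ↦ (hshift p hp ⟨t, ht⟩).1
    have h4 : HasDerivWithinAt (fun t : ℝ ↦ Ψ (p - ((1 - t) * σ p) • e))
        (σ p • Y (Ψ p)) (Icc 0 1) 1 := by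
      have h5 : HasDerivAt (fun t : ℝ ↦ β (pr p) + σ p • ∫ x in (0 : ℝ)..t,
          IccExtend zero_le_one (N (Z p)) x) (σ p • IccExtend zero_le_one (N (Z p)) 1) 1 :=
        ((intervalIntegral.integral_hasDerivAt_right
          ((N (Z p)).continuous.Icc_extend'.intervalIntegrable _ _)
          ((N (Z p)).continuous.Icc_extend'.stronglyMeasurableAtFilter _ _)
          (N (Z p)).continuous.Icc_extend'.continuousAt).const_smul (σ p)).const_add _
      have h6 : IccExtend zero_le_one (N (Z p)) 1 = Y (Ψ p) := by
        rw [IccExtend_right, hN _ (hZ𝒮 p hp)]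
        rfl
      rw [h6] at h5
      refine h5.hasDerivWithinAt.congr_of_mem (fun t ht ↦ ?_) (right_mem_Icc.2 zero_le_one)
      rw [(hshift p hp ⟨t, ht⟩).2, hfix p hp]
    have h7 := (uniqueDiffOn_Icc (zero_lt_one (α := ℝ)) 1 (right_mem_Icc.2 zero_le_one)).eq_deriv _ h1 h4
    rw [map_smul] at h7
    exact smul_right_injective E hp0.ne' h7
  refine ⟨V, hV, hp₀V, fun p hp ↦ hpr p ▸ hV₀U hp.1, Ψ, hΨ,
    fun p hp ↦ ⟨(hZ𝒮 p hp 1).1, hrO (hZ𝒮 p hp 1).2⟩, ?_, ?_⟩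
  · intro p hp h0
    have hpD : p ∈ D := ⟨h0.ge, hp⟩
    simp only [Ψ, hfix p hpD, h0, hpr]
    simp
  · intro p hp
    rcases eq_or_lt_of_le (show 0 ≤ σ p from hp.1) with h0 | h0
    · -- on the initial hypersurface the identity follows by continuity
      have hcl : p ∈ closure (D ∩ {q | 0 < σ q}) := by
        refine mem_closure_of_tendsto (f := fun t : ℝ ↦ p + t • e) (b := 𝓝[>] 0) ?_ ?_
        · have : Continuous fun t : ℝ ↦ p + t • e := by fun_prop
          simpa using (this.tendsto 0).mono_left nhdsWithin_le_nhds
        · have h1 : ∀ᶠ t in 𝓝[>] (0 : ℝ), p + t • e ∈ V := by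
            have : Continuous fun t : ℝ ↦ p + t • e := by fun_prop
            refine (this.tendsto 0).mono_left nhdsWithin_le_nhds (hV.mem_nhds ?_)
            simpa using hp.2
          filter_upwards [h1, self_mem_nhdsWithin] with t ht ht0
          have : 0 < σ (p + t • e) := by simpa [← h0, he] using ht0
          exact ⟨⟨this.le, ht⟩, this⟩
      have hc1 : ContinuousWithinAt (fun q ↦ fderivWithin ℝ Ψ D q e - Y (Ψ q))
          (D ∩ {q | 0 < σ q}) p := by
        have h2 : ContinuousOn (fun q ↦ fderivWithin ℝ Ψ D q e) D :=
          (hΨ.fderivWithin (m := ∞) hUD (by simp)).continuousOn.clm_apply continuousOn_const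
        have h3 : ContinuousOn (fun q ↦ Y (Ψ q)) D :=
          hYS.continuousOn.comp hΨ.continuousOn fun q hq ↦ hZ𝒮 q hq 1
        exact ((h2 p hp).sub (h3 p hp)).mono inter_subset_left
      have hc2 : Tendsto (fun q ↦ fderivWithin ℝ Ψ D q e - Y (Ψ q)) (𝓝[D ∩ {q | 0 < σ q}] p) (𝓝 0) := by
        refine tendsto_const_nhds.congr' ?_
        filter_upwards [self_mem_nhdsWithin] with q hq
        rw [hderpos q hq.1 hq.2, sub_self]
      have : (𝓝[D ∩ {q | 0 < σ q}] p).NeBot := mem_closure_iff_nhdsWithin_neBot.1 hcl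
      exact sub_eq_zero.1 (tendsto_nhds_unique hc1 hc2)
    · exact hderpos p hp h0

end Flow

/-! ### Inverse function theorem and flow boxes on a half-space -/

section HalfSpaceInverse

variable {E : Type*} [NormedAddCommGroup E] [NormedSpace ℝ E] [CompleteSpace E]

/-- Inverse function theorem on a half-space, for maps preserving the half-space and its boundary.
The nonlinear part of `f` is extended to the other side by the retraction onto the half-space along
`e`; the resulting map approximates the linear part well enough to be a local homeomorphism, and
one-sided smoothness of the inverse follows from `contDiffOn_right_inverse`. -/
theorem exists_halfSpace_localInverse (ℓ : E →L[ℝ] ℝ) {e : E} (he : ℓ e = 1) {V : Set E}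
    (hV : IsOpen V) {f : E → E} (hf : ContDiffOn ℝ ∞ f ({x | 0 ≤ ℓ x} ∩ V)) {p₀ : E} (hp₀ : p₀ ∈ V)
    (hℓp₀ : ℓ p₀ = 0) (L : E ≃L[ℝ] E)
    (hL : fderivWithin ℝ f ({x | 0 ≤ ℓ x} ∩ V) p₀ = (L : E →L[ℝ] E)) (hLe : 0 < ℓ (L e))
    (hf0 : ∀ p ∈ V, ℓ p = 0 → ℓ (f p) = 0) (hf1 : ∀ p ∈ V, 0 ≤ ℓ p → 0 ≤ ℓ (f p)) :
    ∃ T : OpenPartialHomeomorph E E, p₀ ∈ T.source ∧ T.source ⊆ V ∧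
      EqOn T f ({x | 0 ≤ ℓ x} ∩ T.source) ∧ (∀ y ∈ T.source, 0 ≤ ℓ (T y) ↔ 0 ≤ ℓ y) ∧
      ContDiffOn ℝ ∞ T ({x | 0 ≤ ℓ x} ∩ T.source) ∧
      ContDiffOn ℝ ∞ T.symm ({x | 0 ≤ ℓ x} ∩ T.target) := by
  set H : Set E := {x | 0 ≤ ℓ x} with hHdef
  have hH : Convex ℝ H := (convex_Ici 0).linear_preimage ℓ.toLinearMap
  have hint : (interior H).Nonempty := ⟨e, mem_interior.2
    ⟨{p | 0 < ℓ p}, fun x (hx : 0 < ℓ x) ↦ hx.le, isOpen_lt continuous_const ℓ.continuous, by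
      change 0 < ℓ e
      rw [he]; exact zero_lt_one⟩⟩
  have hUD : UniqueDiffOn ℝ (H ∩ V) := (uniqueDiffOn_convex hH hint).inter hV
  have hp₀H : p₀ ∈ H := hℓp₀.ge
  have hDc := (hf.fderivWithin (m := ∞) hUD (by simp)).continuousOn
  -- a neighbourhood on which the derivative is invertible
  obtain ⟨W, hW, hp₀W, hWinv⟩ : ∃ W, IsOpen W ∧ p₀ ∈ W ∧ ∀ y ∈ H ∩ V ∩ W,
      (fderivWithin ℝ f (H ∩ V) y).IsInvertible := by
    have h1 := hDc p₀ ⟨hp₀H, hp₀⟩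
    have h2 := h1.eventually (hL ▸ ContinuousLinearEquiv.nhds L)
    obtain ⟨W, hW, hp₀W, h⟩ := mem_nhdsWithin.1 h2
    refine ⟨W, hW, hp₀W, fun y hy ↦ ?_⟩
    obtain ⟨A, hA⟩ := h ⟨hy.2, hy.1⟩
    exact ⟨A, hA⟩
  -- a Lipschitz constant of the retraction `ret` onto the half-space along `e`
  let κ : NNReal := 1 + ‖ℓ‖₊ * ‖e‖₊
  have hκ : 0 < κ := by positivity
  -- if `f - L` is `c`-Lipschitz then `F - L` below is `c κ`-Lipschitz, which has to be smaller than
  -- the reciprocal of the norm of `L⁻¹`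
  obtain ⟨c, hc, hcL⟩ : ∃ c : NNReal, 0 < c ∧ (Subsingleton E ∨ c * κ < ‖(L.symm : E →L[ℝ] E)‖₊⁻¹) := by
    rcases subsingleton_or_nontrivial E with h | h
    · exact ⟨1, one_pos, Or.inl h⟩
    · have : 0 < ‖(L.symm : E →L[ℝ] E)‖₊⁻¹ := by
        have := L.nnnorm_symm_pos
        positivity
      refine ⟨‖(L.symm : E →L[ℝ] E)‖₊⁻¹ / κ / 2, by positivity, Or.inr ?_⟩
      have h3 : ‖(L.symm : E →L[ℝ] E)‖₊⁻¹ / κ / 2 * κ = ‖(L.symm : E →L[ℝ] E)‖₊⁻¹ / 2 := by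
        field_simp
      rw [h3]
      exact half_lt_self this
  obtain ⟨r, hr, hrV, hrD⟩ : ∃ r > 0, Metric.ball p₀ r ⊆ V ∧ ∀ x ∈ H ∩ Metric.ball p₀ r,
      ‖fderivWithin ℝ f (H ∩ V) x - L‖ ≤ c := by
    have h1 := hDc p₀ ⟨hp₀H, hp₀⟩
    rw [ContinuousWithinAt, hL] at h1
    have h2 := h1.eventually (Metric.closedBall_mem_nhds _ (NNReal.coe_pos.2 hc))
    obtain ⟨r₁, hr₁, h3⟩ := Metric.mem_nhdsWithin_iff.1 h2
    obtain ⟨r₂, hr₂, h4⟩ := Metric.isOpen_iff.1 hV p₀ hp₀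
    refine ⟨min r₁ r₂, lt_min hr₁ hr₂,
      (Metric.ball_subset_ball (min_le_right _ _)).trans h4, fun x hx ↦ ?_⟩
    have := h3 ⟨Metric.ball_subset_ball (min_le_left _ _) hx.2, hx.1,
      h4 (Metric.ball_subset_ball (min_le_right _ _) hx.2)⟩
    simpa [dist_eq_norm] using this
  let ret : E → E := fun y ↦ y + (max (ℓ y) 0 - ℓ y) • e
  have hretH : ∀ y, ℓ (ret y) = max (ℓ y) 0 := fun y ↦ by simp [ret, he]
  have hret1 : ∀ y ∈ H, ret y = y := fun y hy ↦ by
    have : max (ℓ y) 0 = ℓ y := max_eq_left hy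
    simp [ret, this]
  have hretL : ∀ x y, ‖ret x - ret y‖ ≤ κ * ‖x - y‖ := by
    intro x y
    have h1 : ret x - ret y = (x - y) + ((max (ℓ x) 0 - ℓ x) - (max (ℓ y) 0 - ℓ y)) • e := by
      simp only [ret, sub_smul]; abel
    have h2 : |(max (ℓ x) 0 - ℓ x) - (max (ℓ y) 0 - ℓ y)| ≤ |ℓ x - ℓ y| := by
      rcases max_cases (ℓ x) 0 with ⟨h, h'⟩ | ⟨h, h'⟩ <;> rcases max_cases (ℓ y) 0 with ⟨k, k'⟩ | ⟨k, k'⟩ <;>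
        rw [h, k, abs_le] <;> constructor <;>
        first
          | (have := neg_abs_le (ℓ x - ℓ y); have := le_abs_self (ℓ x - ℓ y); linarith)
    have h3 : |ℓ x - ℓ y| ≤ ‖ℓ‖ * ‖x - y‖ := by
      rw [← map_sub, ← Real.norm_eq_abs]; exact ℓ.le_opNorm _
    rw [h1]
    refine (norm_add_le _ _).trans ?_
    rw [norm_smul, Real.norm_eq_abs]
    have h4 : |(max (ℓ x) 0 - ℓ x) - (max (ℓ y) 0 - ℓ y)| * ‖e‖ ≤ ‖ℓ‖ * ‖x - y‖ * ‖e‖ := by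
      gcongr; exact h2.trans h3
    have h5 : (κ : ℝ) = 1 + ‖ℓ‖ * ‖e‖ := by simp [κ]
    rw [h5]
    nlinarith
  have hretB : ∀ y ∈ Metric.ball p₀ (r / κ), ret y ∈ H ∩ Metric.ball p₀ r := by
    intro y hy
    refine ⟨?_, ?_⟩
    · change 0 ≤ ℓ (ret y)
      rw [hretH]; exact le_max_right _ _
    · have h1 := hretL y p₀
      rw [hret1 p₀ hp₀H] at h1
      rw [Metric.mem_ball, dist_eq_norm] at hy ⊢
      refine h1.trans_lt ?_
      calc (κ : ℝ) * ‖y - p₀‖ < κ * (r / κ) := by gcongr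
        _ = r := by field_simp
  have hκ' : (0 : ℝ) < κ := hκ
  let F : E → E := fun y ↦ L y + (f (ret y) - L (ret y))
  have hlip : ∀ x ∈ H ∩ Metric.ball p₀ r, ∀ y ∈ H ∩ Metric.ball p₀ r,
      ‖f x - f y - L (x - y)‖ ≤ c * ‖x - y‖ := by
    intro x hx y hy
    refine (hH.inter (convex_ball p₀ r)).norm_image_sub_le_of_norm_hasFDerivWithin_le' (𝕜 := ℝ)
      (f' := fderivWithin ℝ f (H ∩ V)) (φ := (L : E →L[ℝ] E)) (fun z hz ↦ ?_) (fun z hz ↦ hrD z hz) hy hx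
    exact ((hf.differentiableOn (by simp)) z ⟨hz.1, hrV hz.2⟩).hasFDerivWithinAt.mono
      (inter_subset_inter_right _ hrV)
  have happ : ApproximatesLinearOn F (L : E →L[ℝ] E) (Metric.ball p₀ (r / κ)) (c * κ) := by
    intro x hx y hy
    have h1 := hlip _ (hretB x hx) _ (hretB y hy)
    have h2 : F x - F y - (L : E →L[ℝ] E) (x - y) = f (ret x) - f (ret y) - L (ret x - ret y) := by
      simp only [F, map_sub, ContinuousLinearEquiv.coe_coe]; abel
    rw [h2]
    refine h1.trans ?_
    push_cast
    rw [mul_assoc]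
    gcongr
    exact hretL x y
  let T₀ := happ.toOpenPartialHomeomorph F _ hcL Metric.isOpen_ball
  let T := T₀.restrOpen W hW
  have hTF : ∀ y, T y = F y := fun y ↦ rfl
  have hsrc : T.source = Metric.ball p₀ (r / κ) ∩ W := by
    simp only [T, T₀, ApproximatesLinearOn.toOpenPartialHomeomorph, OpenPartialHomeomorph.restrOpen_source]
    rfl
  have hsrcV : T.source ⊆ V := by
    rw [hsrc]
    rintro y ⟨hy, -⟩
    refine hrV (Metric.ball_subset_ball ?_ hy)
    have : (1 : ℝ) ≤ κ := by simp only [κ, NNReal.coe_add, NNReal.coe_one]; simp; positivity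
    exact div_le_self hr.le this
  have hTf : EqOn T f (H ∩ T.source) := fun y hy ↦ by
    rw [hTF]; simp only [F, hret1 y hy.1]; abel
  -- on the negative side `F` moves the boundary value `f (ret y)` by the multiple `ℓ y` of `L e`
  have hside : ∀ y ∈ T.source, 0 ≤ ℓ (T y) ↔ 0 ≤ ℓ y := by
    intro y hy
    constructor
    · intro h
      by_contra hneg
      push Not at hneg
      have hmax : max (ℓ y) 0 = 0 := max_eq_right hneg.le
      have hmem := hretB y (hsrc ▸ hy).1
      have h0 : ℓ (f (ret y)) = 0 := hf0 _ (hrV hmem.2) (by rw [hretH, hmax])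
      have h1 : T y = f (ret y) + ℓ y • L e := by
        rw [hTF]
        simp only [F, ret, hmax, map_add, map_smul, zero_sub, neg_smul]
        abel
      rw [h1, map_add, map_smul, h0, zero_add, smul_eq_mul] at h
      exact absurd h (not_le.2 (mul_neg_of_neg_of_pos hneg hLe))
    · intro h
      rw [hTf ⟨h, hy⟩]
      exact hf1 y (hsrcV hy) h
  have hsub : H ∩ T.source ⊆ H ∩ V := inter_subset_inter_right _ hsrcV
  refine ⟨T, ?_, hsrcV, hTf, hside, (hf.mono hsub).congr hTf, ?_⟩
  · rw [hsrc]; exact ⟨Metric.mem_ball_self (by positivity), hp₀W⟩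
  · have hmaps : MapsTo T.symm (H ∩ T.target) (H ∩ T.source) := by
      intro y hy
      have h1 := T.map_target hy.2
      refine ⟨?_, h1⟩
      have := (hside _ h1).1
      rw [T.right_inv hy.2] at this
      exact this hy.1
    refine contDiffOn_right_inverse (f := f) (f' := fderivWithin ℝ f (H ∩ V)) (s := H ∩ T.source)
      (fun x hx ↦ ?_) ?_ (T.continuousOn_symm.mono inter_subset_right) hmaps (fun y hy ↦ ?_) ?_
    · exact ((hf.differentiableOn (by simp)) x (hsub hx)).hasFDerivWithinAt.mono hsub
    · exact (hf.fderivWithin (m := ∞) hUD (by simp)).mono hsub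
    · rw [← hTf (hmaps hy), T.right_inv hy.2]
    · intro y hy
      have := hmaps hy
      exact hWinv _ ⟨hsub this, (hsrc ▸ this.2).2⟩

end HalfSpaceInverse

section FlowBox

universe u
variable {E : Type u} [NormedAddCommGroup E] [NormedSpace ℝ E] [FiniteDimensional ℝ E]

/-- Flow box at the boundary of a half-space: a vector field pointing strictly inwards is
straightened to the constant field `e` by a local diffeomorphism of the half-space with prescribed
values on the boundary. -/
theorem exists_halfSpace_flowBox (ℓ : E →L[ℝ] ℝ) {e : E} (he : ℓ e = 1)
    {O : Set E} (hO : IsOpen O) {Y : E → E} (hY : ContDiffOn ℝ ∞ Y ({x | 0 ≤ ℓ x} ∩ O))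
    {U : Set E} (hU : IsOpen U) {β : E → E} (hβ : ContDiffOn ℝ ∞ β U) (hβℓ : ∀ p ∈ U, ℓ (β p) = 0)
    {p₀ : E} (hp₀ : p₀ ∈ U) (hσ₀ : ℓ p₀ = 0) (hβO : β p₀ ∈ O) (hpos : 0 < ℓ (Y (β p₀)))
    (hinj : ∀ w, ℓ w = 0 → fderiv ℝ β p₀ w = 0 → w = 0) :
    ∃ T : OpenPartialHomeomorph E E, p₀ ∈ T.source ∧ (∀ p ∈ T.source, p - ℓ p • e ∈ U) ∧
      (∀ p ∈ {x | 0 ≤ ℓ x} ∩ T.source, T p ∈ O) ∧ (∀ y ∈ T.source, 0 ≤ ℓ (T y) ↔ 0 ≤ ℓ y) ∧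
      (∀ p ∈ T.source, ℓ p = 0 → T p = β p) ∧
      ContDiffOn ℝ ∞ T ({x | 0 ≤ ℓ x} ∩ T.source) ∧
      ContDiffOn ℝ ∞ T.symm ({x | 0 ≤ ℓ x} ∩ T.target) ∧
      ∀ p ∈ {x | 0 ≤ ℓ x} ∩ T.source, fderivWithin ℝ T {x | 0 ≤ ℓ x} p e = Y (T p) := by
  have : CompleteSpace E := FiniteDimensional.complete ℝ E
  obtain ⟨V, hV, hp₀V, hVU, Ψ, hΨ, hΨO, hΨβ, hΨY⟩ := exists_halfSpace_flow ℓ ℓ he hO hY hU hβ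
    (fun p hp ↦ (hβℓ p hp).ge) hp₀ hσ₀ hβO hpos
  set H : Set E := {x | 0 ≤ ℓ x} with hHdef
  have hp₀H : p₀ ∈ H := hσ₀.ge
  have hΨd := ((hΨ.differentiableOn (by simp)) p₀ ⟨hp₀H, hp₀V⟩).hasFDerivWithinAt
  set D := fderivWithin ℝ Ψ (H ∩ V) p₀ with hD
  have hβd : HasFDerivAt β (fderiv ℝ β p₀) p₀ :=
    ((hβ.contDiffAt (hU.mem_nhds hp₀)).differentiableAt (by simp)).hasFDerivAt
  have hDe : D e = Y (β p₀) := by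
    rw [hD, hΨY p₀ ⟨hp₀H, hp₀V⟩, hΨβ p₀ hp₀V hσ₀]
  -- on the boundary `Ψ` is `β`, so their derivatives agree in tangential directions
  have hDw : ∀ w, ℓ w = 0 → D w = fderiv ℝ β p₀ w := by
    intro w hw
    have hl : HasDerivAt (fun t : ℝ ↦ p₀ + t • w) w 0 := by
      simpa using ((hasDerivAt_id (0 : ℝ)).smul_const w).const_add p₀
    have hmem : ∀ᶠ t in 𝓝 (0 : ℝ), p₀ + t • w ∈ V := by
      have : Continuous fun t : ℝ ↦ p₀ + t • w := by fun_prop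
      exact this.continuousAt.eventually_mem (hV.mem_nhds (by simpa using hp₀V))
    have hℓ : ∀ t : ℝ, ℓ (p₀ + t • w) = 0 := fun t ↦ by simp [hw, hσ₀]
    obtain ⟨s, hs, hs0⟩ := hmem.exists_mem
    have h1 : HasDerivWithinAt (fun t : ℝ ↦ Ψ (p₀ + t • w)) (D w) s 0 := by
      have h2 : HasFDerivWithinAt Ψ D (H ∩ V) (p₀ + (0 : ℝ) • w) := by simpa using hΨd
      exact h2.comp_hasDerivWithinAt (0 : ℝ) hl.hasDerivWithinAt
        (show MapsTo (fun t : ℝ ↦ p₀ + t • w) s (H ∩ V) from fun t ht ↦ ⟨(hℓ t).ge, hs0 t ht⟩)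
    have h3 : HasDerivAt (fun t : ℝ ↦ β (p₀ + t • w)) (fderiv ℝ β p₀ w) 0 := by
      have h2 : HasFDerivAt β (fderiv ℝ β p₀) (p₀ + (0 : ℝ) • w) := by simpa using hβd
      exact h2.comp_hasDerivAt (0 : ℝ) hl
    refine (h1.hasDerivAt hs).unique (h3.congr_of_eventuallyEq ?_)
    filter_upwards [hmem] with t ht using hΨβ _ ht (hℓ t)
  have hℓβ : ∀ w, ℓ (fderiv ℝ β p₀ w) = 0 := by
    intro w
    have h1 : HasFDerivAt (fun p ↦ ℓ (β p)) (ℓ ∘L fderiv ℝ β p₀) p₀ := ℓ.hasFDerivAt.comp p₀ hβd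
    have h2 : HasFDerivAt (fun p ↦ ℓ (β p)) (0 : E →L[ℝ] ℝ) p₀ :=
      (hasFDerivAt_const (0 : ℝ) p₀).congr_of_eventuallyEq
        (by filter_upwards [hU.mem_nhds hp₀] with p hp using hβℓ p hp)
    exact congrArg (fun A : E →L[ℝ] ℝ ↦ A w) (h1.unique h2)
  have hDinj : Function.Injective D := by
    rw [injective_iff_map_eq_zero]
    intro v hv
    have hw : ℓ (v - ℓ v • e) = 0 := by simp [he]
    have h1 : D v = ℓ v • Y (β p₀) + fderiv ℝ β p₀ (v - ℓ v • e) := by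
      rw [← hDw _ hw, ← hDe, ← map_smul, ← map_add]; simp
    have h2 : ℓ v * ℓ (Y (β p₀)) = 0 := by
      have := congrArg ℓ (h1.symm.trans hv)
      rw [map_add, hℓβ, map_smul, add_zero, map_zero, smul_eq_mul] at this
      exact this
    have h3 : ℓ v = 0 := (mul_eq_zero.1 h2).resolve_right hpos.ne'
    rw [hv, h3, zero_smul, zero_smul, sub_zero, zero_add] at h1
    exact hinj v h3 h1.symm
  let L : E ≃L[ℝ] E := (LinearEquiv.ofInjectiveEndo (D : E →ₗ[ℝ] E) hDinj).toContinuousLinearEquiv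
  have hLD : (L : E →L[ℝ] E) = D := by ext; rfl
  have hLe : L e = Y (β p₀) := hDe
  obtain ⟨T, hT0, hTV, hTΨ, hTs, hT1, hT2⟩ := exists_halfSpace_localInverse ℓ he hV hΨ hp₀V hσ₀ L hLD.symm
    (by rw [hLe]; exact hpos)
    (fun p hp h0 ↦ by
      have hpU := hVU p hp
      rw [h0, zero_smul, sub_zero] at hpU
      rw [hΨβ p hp h0]; exact hβℓ p hpU) (fun p hp h0 ↦ (hΨO p ⟨h0, hp⟩).1)
  refine ⟨T, hT0, fun p hp ↦ hVU p (hTV hp), fun p hp ↦ ?_, hTs, fun p hp h0 ↦ ?_, hT1, hT2,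
    fun p hp ↦ ?_⟩
  · rw [hTΨ hp]; exact (hΨO p ⟨hp.1, hTV hp.2⟩).2
  · rw [hTΨ ⟨h0.ge, hp⟩]; exact hΨβ p (hTV hp) h0
  · rw [hTΨ hp, ← hΨY p ⟨hp.1, hTV hp.2⟩, fderivWithin_inter (hV.mem_nhds (hTV hp.2))]
    congr 1
    refine Filter.EventuallyEq.fderivWithin_eq ?_ (hTΨ hp)
    filter_upwards [self_mem_nhdsWithin, mem_nhdsWithin_of_mem_nhds (T.open_source.mem_nhds hp.2)]
      with q hq1 hq2 using hTΨ ⟨hq1, hq2⟩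

end FlowBox

/-! ### Metrics in coordinates -/

section PullForm

variable {n : ℕ} {H : Type*} [TopologicalSpace H] {I : ModelWithCorners ℝ (Euc n) H}
  {M : Type*} [TopologicalSpace M] [ChartedSpace H M] [IsManifold I ∞ M]

/-- The metric at `p` as a bilinear form on the model space, to which all tangent spaces of `M` are
definitionally equal. -/
def metricAt (g : Metric I M) (p : M) : Euc n →L[ℝ] Euc n →L[ℝ] ℝ := g.inner p

/-- The derivative of a map from a Euclidean space into `M`, within `s`, as a map of model
spaces. -/
def modelDeriv (I : ModelWithCorners ℝ (Euc n) H) {k : ℕ} (ψ : Euc k → M) (s : Set (Euc k))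
    (y : Euc k) : Euc k →L[ℝ] Euc n :=
  mfderivWithin 𝓘(ℝ, Euc k) I ψ s y

/-- The pullback of the metric `g` along a (parametrisation) map `ψ`, differentiated within `s`. -/
def pullForm (g : Metric I M) {k : ℕ} (ψ : Euc k → M) (s : Set (Euc k)) (y : Euc k) :
    Euc k →L[ℝ] Euc k →L[ℝ] ℝ :=
  (metricAt g (ψ y)).bilinearComp (modelDeriv I ψ s y) (modelDeriv I ψ s y)

/-- The metric in the coordinates of the chart `e`, as a bilinear form on the model space. -/
def coordMetric (g : Metric I M) (e : OpenPartialHomeomorph M H) (y : Euc n) :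
    Euc n →L[ℝ] Euc n →L[ℝ] ℝ :=
  pullForm g (e.extend I).symm (range I) y

theorem metricCoord_eq (g : Metric I M) (e : OpenPartialHomeomorph M H) (i j : Fin n) (y : Euc n) :
    metricCoord g e i j y =
      coordMetric g e y (EuclideanSpace.single i 1) (EuclideanSpace.single j 1) := rfl

theorem pullForm_symm (g : Metric I M) {k : ℕ} (ψ : Euc k → M) (s : Set (Euc k)) (y v w : Euc k) :
    pullForm g ψ s y v w = pullForm g ψ s y w v := g.symm _ _ _

theorem metricAt_pos (g : Metric I M) (p : M) {v : Euc n} (hv : v ≠ 0) : 0 < metricAt g p v v :=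
  g.pos p v hv

omit [IsManifold I ∞ M] in
theorem modelDeriv_congr {k : ℕ} {ψ ψ' : Euc k → M} {s : Set (Euc k)} {y : Euc k}
    (h : ψ =ᶠ[𝓝[s] y] ψ') (hy : ψ y = ψ' y) : modelDeriv I ψ s y = modelDeriv I ψ' s y :=
  h.mfderivWithin_eq hy

theorem pullForm_congr (g : Metric I M) {k : ℕ} {ψ ψ' : Euc k → M} {s : Set (Euc k)} {y : Euc k}
    (h : ψ =ᶠ[𝓝[s] y] ψ') (hy : ψ y = ψ' y) : pullForm g ψ s y = pullForm g ψ' s y := by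
  rw [pullForm, pullForm, modelDeriv_congr h hy, hy]

omit [IsManifold I ∞ M] in
theorem modelDeriv_comp {k l : ℕ} {ψ : Euc k → M} {R : Euc l → Euc k} {s : Set (Euc k)}
    {t : Set (Euc l)} {y : Euc l} (hψ : MDifferentiableWithinAt 𝓘(ℝ, Euc k) I ψ s (R y))
    (hR : DifferentiableWithinAt ℝ R t y) (hmaps : ∀ᶠ z in 𝓝[t] y, R z ∈ s)
    (ht : UniqueDiffWithinAt ℝ t y) :
    modelDeriv I (ψ ∘ R) t y = modelDeriv I ψ s (R y) ∘L fderivWithin ℝ R t y := by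
  have h1 : HasMFDerivWithinAt 𝓘(ℝ, Euc l) 𝓘(ℝ, Euc k) R t y (fderivWithin ℝ R t y) :=
    hR.hasFDerivWithinAt.hasMFDerivWithinAt
  have h2 := mfderivWithin_comp_of_preimage_mem_nhdsWithin (I := 𝓘(ℝ, Euc l))
    (I' := 𝓘(ℝ, Euc k)) (I'' := I) y hψ h1.mdifferentiableWithinAt hmaps ht.uniqueMDiffWithinAt
  rw [h1.mfderivWithin ht.uniqueMDiffWithinAt] at h2
  exact h2

theorem pullForm_comp (g : Metric I M) {k l : ℕ} {ψ : Euc k → M} {R : Euc l → Euc k}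
    {s : Set (Euc k)}
    {t : Set (Euc l)} {y : Euc l} (hψ : MDifferentiableWithinAt 𝓘(ℝ, Euc k) I ψ s (R y))
    (hR : DifferentiableWithinAt ℝ R t y) (hmaps : ∀ᶠ z in 𝓝[t] y, R z ∈ s)
    (ht : UniqueDiffWithinAt ℝ t y) (v w : Euc l) :
    pullForm g (ψ ∘ R) t y v w =
      pullForm g ψ s (R y) (fderivWithin ℝ R t y v) (fderivWithin ℝ R t y w) := by
  rw [pullForm, modelDeriv_comp hψ hR hmaps ht]
  rfl

/-- Pulling back along `h ∘ ψ` is pulling back along `ψ` a metric whose value on `T_{ψ y}` is the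
pullback along `h`. -/
theorem pullForm_map {n' : ℕ} {H' : Type*} [TopologicalSpace H']
    {I' : ModelWithCorners ℝ (Euc n') H'}
    {M' : Type*} [TopologicalSpace M'] [ChartedSpace H' M'] (g : Metric I M)
    {h : M' → M} {k : ℕ} {ψ : Euc k → M'} {s : Set (Euc k)} {y : Euc k}
    (hh : MDifferentiableAt I' I h (ψ y)) (hψ : MDifferentiableWithinAt 𝓘(ℝ, Euc k) I' ψ s y)
    (hs : UniqueDiffWithinAt ℝ s y) (v w : Euc k) :
    pullForm g (h ∘ ψ) s y v w =
      pullback I' g h (ψ y) (modelDeriv I' ψ s y v) (modelDeriv I' ψ s y w) := by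
  have h1 := hh.hasMFDerivAt.comp_hasMFDerivWithinAt y hψ.hasMFDerivWithinAt
  have h2 : modelDeriv I (h ∘ ψ) s y = (mfderiv I' I h (ψ y) : Euc n' →L[ℝ] Euc n) ∘L modelDeriv I' ψ s y :=
    h1.mfderivWithin hs.uniqueMDiffWithinAt
  rw [pullForm, h2]
  rfl

theorem contDiffOn_pullForm (g : Metric I M) {k : ℕ} {ψ : Euc k → M} {s : Set (Euc k)}
    (hψ : ContMDiffOn 𝓘(ℝ, Euc k) I ∞ ψ s) (hs : UniqueDiffOn ℝ s) :
    ContDiffOn ℝ ∞ (pullForm g ψ s) s := by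
  have hvec : ∀ v : Euc k, ContMDiffOn 𝓘(ℝ, Euc k) (I.prod 𝓘(ℝ, Euc n)) ∞
      (fun y ↦ Bundle.TotalSpace.mk' (Euc n) (E := fun x : M ↦ TangentSpace I x) (ψ y)
        (modelDeriv I ψ s y v)) s := by
    intro v
    have h1 := hψ.contMDiffOn_tangentMapWithin (m := ∞) (by simp) hs.uniqueMDiffOn
    have h2 := (contMDiff_vectorSpace_iff_contDiff (𝕜 := ℝ) (E := Euc k) (n := ∞)
      (V := fun _ ↦ v)).2 contDiff_const
    exact h1.comp h2.contMDiffOn (fun y hy ↦ hy)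
  refine contDiffOn_clm_apply.2 fun v ↦ contDiffOn_clm_apply.2 fun w ↦ ?_
  have h := ContMDiffOn.clm_bundle_apply₂ (E₃ := Bundle.Trivial M ℝ) (F₃ := ℝ) (ψ := fun y ↦ g.inner (ψ y))
    (b := ψ) (s := s)
    (g.contMDiff.comp_contMDiffOn hψ) (hvec v) (hvec w)
  intro y hy
  have h' := h y hy
  rw [Bundle.contMDiffWithinAt_totalSpace] at h'
  exact h'.2.contDiffWithinAt

end PullForm

section Charts

variable {n : ℕ} {H : Type*} [TopologicalSpace H] {I : ModelWithCorners ℝ (Euc n) H}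
  {M : Type*} [TopologicalSpace M] [ChartedSpace H M]
  {e : OpenPartialHomeomorph M H}

omit [ChartedSpace H M] in
theorem target_mem_nhdsWithin_range {y : Euc n} (hy : y ∈ (e.extend I).target) :
    (e.extend I).target ∈ 𝓝[range I] y := by
  have h := e.extend_target_mem_nhdsWithin (I := I) (y := (e.extend I).symm y)
    (by simpa using (e.extend I).map_target hy)
  rwa [(e.extend I).right_inv hy] at h

omit [ChartedSpace H M] in
theorem target_eventuallyEq_range {y : Euc n} (hy : y ∈ (e.extend I).target) :
    (e.extend I).target =ᶠ[𝓝 y] range I := by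
  have h := e.extend_target_eventuallyEq (I := I) (y := (e.extend I).symm y)
    (by simpa using (e.extend I).map_target hy)
  rwa [(e.extend I).right_inv hy] at h

omit [ChartedSpace H M] in
theorem uniqueDiffOn_extend_target : UniqueDiffOn ℝ (e.extend I).target := by
  rw [e.extend_target]
  exact I.uniqueDiffOn_preimage e.open_target

theorem contMDiffOn_extend_target_symm (he : e ∈ IsManifold.maximalAtlas I ∞ M) :
    ContMDiffOn 𝓘(ℝ, Euc n) I ∞ (e.extend I).symm (e.extend I).target := by
  rw [e.extend_target']
  exact contMDiffOn_extend_symm he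

theorem mdifferentiableWithinAt_extend_symm (he : e ∈ IsManifold.maximalAtlas I ∞ M) {y : Euc n}
    (hy : y ∈ (e.extend I).target) :
    MDifferentiableWithinAt 𝓘(ℝ, Euc n) I (e.extend I).symm (range I) y :=
  ((contMDiffOn_extend_target_symm he y hy).mdifferentiableWithinAt (by simp)).mono_of_mem_nhdsWithin
    (target_mem_nhdsWithin_range hy)

/-- The derivative of the chart `e` at `x`, as an endomorphism of the model space. -/
def chartDeriv (I : ModelWithCorners ℝ (Euc n) H) (e : OpenPartialHomeomorph M H) (x : M) :
    Euc n →L[ℝ] Euc n :=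
  mfderiv I 𝓘(ℝ, Euc n) (e.extend I) x

/-- The derivative of the inverse of the chart `e` at `y`. -/
def chartSymmDeriv (I : ModelWithCorners ℝ (Euc n) H) (e : OpenPartialHomeomorph M H) (y : Euc n) :
    Euc n →L[ℝ] Euc n :=
  modelDeriv I (e.extend I).symm (range I) y

theorem mdifferentiableAt_extend [IsManifold I ∞ M] (he : e ∈ IsManifold.maximalAtlas I ∞ M) {x : M}
    (hx : x ∈ e.source) : MDifferentiableAt I 𝓘(ℝ, Euc n) (e.extend I) x :=
  (OpenPartialHomeomorph.contMDiffAt_extend he hx).mdifferentiableAt (by simp)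

theorem chartDeriv_chartSymmDeriv [IsManifold I ∞ M] (he : e ∈ IsManifold.maximalAtlas I ∞ M)
    {y : Euc n}
    (hy : y ∈ (e.extend I).target) (v : Euc n) :
    chartDeriv I e ((e.extend I).symm y) (chartSymmDeriv I e y v) = v := by
  have hx : (e.extend I).symm y ∈ e.source := by simpa using (e.extend I).map_target hy
  have h := (mdifferentiableAt_extend he hx).hasMFDerivAt.comp_hasMFDerivWithinAt y
    (mdifferentiableWithinAt_extend_symm he hy).hasMFDerivWithinAt
  have h2 : HasMFDerivWithinAt 𝓘(ℝ, Euc n) 𝓘(ℝ, Euc n) (e.extend I ∘ (e.extend I).symm)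
      (range I) y (ContinuousLinearMap.id ℝ (Euc n)) := by
    refine HasMFDerivWithinAt.congr_of_eventuallyEq (f := id)
      (hasMFDerivAt_id (I := 𝓘(ℝ, Euc n)) y).hasMFDerivWithinAt ?_ ?_
    · filter_upwards [target_mem_nhdsWithin_range hy] with z hz using (e.extend I).right_inv hz
    · exact (e.extend I).right_inv hy
  have hu : UniqueMDiffWithinAt 𝓘(ℝ, Euc n) (range I) y :=
    (I.uniqueDiffOn y (e.extend_target_subset_range hy)).uniqueMDiffWithinAt
  have h3 := (hu.eq h h2)
  exact congrArg (fun L : Euc n →L[ℝ] Euc n ↦ L v) h3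

theorem chartSymmDeriv_chartDeriv [IsManifold I ∞ M] (he : e ∈ IsManifold.maximalAtlas I ∞ M)
    {x : M} (hx : x ∈ e.source) (v : Euc n) :
    chartSymmDeriv I e (e.extend I x) (chartDeriv I e x v) = v := by
  have hy : e.extend I x ∈ (e.extend I).target := (e.extend I).map_source (by simpa using hx)
  have hxy : (e.extend I).symm (e.extend I x) = x := (e.extend I).left_inv (by simpa using hx)
  have key : ∀ w, chartDeriv I e x (chartSymmDeriv I e (e.extend I x) w) = w := by
    intro w
    have := chartDeriv_chartSymmDeriv he hy w
    rwa [hxy] at this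
  have hsurj : Function.Surjective (chartDeriv I e x).toLinearMap := fun w ↦ ⟨_, key w⟩
  have hinj := LinearMap.injective_iff_surjective.2 hsurj
  exact hinj (key _)

theorem coordMetric_chartDeriv [IsManifold I ∞ M] (g : Metric I M)
    (he : e ∈ IsManifold.maximalAtlas I ∞ M) {x : M} (hx : x ∈ e.source) (v w : Euc n) :
    coordMetric g e (e.extend I x) (chartDeriv I e x v) (chartDeriv I e x w) =
      metricAt g x v w := by
  have hxy : (e.extend I).symm (e.extend I x) = x := (e.extend I).left_inv (by simpa using hx)
  change metricAt g ((e.extend I).symm (e.extend I x)) (chartSymmDeriv I e (e.extend I x) _)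
    (chartSymmDeriv I e (e.extend I x) _) = _
  rw [chartSymmDeriv_chartDeriv he hx, chartSymmDeriv_chartDeriv he hx, hxy]

theorem coordMetric_pos [IsManifold I ∞ M] (g : Metric I M)
    (he : e ∈ IsManifold.maximalAtlas I ∞ M) {y : Euc n} (hy : y ∈ (e.extend I).target)
    {v : Euc n} (hv : v ≠ 0) : 0 < coordMetric g e y v v := by
  refine metricAt_pos g _ fun h ↦ hv ?_
  have := chartDeriv_chartSymmDeriv he hy v
  rw [show chartSymmDeriv I e y v = 0 from h, map_zero] at this
  exact this.symm

theorem coordMetric_symm [IsManifold I ∞ M] (g : Metric I M) (e : OpenPartialHomeomorph M H)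
    (y v w : Euc n) : coordMetric g e y v w = coordMetric g e y w v :=
  pullForm_symm _ _ _ _ _ _

theorem contDiffOn_coordMetric [IsManifold I ∞ M] (g : Metric I M)
    (he : e ∈ IsManifold.maximalAtlas I ∞ M) :
    ContDiffOn ℝ ∞ (coordMetric g e) (e.extend I).target := by
  refine (contDiffOn_pullForm g (contMDiffOn_extend_target_symm he)
    uniqueDiffOn_extend_target).congr fun y hy ↦ ?_
  rw [coordMetric, pullForm, pullForm]
  have : modelDeriv I (e.extend I).symm (range I) y =
      modelDeriv I (e.extend I).symm (e.extend I).target y :=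
    mfderivWithin_congr_set (target_eventuallyEq_range hy).symm
  rw [this]

theorem contDiffOn_comp_extend_symm {f : M → ℝ} (hf : ContMDiff I 𝓘(ℝ, ℝ) ∞ f)
    (he : e ∈ IsManifold.maximalAtlas I ∞ M) :
    ContDiffOn ℝ ∞ (f ∘ (e.extend I).symm) (e.extend I).target :=
  (hf.comp_contMDiffOn (contMDiffOn_extend_target_symm he)).contDiffOn

theorem fderivWithin_comp_extend_symm {f : M → ℝ} (hf : ContMDiff I 𝓘(ℝ, ℝ) ∞ f)
    (he : e ∈ IsManifold.maximalAtlas I ∞ M) {y : Euc n} (hy : y ∈ (e.extend I).target)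
    (v : Euc n) :
    fderivWithin ℝ (f ∘ (e.extend I).symm) (range I) y v =
      mvfderiv I f ((e.extend I).symm y) (chartSymmDeriv I e y v) := by
  have hu : UniqueMDiffWithinAt 𝓘(ℝ, Euc n) (range I) y :=
    (I.uniqueDiffOn y (e.extend_target_subset_range hy)).uniqueMDiffWithinAt
  have h := ((hf.mdifferentiable (by simp)) ((e.extend I).symm y)).hasMFDerivAt.comp_hasMFDerivWithinAt y
    (mdifferentiableWithinAt_extend_symm he hy).hasMFDerivWithinAt
  have h2 := h.mfderivWithin hu
  rw [mfderivWithin_eq_fderivWithin] at h2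
  rw [h2]
  rfl

end Charts

/-! ### Coordinates of the half-space -/

section HalfSpace

/-- The inclusion `u ↦ (0, u)` of `ℝᵈ` as the boundary hyperplane of the half-space in `ℝᵈ⁺¹`. -/
def bdryIncl (d : ℕ) : Euc d →L[ℝ] Euc (d + 1) :=
  LinearMap.toContinuousLinearMap
    { toFun := fun u ↦ WithLp.toLp 2 (Fin.cons 0 u)
      map_add' := fun u v ↦ by
        ext i; refine Fin.cases ?_ (fun i ↦ ?_) i <;> simp
      map_smul' := fun c u ↦ by
        ext i; refine Fin.cases ?_ (fun i ↦ ?_) i <;> simp }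

/-- The projection `(t, u) ↦ u` of `ℝᵈ⁺¹` onto `ℝᵈ`. -/
def bdryProj (d : ℕ) : Euc (d + 1) →L[ℝ] Euc d :=
  LinearMap.toContinuousLinearMap
    { toFun := fun y ↦ WithLp.toLp 2 (fun i ↦ y i.succ)
      map_add' := fun u v ↦ by ext i; simp
      map_smul' := fun c u ↦ by ext i; simp }

/-- The inward basis vector `∂/∂x⁰` at the boundary of the half-space. -/
def inward (d : ℕ) : Euc (d + 1) := EuclideanSpace.single 0 1

variable {d : ℕ}

@[simp] theorem bdryIncl_zero (u : Euc d) : bdryIncl d u 0 = 0 := rfl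
@[simp] theorem bdryIncl_succ (u : Euc d) (i : Fin d) : bdryIncl d u i.succ = u i := rfl
@[simp] theorem bdryProj_apply (y : Euc (d + 1)) (i : Fin d) : bdryProj d y i = y i.succ := rfl
@[simp] theorem inward_zero : inward d 0 = 1 := by simp [inward]
@[simp] theorem inward_succ (i : Fin d) : inward d i.succ = 0 := by simp [inward]

@[simp] theorem bdryProj_bdryIncl (u : Euc d) : bdryProj d (bdryIncl d u) = u := by
  ext i; simp

theorem bdryIncl_bdryProj (y : Euc (d + 1)) :
    bdryIncl d (bdryProj d y) + y 0 • inward d = y := by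
  ext i; refine Fin.cases ?_ (fun i ↦ ?_) i <;> simp

theorem bdryIncl_bdryProj_of_zero {y : Euc (d + 1)} (hy : y 0 = 0) :
    bdryIncl d (bdryProj d y) = y := by
  simpa [hy] using bdryIncl_bdryProj y

theorem range_halfSpace : range (𝓡∂ (d + 1)) = {y : Euc (d + 1) | 0 ≤ y 0} :=
  range_modelWithCornersEuclideanHalfSpace _

theorem mem_range_halfSpace {y : Euc (d + 1)} : y ∈ range (𝓡∂ (d + 1)) ↔ 0 ≤ y 0 := by
  rw [range_halfSpace]; rfl

theorem uniqueDiffOn_halfSpace : UniqueDiffOn ℝ (range (𝓡∂ (d + 1))) := (𝓡∂ (d + 1)).uniqueDiffOn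

/-- Dropping the normal coordinate does not increase the distance to a boundary point. -/
theorem dist_bdryIncl_bdryProj_le (y : Euc (d + 1)) (u : Euc d) :
    dist (bdryIncl d (bdryProj d y)) (bdryIncl d u) ≤ dist y (bdryIncl d u) := by
  rw [EuclideanSpace.dist_eq, EuclideanSpace.dist_eq]
  apply Real.sqrt_le_sqrt
  simp only [Fin.sum_univ_succ, bdryIncl_zero, bdryIncl_succ, bdryProj_apply, dist_self]
  nlinarith [sq_nonneg (dist (y 0) 0)]

/-- A half-ball centred at the boundary contains, with each of its points, the normal segment that
joins the point to the boundary. -/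
theorem add_smul_inward_mem_ball {y : Euc (d + 1)} {u : Euc d} {r t : ℝ}
    (hy : y ∈ Metric.ball (bdryIncl d u) r) (ht : t ∈ Icc 0 (y 0)) :
    bdryIncl d (bdryProj d y) + t • inward d ∈ Metric.ball (bdryIncl d u) r := by
  rcases ht.1.trans ht.2 |>.eq_or_lt with h0 | h0
  · have : t = 0 := le_antisymm (h0 ▸ ht.2) ht.1
    rw [this, zero_smul, add_zero]
    exact (dist_bdryIncl_bdryProj_le y u).trans_lt hy
  · have h1 : bdryIncl d (bdryProj d y) ∈ Metric.ball (bdryIncl d u) r :=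
      (dist_bdryIncl_bdryProj_le y u).trans_lt hy
    have h2 := (convex_ball (bdryIncl d u) r) h1 hy
      (sub_nonneg.2 ((div_le_one h0).2 ht.2)) (div_nonneg ht.1 h0.le)
      (sub_add_cancel 1 (t / y 0))
    convert h2 using 1
    conv_rhs => rw [← bdryIncl_bdryProj y]
    ext i
    refine Fin.cases ?_ (fun i ↦ ?_) i
    · simp
      field_simp
    · simp
      ring

end HalfSpace

/-! ### Uniqueness for the equation along normal lines -/

section Uniqueness

variable {d : ℕ}

/-- A function `f` and a vector valued function `h` on a half-ball centred at the boundary which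
satisfy `∂₀ f = σ L h`, for a linear form `L`, and `∂₀ h = -2 σ φ(f) h` are determined by their
values at the boundary. -/
theorem eqOn_of_normal_ode {W : Type*} [NormedAddCommGroup W] [NormedSpace ℝ W]
    [FiniteDimensional ℝ W] {φ : ℝ → ℝ} (hφ : ContDiff ℝ ∞ φ) {σ : ℝ} {u : Euc d} {r : ℝ}
    {f f' : Euc (d + 1) → ℝ} {h h' : Euc (d + 1) → W} {L : W →L[ℝ] ℝ}
    {S : Set (Euc (d + 1))} (hS : S = range (𝓡∂ (d + 1)) ∩ Metric.ball (bdryIncl d u) r)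
    (hf : ∀ y ∈ S, DifferentiableWithinAt ℝ f (range (𝓡∂ (d + 1))) y)
    (hf' : ∀ y ∈ S, DifferentiableWithinAt ℝ f' (range (𝓡∂ (d + 1))) y)
    (hh : ∀ y ∈ S, DifferentiableWithinAt ℝ h (range (𝓡∂ (d + 1))) y)
    (hh' : ∀ y ∈ S, DifferentiableWithinAt ℝ h' (range (𝓡∂ (d + 1))) y)
    (hfd : ∀ y ∈ S, fderivWithin ℝ f (range (𝓡∂ (d + 1))) y (inward d) =
      σ * L (h y))
    (hfd' : ∀ y ∈ S, fderivWithin ℝ f' (range (𝓡∂ (d + 1))) y (inward d) =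
      σ * L (h' y))
    (hhd : ∀ y ∈ S, fderivWithin ℝ h (range (𝓡∂ (d + 1))) y (inward d) =
      (-2 * σ * φ (f y)) • h y)
    (hhd' : ∀ y ∈ S, fderivWithin ℝ h' (range (𝓡∂ (d + 1))) y (inward d) =
      (-2 * σ * φ (f' y)) • h' y)
    (hf0 : ∀ v, bdryIncl d v ∈ S → f (bdryIncl d v) = f' (bdryIncl d v))
    (hh0 : ∀ v, bdryIncl d v ∈ S → h (bdryIncl d v) = h' (bdryIncl d v)) :
    ∀ y ∈ S, f y = f' y ∧ h y = h' y := by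
  intro y hy
  let γ : ℝ → Euc (d + 1) := fun t ↦ bdryIncl d (bdryProj d y) + t • inward d
  let X : ℝ × W → ℝ × W := fun p ↦ (σ * L p.2, (-2 * σ * φ p.1) • p.2)
  have hX : ContDiff ℝ ∞ X := by
    refine ContDiff.prodMk ?_ ?_
    · exact contDiff_const.mul (L.contDiff.comp contDiff_snd)
    · exact (contDiff_const.mul (hφ.comp contDiff_fst)).smul contDiff_snd
  have hy0 : 0 ≤ y 0 := by rw [hS] at hy; exact mem_range_halfSpace.1 hy.1
  have hγ0 : ∀ t, γ t 0 = t := fun t ↦ by simp [γ]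
  have hγS : ∀ t ∈ Icc 0 (y 0), γ t ∈ S := by
    intro t ht
    rw [hS] at hy ⊢
    exact ⟨mem_range_halfSpace.2 (by rw [hγ0]; exact ht.1), add_smul_inward_mem_ball hy.2 ht⟩
  have hγd : ∀ t, HasDerivAt γ (inward d) t := fun t ↦ by
    simpa [γ] using ((hasDerivAt_id t).smul_const (inward d)).const_add (bdryIncl d (bdryProj d y))
  have hmaps : MapsTo γ (Ici 0) (range (𝓡∂ (d + 1))) := fun s hs ↦
    mem_range_halfSpace.2 (by rw [hγ0]; exact hs)
  -- both pairs are solutions of the same autonomous equation along `γ`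
  have key : ∀ {F : Euc (d + 1) → ℝ} {K : Euc (d + 1) → W},
      (∀ y ∈ S, DifferentiableWithinAt ℝ F (range (𝓡∂ (d + 1))) y) →
      (∀ y ∈ S, DifferentiableWithinAt ℝ K (range (𝓡∂ (d + 1))) y) →
      (∀ y ∈ S, fderivWithin ℝ F (range (𝓡∂ (d + 1))) y (inward d) =
        σ * L (K y)) →
      (∀ y ∈ S, fderivWithin ℝ K (range (𝓡∂ (d + 1))) y (inward d) =
        (-2 * σ * φ (F y)) • K y) →
      ∀ t ∈ Icc 0 (y 0), HasDerivWithinAt (fun t ↦ (F (γ t), K (γ t)))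
        (X (F (γ t), K (γ t))) (Ici 0) t := by
    intro F K hF hK hFd hKd t ht
    have h1 := (hF _ (hγS t ht)).hasFDerivWithinAt.comp_hasDerivWithinAt t
      (hγd t).hasDerivWithinAt hmaps
    have h2 := (hK _ (hγS t ht)).hasFDerivWithinAt.comp_hasDerivWithinAt t
      (hγd t).hasDerivWithinAt hmaps
    rw [hFd _ (hγS t ht)] at h1
    rw [hKd _ (hγS t ht)] at h2
    exact h1.prodMk h2
  have k1 := key hf hh hfd hhd
  have k2 := key hf' hh' hfd' hhd'
  have c1 : ContinuousOn (fun t ↦ (f (γ t), h (γ t))) (Icc 0 (y 0)) := fun t ht ↦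
    (k1 t ht).continuousWithinAt.mono Icc_subset_Ici_self
  have c2 : ContinuousOn (fun t ↦ (f' (γ t), h' (γ t))) (Icc 0 (y 0)) := fun t ht ↦
    (k2 t ht).continuousWithinAt.mono Icc_subset_Ici_self
  -- `X` is only locally Lipschitz, but both solution curves stay in a ball
  obtain ⟨R, hR⟩ := ((isCompact_Icc.image_of_continuousOn c1).isBounded.union
    (isCompact_Icc.image_of_continuousOn c2).isBounded).subset_closedBall 0
  obtain ⟨K, hK⟩ := (hX.contDiffOn (s := Metric.closedBall 0 R)).exists_lipschitzOnWith (by simp)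
    (convex_closedBall _ _) (isCompact_closedBall _ _)
  have hcongr := ODE_solution_unique_of_mem_Icc_right (v := fun _ ↦ X)
    (s := fun _ ↦ Metric.closedBall 0 R) (K := K) (a := 0) (b := y 0) (fun t ht ↦ hK)
    c1 (fun t ht ↦ (k1 t (Ico_subset_Icc_self ht)).mono (Ici_subset_Ici.2 ht.1))
    (fun t ht ↦ hR (Or.inl ⟨t, Ico_subset_Icc_self ht, rfl⟩))
    c2 (fun t ht ↦ (k2 t (Ico_subset_Icc_self ht)).mono (Ici_subset_Ici.2 ht.1))
    (fun t ht ↦ hR (Or.inr ⟨t, Ico_subset_Icc_self ht, rfl⟩))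
    (by
      have h0 : γ 0 = bdryIncl d (bdryProj d y) := by simp [γ]
      have h1 := hγS 0 ⟨le_rfl, hy0⟩
      rw [h0] at h1
      simp only [h0]
      rw [hf0 _ h1, hh0 _ h1])
  have hend : γ (y 0) = y := bdryIncl_bdryProj y
  have := hcongr (x := y 0) ⟨hy0, le_rfl⟩
  simp only [hend, Prod.mk.injEq] at this
  exact this

end Uniqueness

/-! ### The Hessian equation in gradient coordinates -/

section Obata

variable {n : ℕ} {H : Type*} [TopologicalSpace H] {I : ModelWithCorners ℝ (Euc n) H}
  {M : Type*} [TopologicalSpace M] [ChartedSpace H M] [IsManifold I ∞ M]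

/-- The matrix of metric coefficients is invertible by positivity, so that `invMetricCoord` is a genuine
inverse at points of the chart. -/
theorem invMetricCoord_sum (g : Metric I M) {e : OpenPartialHomeomorph M H}
    (he : e ∈ IsManifold.maximalAtlas I ∞ M) {y : Euc n} (hy : y ∈ (e.extend I).target)
    (i l : Fin n) :
    ∑ k, metricCoord g e i k y * invMetricCoord g e k l y = if i = l then 1 else 0 := by
  set A : Matrix (Fin n) (Fin n) ℝ := Matrix.of fun a b ↦ metricCoord g e a b y with hA
  have hunit : IsUnit A := by
    rw [← Matrix.mulVec_injective_iff_isUnit]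
    refine (injective_iff_map_eq_zero (Matrix.mulVecLin A)).2 fun v hv ↦ ?_
    by_contra hne
    have hne' : (WithLp.toLp 2 v : Euc n) ≠ 0 := fun h ↦ hne (by simpa using h)
    have hpos := coordMetric_pos g he hy hne'
    have hexp : (WithLp.toLp 2 v : Euc n) = ∑ i, v i • EuclideanSpace.single i (1 : ℝ) := by
      ext k
      simp [Finset.sum_apply, Pi.single_apply]
    have : coordMetric g e y (WithLp.toLp 2 v) (WithLp.toLp 2 v) = ∑ i, v i * (A.mulVec v) i := by
      rw [hexp]
      simp only [map_sum, map_smul, sum_apply, smul_apply, smul_eq_mul,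
        Matrix.mulVec, dotProduct, hA, Matrix.of_apply, metricCoord_eq]
      simp only [Finset.mul_sum]
      rw [Finset.sum_comm]
      refine Finset.sum_congr rfl fun i _ ↦ Finset.sum_congr rfl fun k _ ↦ ?_
      ring
    rw [this] at hpos
    have hv' : A.mulVec v = 0 := hv
    simp [hv'] at hpos
  have h := Matrix.mul_nonsing_inv A ((Matrix.isUnit_iff_isUnit_det A).1 hunit)
  have := congrFun (congrFun h i) l
  rw [Matrix.mul_apply, Matrix.one_apply] at this
  exact this

theorem coordMetric_differentiableWithinAt (g : Metric I M) {e : OpenPartialHomeomorph M H}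
    (he : e ∈ IsManifold.maximalAtlas I ∞ M) {y : Euc n} (hy : y ∈ (e.extend I).target) :
    DifferentiableWithinAt ℝ (coordMetric g e) (range I) y :=
  ((contDiffOn_coordMetric g he y hy).differentiableWithinAt (by simp)).mono_of_mem_nhdsWithin
    (target_mem_nhdsWithin_range hy)

omit [IsManifold I ∞ M] in
theorem contDiffWithinAt_comp_extend_symm {f : M → ℝ} (hf : ContMDiff I 𝓘(ℝ, ℝ) ∞ f)
    {e : OpenPartialHomeomorph M H}
    (he : e ∈ IsManifold.maximalAtlas I ∞ M) {y : Euc n} (hy : y ∈ (e.extend I).target) :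
    ContDiffWithinAt ℝ ∞ (f ∘ (e.extend I).symm) (range I) y :=
  (contDiffOn_comp_extend_symm hf he y hy).mono_of_mem_nhdsWithin (target_mem_nhdsWithin_range hy)

theorem partialDeriv_metricCoord (g : Metric I M) {e : OpenPartialHomeomorph M H}
    (he : e ∈ IsManifold.maximalAtlas I ∞ M) {y : Euc n} (hy : y ∈ (e.extend I).target)
    (k i j : Fin n) :
    partialDeriv I k (metricCoord g e i j) y =
      fderivWithin ℝ (coordMetric g e) (range I) y (EuclideanSpace.single k 1)
        (EuclideanSpace.single i 1) (EuclideanSpace.single j 1) := by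
  have hd := (coordMetric_differentiableWithinAt g he hy).hasFDerivWithinAt
  have h1 := (hd.clm_apply (hasFDerivWithinAt_const (EuclideanSpace.single i (1 : ℝ)) y (range I)))
  have h2 := (h1.clm_apply (hasFDerivWithinAt_const (EuclideanSpace.single j (1 : ℝ)) y (range I)))
  have h3 := h2.fderivWithin (I.uniqueDiffOn y (e.extend_target_subset_range hy))
  have h4 : fderivWithin ℝ (metricCoord g e i j) (range I) y = _ := h3
  rw [partialDeriv, h4]
  simp

theorem partialDeriv_partialDeriv_comm {F : Euc n → ℝ} {y : Euc n}
    (hF : ContDiffWithinAt ℝ ∞ F (range I) y) (hy : y ∈ range I) (i j : Fin n) :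
    partialDeriv I i (partialDeriv I j F) y = partialDeriv I j (partialDeriv I i F) y := by
  have hu := I.uniqueDiffOn
  have hs := hF.isSymmSndFDerivWithinAt (by simp; norm_cast) hu (I.range_subset_closure_interior hy) hy
  have hd : DifferentiableWithinAt ℝ (fderivWithin ℝ F (range I)) (range I) y :=
    (hF.fderivWithin_right (m := 1) hu (by norm_cast) hy).differentiableWithinAt (by simp)
  have key : ∀ i j, partialDeriv I i (partialDeriv I j F) y =
      fderivWithin ℝ (fderivWithin ℝ F (range I)) (range I) y (EuclideanSpace.single i 1)
        (EuclideanSpace.single j 1) := by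
    intro i j
    have h1 := hd.hasFDerivWithinAt.clm_apply
      (hasFDerivWithinAt_const (EuclideanSpace.single j (1 : ℝ)) y (range I))
    change fderivWithin ℝ (fun y ↦ fderivWithin ℝ F (range I) y _) (range I) y _ = _
    rw [h1.fderivWithin (hu y hy)]
    simp
  rw [key, key]
  exact hs _ _

/-- In coordinates in which `σ ∇f = ∂/∂x^a` with `σ² = 1`, the equation `∇²f + φ(f) g = 0` becomes
`∂_a g = -2 σ φ(f) g`. -/
theorem fderivWithin_coordMetric_of_obata {g : Metric I M} {φ : ℝ → ℝ} {f : M → ℝ}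
    (hf : ContMDiff I 𝓘(ℝ, ℝ) ∞ f) (hobata : SolvesObata g φ f)
    {e : OpenPartialHomeomorph M H}
    (he : e ∈ IsManifold.maximalAtlas I ∞ M) {σ : ℝ} (hσ : σ * σ = 1) (a : Fin n)
    (hgrad : ∀ y ∈ (e.extend I).target, ∀ v, coordMetric g e y (EuclideanSpace.single a 1) v =
      σ * fderivWithin ℝ (f ∘ (e.extend I).symm) (range I) y v)
    {y : Euc n} (hy : y ∈ (e.extend I).target) :
    fderivWithin ℝ (coordMetric g e) (range I) y (EuclideanSpace.single a 1) =
      (-2 * σ * φ ((f ∘ (e.extend I).symm) y)) • coordMetric g e y := by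
  have hyr := e.extend_target_subset_range hy
  set F := f ∘ (e.extend I).symm with hF
  have hp : ∀ k, ∀ z ∈ (e.extend I).target, partialDeriv I k F z = σ * metricCoord g e a k z := by
    intro k z hz
    rw [metricCoord_eq, hgrad z hz, ← mul_assoc, hσ, one_mul, partialDeriv]
  have hpp : ∀ i k, partialDeriv I i (partialDeriv I k F) y =
      σ * partialDeriv I i (metricCoord g e a k) y := by
    intro i k
    have hev : partialDeriv I k F =ᶠ[𝓝[range I] y] fun z ↦ σ • metricCoord g e a k z := by
      filter_upwards [target_mem_nhdsWithin_range hy] with z hz using hp k z hz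
    rw [partialDeriv, hev.fderivWithin_eq (hp k y hy)]
    have hdiff : DifferentiableWithinAt ℝ (metricCoord g e a k) (range I) y :=
      ((coordMetric_differentiableWithinAt g he hy).clm_apply
        (differentiableWithinAt_const _)).clm_apply (differentiableWithinAt_const _)
    have h2 := (hdiff.hasFDerivWithinAt.const_smul σ).fderivWithin (I.uniqueDiffOn y hyr)
    have h2' : fderivWithin ℝ (fun z ↦ σ • metricCoord g e a k z) (range I) y = _ := h2
    rw [h2']
    rfl
  -- symmetry of the second derivatives of `f`, whose first derivatives are `σ g_{ak}`
  have hsym : ∀ i k, partialDeriv I i (metricCoord g e a k) y =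
      partialDeriv I k (metricCoord g e a i) y := by
    intro i k
    have h := partialDeriv_partialDeriv_comm (contDiffWithinAt_comp_extend_symm hf he hy) hyr i k
    rw [hpp, hpp] at h
    calc _ = σ * (σ * partialDeriv I i (metricCoord g e a k) y) := by rw [← mul_assoc, hσ, one_mul]
      _ = _ := by rw [h, ← mul_assoc, hσ, one_mul]
  have hcomm : ∀ i k, metricCoord g e i k = metricCoord g e k i := by
    intro i k
    funext z
    exact coordMetric_symm g e z _ _
  -- contraction with the differential of `f`, which is `σ g_{al}`, lowers the index of the Christoffel
  -- symbols
  have hchr : ∀ i k, ∑ l, christoffel g e l i k y * partialDeriv I l F y =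
      σ * ((1 / 2) * (partialDeriv I i (metricCoord g e k a) y +
        partialDeriv I k (metricCoord g e i a) y - partialDeriv I a (metricCoord g e i k) y)) := by
    intro i k
    have h1 : ∀ l, christoffel g e l i k y * partialDeriv I l F y = ∑ m,
        σ * (1 / 2) * (partialDeriv I i (metricCoord g e k m) y +
          partialDeriv I k (metricCoord g e i m) y - partialDeriv I m (metricCoord g e i k) y) *
          (metricCoord g e a l y * invMetricCoord g e l m y) := by
      intro l
      rw [christoffel, hp l y hy, Finset.mul_sum, Finset.sum_mul]
      refine Finset.sum_congr rfl fun m _ ↦ ?_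
      ring
    simp_rw [h1]
    rw [Finset.sum_comm]
    simp_rw [← Finset.mul_sum, invMetricCoord_sum g he hy]
    simp
    ring
  have hfin : ∀ i k, partialDeriv I a (metricCoord g e i k) y =
      -2 * σ * φ (F y) * metricCoord g e i k y := by
    intro i k
    have h := hobata e he y hy i k
    rw [hessianCoord, hchr, ← hF, hpp, hcomm k a, hcomm i a, hsym k i] at h
    have h2 : σ * (σ * partialDeriv I a (metricCoord g e i k) y) =
        σ * (-2 * (φ (F y) * metricCoord g e i k y)) := by
      rw [show F y = f ((e.extend I).symm y) from rfl]
      linear_combination 2 * σ * h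
    rw [← mul_assoc, hσ, one_mul] at h2
    rw [h2]
    ring
  -- a bilinear form is determined by its components
  have hbasis : ∀ A A' : Euc n →L[ℝ] Euc n →L[ℝ] ℝ,
      (∀ i k, A (EuclideanSpace.single i 1) (EuclideanSpace.single k 1) =
        A' (EuclideanSpace.single i 1) (EuclideanSpace.single k 1)) → A = A' := by
    intro A A' h
    apply ContinuousLinearMap.coe_injective
    refine (EuclideanSpace.basisFun (Fin n) ℝ).toBasis.ext fun i ↦ ?_
    apply ContinuousLinearMap.coe_injective
    refine (EuclideanSpace.basisFun (Fin n) ℝ).toBasis.ext fun k ↦ ?_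
    simpa using h i k
  refine hbasis _ _ fun i k ↦ ?_
  rw [← partialDeriv_metricCoord g he hy, hfin]
  rfl

end Obata

/-! ### Boundary points and normals in charts -/

variable {d : ℕ} {M : Type*} [TopologicalSpace M] [ChartedSpace (EuclideanHalfSpace (d + 1)) M]

theorem extChartAt_zero_of_mem_boundary {p : M} (hp : p ∈ (𝓡∂ (d + 1)).boundary M) :
    extChartAt (𝓡∂ (d + 1)) p p 0 = 0 := by
  have h : extChartAt (𝓡∂ (d + 1)) p p ∈ frontier (range (𝓡∂ (d + 1))) := hp
  rw [frontier_range_modelWithCornersEuclideanHalfSpace] at h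
  exact h.symm

/-- A function on the half-space which is minimal at a boundary point has a derivative there which
vanishes on tangential vectors and is nonnegative on the inward vector. -/
theorem fderivWithin_of_min {q : Euc (d + 1) → ℝ} {y : Euc (d + 1)} (hy : y 0 = 0)
    (hmin : IsLocalMinOn q (range (𝓡∂ (d + 1))) y) :
    (∀ v : Euc (d + 1), v 0 = 0 → fderivWithin ℝ q (range (𝓡∂ (d + 1))) y v = 0) ∧
      0 ≤ fderivWithin ℝ q (range (𝓡∂ (d + 1))) y (inward d) := by
  have hcone : ∀ v : Euc (d + 1), 0 ≤ v 0 → v ∈ posTangentConeAt (range (𝓡∂ (d + 1))) y := by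
    intro v hv
    apply mem_posTangentConeAt_of_segment_subset
    refine ((convex_halfSpace_ge (f := fun y : Euc (d + 1) ↦ y 0)
      (by constructor <;> intros <;> simp) 0).segment_subset ?_ ?_).trans
      (by rw [range_halfSpace])
    · exact hy.ge
    · simpa [hy] using hv
  refine ⟨fun v hv ↦ le_antisymm ?_ ?_, ?_⟩
  · have := hmin.fderivWithin_nonneg (hcone (-v) (by simp [hv]))
    simpa using this
  · exact hmin.fderivWithin_nonneg (hcone v hv.ge)
  · exact hmin.fderivWithin_nonneg (hcone _ (by simp))

variable [IsManifold (𝓡∂ (d + 1)) ∞ M]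

/-- The derivative of the zeroth coordinate of the preferred chart at a point, in the coordinates of
another chart. -/
theorem hasFDerivWithinAt_zeroth_chartAt
    {e : OpenPartialHomeomorph M (EuclideanHalfSpace (d + 1))}
    (he : e ∈ IsManifold.maximalAtlas (𝓡∂ (d + 1)) ∞ M) {y : Euc (d + 1)}
    (hy : y ∈ (e.extend (𝓡∂ (d + 1))).target) :
    HasFDerivWithinAt (fun z ↦ extChartAt (𝓡∂ (d + 1)) ((e.extend (𝓡∂ (d + 1))).symm y)
        ((e.extend (𝓡∂ (d + 1))).symm z) 0)
      ((EuclideanSpace.proj (0 : Fin (d + 1))) ∘L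
        (chartDeriv (𝓡∂ (d + 1)) (chartAt _ ((e.extend (𝓡∂ (d + 1))).symm y))
          ((e.extend (𝓡∂ (d + 1))).symm y) ∘L chartSymmDeriv (𝓡∂ (d + 1)) e y))
      (range (𝓡∂ (d + 1))) y := by
  have h1 := (mdifferentiableAt_extend (I := 𝓡∂ (d + 1))
    (IsManifold.chart_mem_maximalAtlas (n := ∞) ((e.extend (𝓡∂ (d + 1))).symm y))
    (mem_chart_source _ _)).hasMFDerivAt.comp_hasMFDerivWithinAt y
    (mdifferentiableWithinAt_extend_symm he hy).hasMFDerivWithinAt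
  exact (EuclideanSpace.proj (𝕜 := ℝ) (0 : Fin (d + 1)) :
    Euc (d + 1) →L[ℝ] ℝ).hasFDerivAt.comp_hasFDerivWithinAt y h1.hasFDerivWithinAt

/-- Every chart of the smooth structure sends boundary points to the boundary of the half-space. -/
theorem extend_zero_of_mem_boundary {p : M} (hp : p ∈ (𝓡∂ (d + 1)).boundary M)
    {e : OpenPartialHomeomorph M (EuclideanHalfSpace (d + 1))}
    (he : e ∈ IsManifold.maximalAtlas (𝓡∂ (d + 1)) ∞ M) (hx : p ∈ e.source) :
    e.extend (𝓡∂ (d + 1)) p 0 = 0 := by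
  obtain ⟨y, hy⟩ : ∃ y, e.extend (𝓡∂ (d + 1)) p = y := ⟨_, rfl⟩
  have hyt : y ∈ (e.extend (𝓡∂ (d + 1))).target :=
    hy ▸ (e.extend (𝓡∂ (d + 1))).map_source (by simpa using hx)
  have hyp : (e.extend (𝓡∂ (d + 1))).symm y = p :=
    hy ▸ (e.extend (𝓡∂ (d + 1))).left_inv (by simpa using hx)
  have hyr := e.extend_target_subset_range hyt
  rw [hy]
  by_contra hne
  have hpos : 0 < y 0 := lt_of_le_of_ne (mem_range_halfSpace.1 hyr) (Ne.symm hne)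
  have hnhds : range (𝓡∂ (d + 1)) ∈ 𝓝 y := by
    rw [range_halfSpace]
    filter_upwards [(isOpen_lt continuous_const
      (EuclideanSpace.proj (𝕜 := ℝ) (0 : Fin (d + 1))).continuous).mem_nhds
      (show (0 : ℝ) < EuclideanSpace.proj (𝕜 := ℝ) (0 : Fin (d + 1)) y from hpos)] with z hz
    exact le_of_lt hz
  have hq := hasFDerivWithinAt_zeroth_chartAt he hyt
  rw [hyp] at hq
  -- otherwise the zeroth coordinate of the preferred chart, which is nonnegative and vanishes at `p`,
  -- has a local minimum at an interior point of the coordinate domain, so its derivative vanishes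
  have hmin : IsLocalMin (fun z ↦ extChartAt (𝓡∂ (d + 1)) p ((e.extend (𝓡∂ (d + 1))).symm z) 0)
      y := by
    refine Filter.Eventually.of_forall fun z ↦ ?_
    simp only [hyp]
    rw [extChartAt_zero_of_mem_boundary hp]
    exact mem_range_halfSpace.1 (mem_range_self (f := 𝓡∂ (d + 1)) _)
  have h0 := hmin.hasFDerivAt_eq_zero (hq.hasFDerivAt hnhds)
  have hc := IsManifold.chart_mem_maximalAtlas (I := 𝓡∂ (d + 1)) (n := ∞) p
  -- the derivative of the change of charts is onto
  have h1 := congrArg (fun L : Euc (d + 1) →L[ℝ] ℝ ↦ L (chartDeriv (𝓡∂ (d + 1)) e p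
    (chartSymmDeriv (𝓡∂ (d + 1)) (chartAt _ p)
      ((chartAt (EuclideanHalfSpace (d + 1)) p).extend (𝓡∂ (d + 1)) p) (inward d)))) h0
  have h2 := chartSymmDeriv_chartDeriv he hx
  rw [hy] at h2
  have hct : (chartAt (EuclideanHalfSpace (d + 1)) p).extend (𝓡∂ (d + 1)) p ∈
      ((chartAt (EuclideanHalfSpace (d + 1)) p).extend (𝓡∂ (d + 1))).target :=
    mem_extChartAt_target p
  have h3 := chartDeriv_chartSymmDeriv hc hct (inward d)
  rw [show ((chartAt (EuclideanHalfSpace (d + 1)) p).extend (𝓡∂ (d + 1))).symm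
    ((chartAt (EuclideanHalfSpace (d + 1)) p).extend (𝓡∂ (d + 1)) p) = p from
    extChartAt_to_inv p] at h3
  simp only [ContinuousLinearMap.comp_apply, h2, h3] at h1
  simp at h1

/-- The outward unit normal in the coordinates of a chart. While outwardness is defined through the
preferred chart at the point, every chart sees the normal as outward, because the zeroth coordinate of
the preferred chart is minimal on the boundary. -/
theorem exists_coord_normal {g : Metric (𝓡∂ (d + 1)) M} {f : M → ℝ}
    (hf : ContMDiff (𝓡∂ (d + 1)) 𝓘(ℝ, ℝ) ∞ f)
    {e : OpenPartialHomeomorph M (EuclideanHalfSpace (d + 1))}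
    (he : e ∈ IsManifold.maximalAtlas (𝓡∂ (d + 1)) ∞ M) {y : Euc (d + 1)}
    (hy : y ∈ (e.extend (𝓡∂ (d + 1))).target) (hy0 : y 0 = 0) {c : ℝ}
    (hN : HasNormalDeriv g f ((e.extend (𝓡∂ (d + 1))).symm y) c) :
    ∃ N : Euc (d + 1), N 0 < 0 ∧ coordMetric g e y N N = 1 ∧
      (∀ v : Euc (d + 1), v 0 = 0 → coordMetric g e y N v = 0) ∧
      fderivWithin ℝ (f ∘ (e.extend (𝓡∂ (d + 1))).symm) (range (𝓡∂ (d + 1))) y N = c := by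
  obtain ⟨p, hp⟩ : ∃ p, (e.extend (𝓡∂ (d + 1))).symm y = p := ⟨_, rfl⟩
  rw [hp] at hN
  obtain ⟨ν, hν, hc⟩ := hN
  have hx : p ∈ e.source := by
    rw [← hp]
    simpa using (e.extend (𝓡∂ (d + 1))).map_target hy
  have hyp : e.extend (𝓡∂ (d + 1)) p = y := hp ▸ (e.extend (𝓡∂ (d + 1))).right_inv hy
  -- the zeroth coordinate of the preferred chart at `p`, in the coordinates of `e`
  let q : Euc (d + 1) → ℝ :=
    fun z ↦ extChartAt (𝓡∂ (d + 1)) p ((e.extend (𝓡∂ (d + 1))).symm z) 0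
  have hqd := hasFDerivWithinAt_zeroth_chartAt he hy
  rw [hp] at hqd
  have hqd' : ∀ v, fderivWithin ℝ q (range (𝓡∂ (d + 1))) y v = dx0 p (chartSymmDeriv (𝓡∂ (d + 1)) e y v) := by
    intro v
    change fderivWithin ℝ (fun z ↦ _) _ _ _ = _
    rw [hqd.fderivWithin ((𝓡∂ (d + 1)).uniqueDiffOn y (e.extend_target_subset_range hy))]
    rfl
  have hqy : q y = 0 := by
    simp only [q, hp]
    exact extChartAt_zero_of_mem_boundary hν.mem_boundary
  have hmin : IsLocalMinOn q (range (𝓡∂ (d + 1))) y := by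
    refine Filter.Eventually.of_forall fun z ↦ ?_
    rw [hqy]
    exact mem_range_halfSpace.1 (mem_range_self (f := 𝓡∂ (d + 1)) _)
  obtain ⟨ht, hin⟩ := fderivWithin_of_min hy0 hmin
  have hsymm : chartSymmDeriv (𝓡∂ (d + 1)) e y (chartDeriv (𝓡∂ (d + 1)) e p ν) = ν := by
    have := chartSymmDeriv_chartDeriv he hx ν
    rwa [hyp] at this
  refine ⟨chartDeriv (𝓡∂ (d + 1)) e p ν, ?_, ?_, ?_, ?_⟩
  · have h1 : dx0 p ν = fderivWithin ℝ q (range (𝓡∂ (d + 1))) y (chartDeriv (𝓡∂ (d + 1)) e p ν) := by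
      rw [hqd', hsymm]
    have h2 := hν.outward
    rw [h1, ← bdryIncl_bdryProj (chartDeriv (𝓡∂ (d + 1)) e p ν), map_add, map_smul, ht _ (bdryIncl_zero _),
      zero_add, smul_eq_mul] at h2
    by_contra hcon
    exact absurd (mul_nonneg (not_lt.1 hcon) hin) (not_le.2 h2)
  · have := coordMetric_chartDeriv g he hx ν ν
    rw [hyp] at this
    rw [this]
    exact hν.unit
  · intro v hv
    have h1 := hν.normal (chartSymmDeriv (𝓡∂ (d + 1)) e y v) (by rw [← hqd', ht v hv])
    change metricAt g ((e.extend (𝓡∂ (d + 1))).symm y) (chartSymmDeriv (𝓡∂ (d + 1)) e y (chartDeriv (𝓡∂ (d + 1)) e p ν)) (chartSymmDeriv (𝓡∂ (d + 1)) e y v) = 0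
    rw [hsymm, hp]
    exact h1
  · rw [fderivWithin_comp_extend_symm hf he hy, hsymm]
    subst hp
    exact hc

/-- A positive definite form on `ℝᵈ⁺¹` is determined by its restriction to the boundary hyperplane,
the products of the normal basis vector with tangential ones, and the product of the normal basis
vector with the outward unit normal. -/
theorem form_eq_of_boundary_data {A A' : Euc (d + 1) →L[ℝ] Euc (d + 1) →L[ℝ] ℝ}
    (hA : ∀ v w, A v w = A w v) (hA' : ∀ v w, A' v w = A' w v) (hpos : ∀ v, v ≠ 0 → 0 < A v v)
    (htt : ∀ v w, A (bdryIncl d v) (bdryIncl d w) = A' (bdryIncl d v) (bdryIncl d w))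
    (hnt : ∀ v, A (inward d) (bdryIncl d v) = A' (inward d) (bdryIncl d v))
    {N N' : Euc (d + 1)} (hN0 : N 0 ≠ 0) (hN0' : N' 0 ≠ 0) (hN : A N N = 1) (hN' : A' N' N' = 1)
    (hNt : ∀ v : Euc (d + 1), v 0 = 0 → A N v = 0) (hNt' : ∀ v : Euc (d + 1), v 0 = 0 → A' N' v = 0)
    (hc : A (inward d) N = A' (inward d) N') : A = A' := by
  -- the inward vector is `N / N₀` plus a tangential vector `w`, which is its `A`-orthogonal projection
  -- to the boundary hyperplane, and `A (inward d) N` is the coefficient of the unit normal `N`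
  have key : ∀ {A : Euc (d + 1) →L[ℝ] Euc (d + 1) →L[ℝ] ℝ} {N : Euc (d + 1)},
      (∀ v w, A v w = A w v) → N 0 ≠ 0 → A N N = 1 → (∀ v : Euc (d + 1), v 0 = 0 → A N v = 0) →
      ∃ w : Euc d, (∀ v, A (inward d) (bdryIncl d v) = A (bdryIncl d w) (bdryIncl d v)) ∧
        A (inward d) (inward d) = A (inward d) N ^ 2 + A (bdryIncl d w) (bdryIncl d w) := by
    intro A N hA h0 h1 ht
    set w : Euc d := -((N 0)⁻¹ • bdryProj d N) with hw
    have hdec : inward d = (N 0)⁻¹ • N + bdryIncl d w := by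
      rw [hw, map_neg, map_smul, eq_sub_of_add_eq (bdryIncl_bdryProj N)]
      simp [smul_sub, smul_smul, h0]
    have hz : ∀ v, A N (bdryIncl d v) = 0 := fun v ↦ ht _ (bdryIncl_zero v)
    have hz' : ∀ v, A (bdryIncl d v) N = 0 := fun v ↦ (hA _ _).trans (hz v)
    refine ⟨w, fun v ↦ ?_, ?_⟩
    · rw [hdec]
      simp [hz]
    · rw [hdec]
      simp [hz, hz', h1]
      ring
  obtain ⟨w, hw, hww⟩ := key hA hN0 hN hNt
  obtain ⟨w', hw', hww'⟩ := key hA' hN0' hN' hNt'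
  -- the projections `w` and `w'` have the same products with tangential vectors
  have hw_eq : w = w' := by
    by_contra hne
    have h1 : A (bdryIncl d (w - w')) (bdryIncl d (w - w')) = 0 := by
      have h2 : A (bdryIncl d w) (bdryIncl d (w - w')) = A (bdryIncl d w') (bdryIncl d (w - w')) := by
        rw [← hw, hnt, hw', htt]
      rw [map_sub (bdryIncl d), map_sub A, ← map_sub (bdryIncl d), sub_apply, h2, sub_self]
    refine (hpos (bdryIncl d (w - w')) fun h ↦ hne ?_).ne' h1
    have := congrArg (bdryProj d) h
    rw [bdryProj_bdryIncl, map_zero, sub_eq_zero] at this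
    exact this
  have hnn : A (inward d) (inward d) = A' (inward d) (inward d) := by
    rw [hww, hww', hc, hw_eq, htt]
  ext v w
  rw [← bdryIncl_bdryProj v, ← bdryIncl_bdryProj w]
  simp only [map_add, map_smul, add_apply, smul_apply, smul_eq_mul, htt, hnt, hnn]
  rw [hA (bdryIncl d _) (inward d), hA' (bdryIncl d _) (inward d), hnt]

/-! ### Collar charts -/

variable {d : ℕ} {B : Type*} [TopologicalSpace B] [ChartedSpace (Euc d) B]
  {M : Type*} [TopologicalSpace M] [ChartedSpace (EuclideanHalfSpace (d + 1)) M]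
  [IsManifold (𝓡∂ (d + 1)) ∞ M]

/-- `Θ` is a collar chart of `M` adapted to `f`: on the boundary it is the chart `κ` of `B`, and
its normal coordinate vector field is `σ ∇f`. -/
structure IsCollarChart (g : Metric (𝓡∂ (d + 1)) M) (f : M → ℝ) (j : B → M)
    (κ : OpenPartialHomeomorph B (Euc d)) (σ : ℝ)
    (Θ : OpenPartialHomeomorph M (EuclideanHalfSpace (d + 1))) : Prop where
  mem_maximalAtlas : Θ ∈ IsManifold.maximalAtlas (𝓡∂ (d + 1)) ∞ M
  boundary_mem : ∀ u, bdryIncl d u ∈ (Θ.extend (𝓡∂ (d + 1))).target → u ∈ κ.target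
  boundary_eq : ∀ u, bdryIncl d u ∈ (Θ.extend (𝓡∂ (d + 1))).target →
    (Θ.extend (𝓡∂ (d + 1))).symm (bdryIncl d u) = j (κ.symm u)
  grad : ∀ y ∈ (Θ.extend (𝓡∂ (d + 1))).target, ∀ v, coordMetric g Θ y (inward d) v =
    σ * fderivWithin ℝ (f ∘ (Θ.extend (𝓡∂ (d + 1))).symm) (range (𝓡∂ (d + 1))) y v

variable {g : Metric (𝓡∂ (d + 1)) M} {f : M → ℝ} {j : B → M}
  {κ : OpenPartialHomeomorph B (Euc d)} {σ : ℝ}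
  {Θ : OpenPartialHomeomorph M (EuclideanHalfSpace (d + 1))}

theorem bdryIncl_mem_range (u : Euc d) : bdryIncl d u ∈ range (𝓡∂ (d + 1)) :=
  mem_range_halfSpace.2 (bdryIncl_zero u).ge

theorem tendsto_bdryIncl (u : Euc d) :
    Tendsto (bdryIncl d) (𝓝 u) (𝓝[range (𝓡∂ (d + 1))] (bdryIncl d u)) :=
  tendsto_nhdsWithin_iff.2 ⟨(bdryIncl d).continuous.continuousAt,
    Eventually.of_forall bdryIncl_mem_range⟩

theorem IsCollarChart.apply_boundary (h : IsCollarChart g f j κ σ Θ) (hj : IsBoundaryInclusion d j)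
    {b : B} (hb : j b ∈ Θ.source) :
    b ∈ κ.source ∧ Θ.extend (𝓡∂ (d + 1)) (j b) = bdryIncl d (κ b) := by
  have hbdry : j b ∈ (𝓡∂ (d + 1)).boundary M := by
    rw [← hj.range_eq]
    exact mem_range_self b
  have h0 := extend_zero_of_mem_boundary hbdry h.mem_maximalAtlas hb
  have h1 := bdryIncl_bdryProj_of_zero h0
  have ht : bdryIncl d (bdryProj d (Θ.extend (𝓡∂ (d + 1)) (j b))) ∈
      (Θ.extend (𝓡∂ (d + 1))).target := by
    rw [h1]
    exact (Θ.extend (𝓡∂ (d + 1))).map_source (by simpa using hb)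
  have h2 := h.boundary_eq _ ht
  have h3 := h.boundary_mem _ ht
  rw [h1, (Θ.extend (𝓡∂ (d + 1))).left_inv (by simpa using hb)] at h2
  have h4 := hj.embedding.isEmbedding.injective h2
  have h5 : κ b = bdryProj d (Θ.extend (𝓡∂ (d + 1)) (j b)) := by
    conv_lhs => rw [h4]
    exact κ.right_inv h3
  refine ⟨h4 ▸ κ.map_target h3, ?_⟩
  rw [h5, h1]

omit [ChartedSpace (Euc d) B] in
theorem IsCollarChart.comp_bdryIncl (h : IsCollarChart g f j κ σ Θ) {u : Euc d}
    (hu : bdryIncl d u ∈ (Θ.extend (𝓡∂ (d + 1))).target) :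
    (Θ.extend (𝓡∂ (d + 1))).symm ∘ bdryIncl d =ᶠ[𝓝 u] j ∘ κ.symm := by
  filter_upwards [tendsto_bdryIncl u (target_mem_nhdsWithin_range hu)] with v hv
    using h.boundary_eq v hv

theorem IsCollarChart.coordMetric_bdryIncl (h : IsCollarChart g f j κ σ Θ)
    [IsManifold (𝓡 d) ∞ B]
    (hκ : κ ∈ IsManifold.maximalAtlas (𝓡 d) ∞ B)
    (hj : IsBoundaryInclusion d j) {u : Euc d}
    (hu : bdryIncl d u ∈ (Θ.extend (𝓡∂ (d + 1))).target) (v w : Euc d) :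
    coordMetric g Θ (bdryIncl d u) (bdryIncl d v) (bdryIncl d w) =
      pullback (𝓡 d) g j (κ.symm u) (modelDeriv (𝓡 d) κ.symm univ u v)
        (modelDeriv (𝓡 d) κ.symm univ u w) := by
  have hs := mdifferentiableWithinAt_extend_symm h.mem_maximalAtlas hu
  have h1 := pullForm_comp g (R := bdryIncl d) (t := univ) (y := u) hs
    (bdryIncl d).differentiableAt.differentiableWithinAt
    (Eventually.of_forall bdryIncl_mem_range) uniqueDiffWithinAt_univ v w
  rw [(bdryIncl d).fderivWithin uniqueDiffWithinAt_univ] at h1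
  rw [coordMetric, ← h1, pullForm_congr g (ψ' := j ∘ κ.symm)
    (by rw [nhdsWithin_univ]; exact h.comp_bdryIncl hu) (h.comp_bdryIncl hu).eq_of_nhds]
  have hκd : MDifferentiableAt 𝓘(ℝ, Euc d) (𝓡 d) κ.symm u :=
    ((contMDiffOn_symm_of_mem_maximalAtlas hκ).contMDiffAt
      (κ.open_target.mem_nhds (h.boundary_mem u hu))).mdifferentiableAt (by simp)
  exact pullForm_map g (hj.embedding.contMDiff.mdifferentiable (by simp) _)
    hκd.mdifferentiableWithinAt uniqueDiffWithinAt_univ v w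

omit [ChartedSpace (Euc d) B] in
theorem IsCollarChart.coordMetric_inward_bdryIncl (h : IsCollarChart g f j κ σ Θ)
    (hf : ContMDiff (𝓡∂ (d + 1)) 𝓘(ℝ, ℝ) ∞ f) {u : Euc d}
    (hu : bdryIncl d u ∈ (Θ.extend (𝓡∂ (d + 1))).target) (v : Euc d) :
    coordMetric g Θ (bdryIncl d u) (inward d) (bdryIncl d v) =
      σ * fderiv ℝ (f ∘ j ∘ κ.symm) u v := by
  rw [h.grad _ hu]
  have h1 := ((contDiffWithinAt_comp_extend_symm hf h.mem_maximalAtlas hu).differentiableWithinAt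
    (by simp)).hasFDerivWithinAt.comp u (bdryIncl d).hasFDerivAt.hasFDerivWithinAt
    (s := univ) (fun v _ ↦ bdryIncl_mem_range v)
  have h2 : f ∘ j ∘ κ.symm =ᶠ[𝓝 u] (f ∘ (Θ.extend (𝓡∂ (d + 1))).symm) ∘ bdryIncl d := by
    filter_upwards [h.comp_bdryIncl hu] with z hz using (congrArg f hz).symm
  rw [h2.fderiv_eq, (hasFDerivWithinAt_univ.1 h1).fderiv]
  rfl

/-- Two collar charts over the same boundary chart, for the same boundary metric, Dirichlet data
and Neumann data, give rise to the same metric coefficients at boundary points. -/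
theorem IsCollarChart.coordMetric_eq_of_boundary [IsManifold (𝓡 d) ∞ B]
    {M' : Type*} [TopologicalSpace M'] [ChartedSpace (EuclideanHalfSpace (d + 1)) M']
    [IsManifold (𝓡∂ (d + 1)) ∞ M'] {g' : Metric (𝓡∂ (d + 1)) M'} {f' : M' → ℝ} {j' : B → M'}
    {Θ' : OpenPartialHomeomorph M' (EuclideanHalfSpace (d + 1))}
    (h : IsCollarChart g f j κ σ Θ) (h' : IsCollarChart g' f' j' κ σ Θ')
    (hκ : κ ∈ IsManifold.maximalAtlas (𝓡 d) ∞ B)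
    (hj : IsBoundaryInclusion d j) (hj' : IsBoundaryInclusion d j')
    (hf : ContMDiff (𝓡∂ (d + 1)) 𝓘(ℝ, ℝ) ∞ f) (hf' : ContMDiff (𝓡∂ (d + 1)) 𝓘(ℝ, ℝ) ∞ f')
    (hgg' : ∀ b v w, pullback (𝓡 d) g j b v w = pullback (𝓡 d) g' j' b v w)
    (hff' : ∀ b, f (j b) = f' (j' b)) {c : B → ℝ} (hc : ∀ b, HasNormalDeriv g f (j b) (c b))
    (hc' : ∀ b, HasNormalDeriv g' f' (j' b) (c b)) {u : Euc d}
    (hu : bdryIncl d u ∈ (Θ.extend (𝓡∂ (d + 1))).target)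
    (hu' : bdryIncl d u ∈ (Θ'.extend (𝓡∂ (d + 1))).target) :
    coordMetric g Θ (bdryIncl d u) = coordMetric g' Θ' (bdryIncl d u) := by
  obtain ⟨N, hN0, hN1, hNt, hNc⟩ := exists_coord_normal hf h.mem_maximalAtlas hu (bdryIncl_zero u)
    (by rw [h.boundary_eq u hu]; exact hc _)
  obtain ⟨N', hN0', hN1', hNt', hNc'⟩ := exists_coord_normal hf' h'.mem_maximalAtlas hu'
    (bdryIncl_zero u) (by rw [h'.boundary_eq u hu']; exact hc' _)
  have hcomp : f ∘ j ∘ κ.symm = f' ∘ j' ∘ κ.symm := funext fun z ↦ hff' _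
  refine form_eq_of_boundary_data (coordMetric_symm g Θ _) (coordMetric_symm g' Θ' _)
    (fun v hv ↦ coordMetric_pos g h.mem_maximalAtlas hu hv) (fun v w ↦ ?_) (fun v ↦ ?_)
    hN0.ne hN0'.ne hN1 hN1' hNt hNt' ?_
  · rw [h.coordMetric_bdryIncl hκ hj hu, h'.coordMetric_bdryIncl hκ hj' hu']
    exact hgg' _ _ _
  · rw [h.coordMetric_inward_bdryIncl hf hu, h'.coordMetric_inward_bdryIncl hf' hu', hcomp]
  · rw [h.grad _ hu, h'.grad _ hu', hNc, hNc']

/-- The sign `σ` in a collar chart is opposite to the sign of the Neumann data. -/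
theorem IsCollarChart.mul_normalDeriv_neg (h : IsCollarChart g f j κ σ Θ)
    (hf : ContMDiff (𝓡∂ (d + 1)) 𝓘(ℝ, ℝ) ∞ f) (hj : IsBoundaryInclusion d j)
    {b : B} (hb : j b ∈ Θ.source) {c : ℝ}
    (hc : HasNormalDeriv g f (j b) c) : σ * c < 0 := by
  have hb' := (h.apply_boundary hj hb).2
  have hu : bdryIncl d (κ b) ∈ (Θ.extend (𝓡∂ (d + 1))).target := by
    rw [← hb']
    exact (Θ.extend (𝓡∂ (d + 1))).map_source (by simpa using hb)
  obtain ⟨N, hN0, hN1, hNt, hNc⟩ := exists_coord_normal hf h.mem_maximalAtlas hu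
    (bdryIncl_zero _) (c := c) (by
      rw [← hb', (Θ.extend (𝓡∂ (d + 1))).left_inv (by simpa using hb)]
      exact hc)
  have h1 := h.grad _ hu N
  rw [hNc] at h1
  rw [← h1]
  -- `A N N = N₀ A(∂₀, N)` as `N` is orthogonal to tangential vectors, and `N₀ < 0`
  have h2 : N 0 * coordMetric g Θ (bdryIncl d (κ b)) (inward d) N = 1 := by
    rw [← hN1]
    calc _ = coordMetric g Θ (bdryIncl d (κ b)) (bdryIncl d (bdryProj d N) + N 0 • inward d) N := by
          rw [map_add, map_smul, add_apply, smul_apply,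
            coordMetric_symm g Θ _ (bdryIncl d _) N, hNt _ (bdryIncl_zero _), zero_add, smul_eq_mul]
      _ = _ := by rw [bdryIncl_bdryProj]
  by_contra hcon
  nlinarith

omit [ChartedSpace (Euc d) B] in
/-- In a collar chart the normal coordinate vector field is `σ ∇f`, stated at a point of `M`. -/
theorem IsCollarChart.metricAt_chartSymmDeriv (h : IsCollarChart g f j κ σ Θ)
    (hf : ContMDiff (𝓡∂ (d + 1)) 𝓘(ℝ, ℝ) ∞ f) {x : M} (hx : x ∈ Θ.source) (v : Euc (d + 1)) :
    metricAt g x (chartSymmDeriv (𝓡∂ (d + 1)) Θ (Θ.extend (𝓡∂ (d + 1)) x) (inward d)) v =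
      σ * mvfderiv (𝓡∂ (d + 1)) f x v := by
  have hy : Θ.extend (𝓡∂ (d + 1)) x ∈ (Θ.extend (𝓡∂ (d + 1))).target :=
    (Θ.extend (𝓡∂ (d + 1))).map_source (by simpa using hx)
  have hxy : (Θ.extend (𝓡∂ (d + 1))).symm (Θ.extend (𝓡∂ (d + 1)) x) = x :=
    (Θ.extend (𝓡∂ (d + 1))).left_inv (by simpa using hx)
  have h1 := h.grad _ hy (chartDeriv (𝓡∂ (d + 1)) Θ x v)
  rw [fderivWithin_comp_extend_symm hf h.mem_maximalAtlas hy,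
    chartSymmDeriv_chartDeriv h.mem_maximalAtlas hx] at h1
  change metricAt g ((Θ.extend (𝓡∂ (d + 1))).symm (Θ.extend (𝓡∂ (d + 1)) x)) _
    (chartSymmDeriv _ _ _ (chartDeriv _ _ _ _)) = _ at h1
  rw [chartSymmDeriv_chartDeriv h.mem_maximalAtlas hx, hxy] at h1
  exact h1

omit [ChartedSpace (Euc d) B] in
/-- The change of collar charts preserves the normal coordinate vector field. -/
theorem IsCollarChart.chartDeriv_chartSymmDeriv_inward (h : IsCollarChart g f j κ σ Θ)
    {κ' : OpenPartialHomeomorph B (Euc d)}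
    {Θ' : OpenPartialHomeomorph M (EuclideanHalfSpace (d + 1))}
    (h' : IsCollarChart g f j κ' σ Θ')
    (hf : ContMDiff (𝓡∂ (d + 1)) 𝓘(ℝ, ℝ) ∞ f) {x : M} (hx : x ∈ Θ.source) (hx' : x ∈ Θ'.source) :
    chartDeriv (𝓡∂ (d + 1)) Θ' x
      (chartSymmDeriv (𝓡∂ (d + 1)) Θ (Θ.extend (𝓡∂ (d + 1)) x) (inward d)) = inward d := by
  have hgrad : chartSymmDeriv (𝓡∂ (d + 1)) Θ (Θ.extend (𝓡∂ (d + 1)) x) (inward d) =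
      chartSymmDeriv (𝓡∂ (d + 1)) Θ' (Θ'.extend (𝓡∂ (d + 1)) x) (inward d) := by
    by_contra hne
    refine (metricAt_pos g x (sub_ne_zero.2 hne)).ne' ?_
    rw [map_sub (metricAt g x), sub_apply, h.metricAt_chartSymmDeriv hf hx, h'.metricAt_chartSymmDeriv hf hx',
      sub_self]
  have hy : Θ'.extend (𝓡∂ (d + 1)) x ∈ (Θ'.extend (𝓡∂ (d + 1))).target :=
    (Θ'.extend (𝓡∂ (d + 1))).map_source (by simpa using hx')
  have h1 := chartDeriv_chartSymmDeriv h'.mem_maximalAtlas hy (inward d)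
  rw [(Θ'.extend (𝓡∂ (d + 1))).left_inv (by simpa using hx')] at h1
  rw [hgrad, h1]

/-- Near the boundary, two collar charts differ by the change of the boundary charts only. -/
theorem IsCollarChart.eventually_eq (h : IsCollarChart g f j κ σ Θ)
    {κ' : OpenPartialHomeomorph B (Euc d)}
    {Θ' : OpenPartialHomeomorph M (EuclideanHalfSpace (d + 1))}
    (h' : IsCollarChart g f j κ' σ Θ') (hj : IsBoundaryInclusion d j)
    (hf : ContMDiff (𝓡∂ (d + 1)) 𝓘(ℝ, ℝ) ∞ f) {b : B} (hb : j b ∈ Θ.source)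
    (hb' : j b ∈ Θ'.source) :
    ∀ᶠ x in 𝓝 (j b), Θ'.extend (𝓡∂ (d + 1)) x =
      bdryIncl d (κ' (κ.symm (bdryProj d (Θ.extend (𝓡∂ (d + 1)) x)))) +
        Θ.extend (𝓡∂ (d + 1)) x 0 • inward d := by
  set ψ := (Θ.extend (𝓡∂ (d + 1))).symm with hψ
  have hu : bdryIncl d (κ b) ∈ (Θ.extend (𝓡∂ (d + 1))).target := by
    rw [← (h.apply_boundary hj hb).2]
    exact (Θ.extend (𝓡∂ (d + 1))).map_source (by simpa using hb)
  have hψu : ψ (bdryIncl d (κ b)) = j b := by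
    rw [h.boundary_eq _ hu, κ.left_inv (h.apply_boundary hj hb).1]
  have hD : ∀ᶠ y in 𝓝[range (𝓡∂ (d + 1))] bdryIncl d (κ b),
      y ∈ (Θ.extend (𝓡∂ (d + 1))).target ∧ ψ y ∈ Θ'.source := by
    refine Filter.Eventually.and (target_mem_nhdsWithin_range hu) ?_
    refine ((mdifferentiableWithinAt_extend_symm h.mem_maximalAtlas hu).continuousWithinAt)
      (Θ'.open_source.mem_nhds ?_)
    change ψ _ ∈ _
    rwa [hψu]
  obtain ⟨r, hr, hball⟩ := Metric.mem_nhdsWithin_iff.1 hD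
  have hsub : ∀ y ∈ Metric.ball (bdryIncl d (κ b)) r, y ∈ range (𝓡∂ (d + 1)) →
      y ∈ (Θ.extend (𝓡∂ (d + 1))).target ∧ ψ y ∈ Θ'.source := fun y h1 h2 ↦ hball ⟨h1, h2⟩
  -- the change of charts maps the normal coordinate field to itself
  have hRd : ∀ y ∈ Metric.ball (bdryIncl d (κ b)) r, y ∈ range (𝓡∂ (d + 1)) →
      ∃ L : Euc (d + 1) →L[ℝ] Euc (d + 1), L (inward d) = inward d ∧
        HasFDerivWithinAt (Θ'.extend (𝓡∂ (d + 1)) ∘ ψ) L (range (𝓡∂ (d + 1))) y := by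
    intro y hy hyr
    obtain ⟨h1, h2⟩ := hsub y hy hyr
    have h3 := (mdifferentiableAt_extend h'.mem_maximalAtlas h2).hasMFDerivAt.comp_hasMFDerivWithinAt
      y (mdifferentiableWithinAt_extend_symm h.mem_maximalAtlas h1).hasMFDerivWithinAt
    refine ⟨_, ?_, h3.hasFDerivWithinAt⟩
    have h4 : ψ y ∈ Θ.source := by simpa [hψ] using (Θ.extend (𝓡∂ (d + 1))).map_target h1
    have h5 := h.chartDeriv_chartSymmDeriv_inward h' hf h4 h2
    rw [show Θ.extend (𝓡∂ (d + 1)) (ψ y) = y from (Θ.extend (𝓡∂ (d + 1))).right_inv h1] at h5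
    exact h5
  have hconst : ∀ y ∈ Metric.ball (bdryIncl d (κ b)) r, y ∈ range (𝓡∂ (d + 1)) →
      Θ'.extend (𝓡∂ (d + 1)) (ψ y) =
        bdryIncl d (κ' (κ.symm (bdryProj d y))) + y 0 • inward d := by
    intro y hy hyr
    have hy0 : 0 ≤ y 0 := mem_range_halfSpace.1 hyr
    let γ : ℝ → Euc (d + 1) := fun t ↦ bdryIncl d (bdryProj d y) + t • inward d
    have hγ0 : ∀ t, γ t 0 = t := fun t ↦ by simp [γ]
    have hγr : ∀ t, 0 ≤ t → γ t ∈ range (𝓡∂ (d + 1)) := fun t ht ↦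
      mem_range_halfSpace.2 (by rw [hγ0]; exact ht)
    have hγd : ∀ t, HasDerivAt γ (inward d) t := fun t ↦ by
      simpa [γ] using ((hasDerivAt_id t).smul_const (inward d)).const_add
        (bdryIncl d (bdryProj d y))
    -- so along normal lines it is a translation
    have hder : ∀ t ∈ Icc 0 (y 0), HasDerivWithinAt
        (fun t ↦ Θ'.extend (𝓡∂ (d + 1)) (ψ (γ t)) - t • inward d) 0 (Ici 0) t := by
      intro t ht
      obtain ⟨L, hL, hLd⟩ := hRd (γ t) (add_smul_inward_mem_ball hy ht) (hγr t ht.1)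
      have h1 := hLd.comp_hasDerivWithinAt t (hγd t).hasDerivWithinAt
        (fun s (hs : s ∈ Ici (0 : ℝ)) ↦ hγr s hs)
      have h2 := h1.sub ((hasDerivAt_id t).smul_const (inward d)).hasDerivWithinAt
      rw [hL, one_smul, sub_self] at h2
      exact h2
    have hc := constant_of_has_deriv_right_zero (a := 0) (b := y 0)
      (fun t ht ↦ (hder t ht).continuousWithinAt.mono Icc_subset_Ici_self)
      (fun t ht ↦ (hder t (Ico_subset_Icc_self ht)).mono (Ici_subset_Ici.2 ht.1))
      (y 0) ⟨hy0, le_rfl⟩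
    have hend : γ (y 0) = y := bdryIncl_bdryProj y
    have hstart : γ 0 = bdryIncl d (bdryProj d y) := by simp [γ]
    simp only [hend, hstart, zero_smul, sub_zero] at hc
    have hmem := add_smul_inward_mem_ball hy ⟨le_rfl, hy0⟩
    rw [zero_smul, add_zero] at hmem
    obtain ⟨h1, h2⟩ := hsub _ hmem (bdryIncl_mem_range _)
    rw [hψ, h.boundary_eq _ h1] at h2
    rw [hψ, h.boundary_eq _ h1, (h'.apply_boundary hj h2).2] at hc
    rw [← hc]
    simp [hψ]
  have hcont : Tendsto (Θ.extend (𝓡∂ (d + 1))) (𝓝 (j b)) (𝓝 (bdryIncl d (κ b))) := by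
    rw [← (h.apply_boundary hj hb).2]
    exact Θ.continuousAt_extend hb
  filter_upwards [hcont (Metric.ball_mem_nhds _ hr), Θ.open_source.mem_nhds hb] with x hx hxs
  have h1 := hconst _ hx (mem_range_self _)
  rwa [hψ, (Θ.extend (𝓡∂ (d + 1))).left_inv (by simpa using hxs)] at h1

/-- Two collar charts over the same boundary chart and the same half-ball, for solutions of the
same equation `∇²f + φ(f) g = 0` with the same boundary data, induce the same function and the same
metric on that half-ball. -/
theorem IsCollarChart.data_eq [IsManifold (𝓡 d) ∞ B]
    {M' : Type*} [TopologicalSpace M'] [ChartedSpace (EuclideanHalfSpace (d + 1)) M']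
    [IsManifold (𝓡∂ (d + 1)) ∞ M'] {g' : Metric (𝓡∂ (d + 1)) M'} {f' : M' → ℝ} {j' : B → M'}
    {Θ' : OpenPartialHomeomorph M' (EuclideanHalfSpace (d + 1))}
    (h : IsCollarChart g f j κ σ Θ) (h' : IsCollarChart g' f' j' κ σ Θ') (hσ : σ * σ = 1)
    (hκ : κ ∈ IsManifold.maximalAtlas (𝓡 d) ∞ B)
    (hj : IsBoundaryInclusion d j) (hj' : IsBoundaryInclusion d j')
    (hf : ContMDiff (𝓡∂ (d + 1)) 𝓘(ℝ, ℝ) ∞ f) (hf' : ContMDiff (𝓡∂ (d + 1)) 𝓘(ℝ, ℝ) ∞ f')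
    (hgg' : ∀ b v w, pullback (𝓡 d) g j b v w = pullback (𝓡 d) g' j' b v w)
    (hff' : ∀ b, f (j b) = f' (j' b)) {c : B → ℝ} (hc : ∀ b, HasNormalDeriv g f (j b) (c b))
    (hc' : ∀ b, HasNormalDeriv g' f' (j' b) (c b))
    {φ : ℝ → ℝ} (hφ : ContDiff ℝ ∞ φ) (ho : SolvesObata g φ f) (ho' : SolvesObata g' φ f')
    {u : Euc d} {r : ℝ}
    (ht : (Θ.extend (𝓡∂ (d + 1))).target = range (𝓡∂ (d + 1)) ∩ Metric.ball (bdryIncl d u) r)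
    (ht' : (Θ'.extend (𝓡∂ (d + 1))).target = range (𝓡∂ (d + 1)) ∩ Metric.ball (bdryIncl d u) r)
    {y : Euc (d + 1)} (hy : y ∈ (Θ.extend (𝓡∂ (d + 1))).target) :
    f ((Θ.extend (𝓡∂ (d + 1))).symm y) = f' ((Θ'.extend (𝓡∂ (d + 1))).symm y) ∧
      coordMetric g Θ y = coordMetric g' Θ' y := by
  have htt : (Θ'.extend (𝓡∂ (d + 1))).target = (Θ.extend (𝓡∂ (d + 1))).target := ht'.trans ht.symm
  have hgrad : ∀ z ∈ (Θ.extend (𝓡∂ (d + 1))).target,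
      fderivWithin ℝ (f ∘ (Θ.extend (𝓡∂ (d + 1))).symm) (range (𝓡∂ (d + 1))) z (inward d) =
        σ * coordMetric g Θ z (inward d) (inward d) := by
    intro z hz
    rw [h.grad z hz, ← mul_assoc, hσ, one_mul]
  have hgrad' : ∀ z ∈ (Θ'.extend (𝓡∂ (d + 1))).target,
      fderivWithin ℝ (f' ∘ (Θ'.extend (𝓡∂ (d + 1))).symm) (range (𝓡∂ (d + 1))) z (inward d) =
        σ * coordMetric g' Θ' z (inward d) (inward d) := by
    intro z hz
    rw [h'.grad z hz, ← mul_assoc, hσ, one_mul]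
  refine eqOn_of_normal_ode (f := f ∘ (Θ.extend (𝓡∂ (d + 1))).symm)
    (f' := f' ∘ (Θ'.extend (𝓡∂ (d + 1))).symm) (h := coordMetric g Θ) (h' := coordMetric g' Θ')
    (L := (ContinuousLinearMap.apply ℝ ℝ (inward d)).comp
      (ContinuousLinearMap.apply ℝ (Euc (d + 1) →L[ℝ] ℝ) (inward d))) hφ ht ?_ ?_ ?_ ?_
    hgrad (fun z hz ↦ hgrad' z (htt ▸ hz)) ?_ ?_ ?_ ?_ y hy
  · exact fun z hz ↦ (contDiffWithinAt_comp_extend_symm hf h.mem_maximalAtlas hz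
      ).differentiableWithinAt (by simp)
  · exact fun z hz ↦ (contDiffWithinAt_comp_extend_symm hf' h'.mem_maximalAtlas (htt ▸ hz)
      ).differentiableWithinAt (by simp)
  · exact fun z hz ↦ coordMetric_differentiableWithinAt g h.mem_maximalAtlas hz
  · exact fun z hz ↦ coordMetric_differentiableWithinAt g' h'.mem_maximalAtlas (htt ▸ hz)
  · exact fun z hz ↦ fderivWithin_coordMetric_of_obata hf ho h.mem_maximalAtlas hσ 0 h.grad hz
  · exact fun z hz ↦ fderivWithin_coordMetric_of_obata hf' ho' h'.mem_maximalAtlas hσ 0 h'.grad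
      (htt ▸ hz)
  · intro v hv
    simp only [Function.comp_apply]
    rw [h.boundary_eq v hv, h'.boundary_eq v (htt ▸ hv), hff']
  · intro v hv
    exact h.coordMetric_eq_of_boundary h' hκ hj hj' hf hf' hgg' hff' hc hc' hv (htt ▸ hv)

/-! ### Changes of charts and immersions -/

section General

variable {n : ℕ} {H : Type*} [TopologicalSpace H] {I : ModelWithCorners ℝ (Euc n) H}
  {M : Type*} [TopologicalSpace M] [ChartedSpace H M]

theorem trans_mem_maximalAtlas {e : OpenPartialHomeomorph M H}
    (he : e ∈ IsManifold.maximalAtlas I ∞ M) {G : OpenPartialHomeomorph H H}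
    (hG : G ∈ contDiffGroupoid ∞ I) : e.trans G ∈ IsManifold.maximalAtlas I ∞ M := by
  refine mem_maximalAtlas_iff.2 fun e' he' ↦ ?_
  obtain ⟨h1, h2⟩ := mem_maximalAtlas_iff.1 he e' he'
  rw [OpenPartialHomeomorph.trans_symm_eq_symm_trans_symm, OpenPartialHomeomorph.trans_assoc,
    ← OpenPartialHomeomorph.trans_assoc e'.symm]
  exact ⟨StructureGroupoid.trans _ (StructureGroupoid.symm _ hG) h1, StructureGroupoid.trans _ h2 hG⟩

theorem mfderiv_injective_of_writtenInCharts [IsManifold I ∞ M]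
    {n' : ℕ} {H' : Type*} [TopologicalSpace H']
    {J : ModelWithCorners ℝ (Euc n') H'} {N : Type*} [TopologicalSpace N] [ChartedSpace H' N]
    [IsManifold J ∞ N] {f : M → N} {e : OpenPartialHomeomorph M H}
    {e' : OpenPartialHomeomorph N H'} (he : e ∈ IsManifold.maximalAtlas I ∞ M)
    (he' : e' ∈ IsManifold.maximalAtlas J ∞ N) {y : Euc n} (hy : y ∈ (e.extend I).target)
    (hf : MDifferentiableAt I J f ((e.extend I).symm y)) (hy' : f ((e.extend I).symm y) ∈ e'.source)
    {L : Euc n →L[ℝ] Euc n'} (hL : Function.Injective L)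
    (hw : EqOn (e'.extend J ∘ f ∘ (e.extend I).symm) L (e.extend I).target) :
    Function.Injective (mfderiv I J f ((e.extend I).symm y)) := by
  have hx : (e.extend I).symm y ∈ e.source := by simpa using (e.extend I).map_target hy
  have h1 : HasMFDerivWithinAt 𝓘(ℝ, Euc n) I (e.extend I).symm (range I) y
      (chartSymmDeriv I e y) := (mdifferentiableWithinAt_extend_symm he hy).hasMFDerivWithinAt
  have h2 : HasMFDerivAt J 𝓘(ℝ, Euc n') (e'.extend J) (f ((e.extend I).symm y))
      (chartDeriv J e' (f ((e.extend I).symm y))) := (mdifferentiableAt_extend he' hy').hasMFDerivAt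
  have h4 := ((h2.comp _ hf.hasMFDerivAt).comp_hasMFDerivWithinAt _ h1).hasFDerivWithinAt
  have h6 := h4.congr_of_eventuallyEq (f₁ := L) (by
    filter_upwards [target_mem_nhdsWithin_range hy] with z hz using (hw hz).symm) (hw hy).symm
  have h7 := (I.uniqueDiffOn _ (e.extend_target_subset_range hy)).eq L.hasFDerivWithinAt h6
  refine (injective_iff_map_eq_zero (mfderiv I J f ((e.extend I).symm y))).2 fun v hv ↦ ?_
  have h8 : ∀ w, L w = chartDeriv J e' (f ((e.extend I).symm y))
      (mfderiv I J f ((e.extend I).symm y) (chartSymmDeriv I e y w)) := fun w ↦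
    congrArg (fun L : Euc n →L[ℝ] Euc n' ↦ L w) h7
  have h11 := chartSymmDeriv_chartDeriv he hx v
  rw [(e.extend I).right_inv hy] at h11
  have h9 := h8 (chartDeriv I e ((e.extend I).symm y) v)
  rw [h11, show mfderiv I J f ((e.extend I).symm y) v = 0 from hv] at h9
  replace h9 := h9.trans (map_zero (chartDeriv J e' _))
  rw [(injective_iff_map_eq_zero L).1 hL _ h9, map_zero] at h11
  exact h11.symm

/-- An immersion, defined by a linear normal form in suitable charts, has injective derivative. -/
theorem mfderiv_injective_of_isImmersionAt [IsManifold I ∞ M]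
    {n' : ℕ} {H' : Type*} [TopologicalSpace H']
    {J : ModelWithCorners ℝ (Euc n') H'} {N : Type*} [TopologicalSpace N] [ChartedSpace H' N]
    [IsManifold J ∞ N] {f : M → N} {x : M} (h : Manifold.IsImmersionAt I J ∞ f x) :
    Function.Injective (mfderiv I J f x) := by
  have hx := h.mem_domChart_source
  have hyx : (h.domChart.extend I).symm (h.domChart.extend I x) = x :=
    (h.domChart.extend I).left_inv (by simpa using hx)
  have h1 := mfderiv_injective_of_writtenInCharts (f := f) (y := h.domChart.extend I x)
    (L := (h.equiv : (Euc n × h.complement) →L[ℝ] Euc n') ∘L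
      ContinuousLinearMap.inl ℝ (Euc n) h.complement)
    h.domChart_mem_maximalAtlas h.codChart_mem_maximalAtlas
    ((h.domChart.extend I).map_source (by simpa using hx))
    (by rw [hyx]; exact h.contMDiffAt.mdifferentiableAt (by simp))
    (by rw [hyx]; exact h.mem_codChart_source)
    (h.equiv.injective.comp fun v w hvw ↦ (Prod.mk.inj hvw).1) h.writtenInCharts
  rwa [hyx] at h1

end General

/-- A positive definite form on a finite dimensional space is invertible as a map to the dual. -/
theorem isInvertible_of_pos {n : ℕ} {A : Euc n →L[ℝ] Euc n →L[ℝ] ℝ}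
    (hA : ∀ v, v ≠ 0 → 0 < A v v) : A.IsInvertible := by
  have hinj : Function.Injective A := (injective_iff_map_eq_zero A).2 fun v hv ↦ by
    by_contra hne
    have := hA v hne
    rw [hv] at this
    simp at this
  have hfin : Module.finrank ℝ (Euc n) = Module.finrank ℝ (Euc n →L[ℝ] ℝ) := by
    rw [← (LinearMap.toContinuousLinearMap (𝕜 := ℝ) (E := Euc n) (F' := ℝ)).finrank_eq]
    exact Subspace.dual_finrank_eq.symm
  exact ⟨(A.toLinearMap.linearEquivOfInjective hinj hfin).toContinuousLinearEquiv, by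
    ext v; rfl⟩

section HalfSpaceRestrict

variable {d : ℕ}

/-- A partial homeomorphism of `ℝᵈ⁺¹` which preserves the half-space, as a partial homeomorphism of
the half-space. -/
def halfSpaceRestrict (T : OpenPartialHomeomorph (Euc (d + 1)) (Euc (d + 1)))
    (hT : ∀ y ∈ T.source, 0 ≤ T y 0 ↔ 0 ≤ y 0) :
    OpenPartialHomeomorph (EuclideanHalfSpace (d + 1)) (EuclideanHalfSpace (d + 1)) where
  toFun x := (𝓡∂ (d + 1)).symm (T ((𝓡∂ (d + 1)) x))
  invFun x := (𝓡∂ (d + 1)).symm (T.symm ((𝓡∂ (d + 1)) x))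
  source := (𝓡∂ (d + 1)) ⁻¹' T.source
  target := (𝓡∂ (d + 1)) ⁻¹' T.target
  map_source' x hx := by
    change (𝓡∂ (d + 1)) ((𝓡∂ (d + 1)).symm (T ((𝓡∂ (d + 1)) x))) ∈ T.target
    rw [(𝓡∂ (d + 1)).right_inv (mem_range_halfSpace.2
      ((hT _ hx).2 (mem_range_halfSpace.1 (mem_range_self _))))]
    exact T.map_source hx
  map_target' x hx := by
    change (𝓡∂ (d + 1)) ((𝓡∂ (d + 1)).symm (T.symm ((𝓡∂ (d + 1)) x))) ∈ T.source
    rw [(𝓡∂ (d + 1)).right_inv (mem_range_halfSpace.2 ((hT _ (T.map_target hx)).1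
      (by rw [T.right_inv hx]; exact mem_range_halfSpace.1 (mem_range_self _))))]
    exact T.map_target hx
  left_inv' x hx := by
    rw [(𝓡∂ (d + 1)).right_inv (mem_range_halfSpace.2
      ((hT _ hx).2 (mem_range_halfSpace.1 (mem_range_self _)))), T.left_inv hx,
      (𝓡∂ (d + 1)).left_inv]
  right_inv' x hx := by
    rw [(𝓡∂ (d + 1)).right_inv (mem_range_halfSpace.2 ((hT _ (T.map_target hx)).1
      (by rw [T.right_inv hx]; exact mem_range_halfSpace.1 (mem_range_self _)))), T.right_inv hx,
      (𝓡∂ (d + 1)).left_inv]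
  open_source := T.open_source.preimage (𝓡∂ (d + 1)).continuous
  open_target := T.open_target.preimage (𝓡∂ (d + 1)).continuous
  continuousOn_toFun := (𝓡∂ (d + 1)).continuous_symm.comp_continuousOn
    (T.continuousOn.comp (𝓡∂ (d + 1)).continuous.continuousOn fun _ hx ↦ hx)
  continuousOn_invFun := (𝓡∂ (d + 1)).continuous_symm.comp_continuousOn
    (T.symm.continuousOn.comp (𝓡∂ (d + 1)).continuous.continuousOn fun _ hx ↦ hx)

theorem halfSpaceRestrict_mem_contDiffGroupoid
    {T : OpenPartialHomeomorph (Euc (d + 1)) (Euc (d + 1))}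
    (hT : ∀ y ∈ T.source, 0 ≤ T y 0 ↔ 0 ≤ y 0)
    (h1 : ContDiffOn ℝ ∞ T ({x | 0 ≤ x 0} ∩ T.source))
    (h2 : ContDiffOn ℝ ∞ T.symm ({x | 0 ≤ x 0} ∩ T.target)) :
    halfSpaceRestrict T hT ∈ contDiffGroupoid ∞ (𝓡∂ (d + 1)) := by
  rw [contDiffGroupoid, mem_groupoid_of_pregroupoid]
  constructor
  · refine h1.congr_mono (fun x hx ↦ ?_) fun x hx ↦ ?_
    · have hx1 : T x ∈ range (𝓡∂ (d + 1)) := by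
        have : x ∈ T.source := by
          have h := hx.1
          change (𝓡∂ (d + 1)) ((𝓡∂ (d + 1)).symm x) ∈ T.source at h
          rwa [(𝓡∂ (d + 1)).right_inv hx.2] at h
        exact mem_range_halfSpace.2 ((hT x this).2 (mem_range_halfSpace.1 hx.2))
      change (𝓡∂ (d + 1)) ((𝓡∂ (d + 1)).symm (T ((𝓡∂ (d + 1)) ((𝓡∂ (d + 1)).symm x)))) = T x
      rw [(𝓡∂ (d + 1)).right_inv hx.2, (𝓡∂ (d + 1)).right_inv hx1]
    · have h := hx.1
      change (𝓡∂ (d + 1)) ((𝓡∂ (d + 1)).symm x) ∈ T.source at h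
      rw [(𝓡∂ (d + 1)).right_inv hx.2] at h
      exact ⟨mem_range_halfSpace.1 hx.2, h⟩
  · refine h2.congr_mono (fun x hx ↦ ?_) fun x hx ↦ ?_
    · have hx1 : T.symm x ∈ range (𝓡∂ (d + 1)) := by
        have : x ∈ T.target := by
          have h := hx.1
          change (𝓡∂ (d + 1)) ((𝓡∂ (d + 1)).symm x) ∈ T.target at h
          rwa [(𝓡∂ (d + 1)).right_inv hx.2] at h
        refine mem_range_halfSpace.2 ((hT _ (T.map_target this)).1 ?_)
        rw [T.right_inv this]
        exact mem_range_halfSpace.1 hx.2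
      change (𝓡∂ (d + 1)) ((𝓡∂ (d + 1)).symm (T.symm ((𝓡∂ (d + 1)) ((𝓡∂ (d + 1)).symm x)))) = T.symm x
      rw [(𝓡∂ (d + 1)).right_inv hx.2, (𝓡∂ (d + 1)).right_inv hx1]
    · have h := hx.1
      change (𝓡∂ (d + 1)) ((𝓡∂ (d + 1)).symm x) ∈ T.target at h
      rw [(𝓡∂ (d + 1)).right_inv hx.2] at h
      exact ⟨mem_range_halfSpace.1 hx.2, h⟩

end HalfSpaceRestrict

/-! ### Existence of collar charts -/

variable {d : ℕ} {B : Type*} [TopologicalSpace B] [ChartedSpace (Euc d) B]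
  {M : Type*} [TopologicalSpace M] [ChartedSpace (EuclideanHalfSpace (d + 1)) M]
  [IsManifold (𝓡∂ (d + 1)) ∞ M]

/-- The gradient of `f`, scaled by `σ`, in the coordinates of a chart. -/
theorem exists_coord_gradient (g : Metric (𝓡∂ (d + 1)) M) {f : M → ℝ}
    (hf : ContMDiff (𝓡∂ (d + 1)) 𝓘(ℝ, ℝ) ∞ f)
    {e : OpenPartialHomeomorph M (EuclideanHalfSpace (d + 1))}
    (he : e ∈ IsManifold.maximalAtlas (𝓡∂ (d + 1)) ∞ M) (σ : ℝ) :
    ∃ Y : Euc (d + 1) → Euc (d + 1), ContDiffOn ℝ ∞ Y (e.extend (𝓡∂ (d + 1))).target ∧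
      ∀ y ∈ (e.extend (𝓡∂ (d + 1))).target, ∀ v, coordMetric g e y (Y y) v =
        σ * fderivWithin ℝ (f ∘ (e.extend (𝓡∂ (d + 1))).symm) (range (𝓡∂ (d + 1))) y v := by
  have hinv : ∀ y ∈ (e.extend (𝓡∂ (d + 1))).target, (coordMetric g e y).IsInvertible :=
    fun y hy ↦ isInvertible_of_pos fun v hv ↦ coordMetric_pos g he hy hv
  refine ⟨fun y ↦ (coordMetric g e y).inverse (σ •
    fderivWithin ℝ (f ∘ (e.extend (𝓡∂ (d + 1))).symm) (range (𝓡∂ (d + 1))) y), ?_, ?_⟩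
  · refine ContDiffOn.clm_apply (fun y hy ↦ ?_) (ContDiffOn.const_smul σ fun y hy ↦ ?_)
    · obtain ⟨E, hE⟩ := hinv y hy
      have h1 : ContDiffAt ℝ ∞ ContinuousLinearMap.inverse (coordMetric g e y) :=
        hE ▸ contDiffAt_map_inverse E
      exact h1.comp_contDiffWithinAt y (contDiffOn_coordMetric g he y hy)
    · exact ((contDiffWithinAt_comp_extend_symm hf he hy).fderivWithin_right (m := ∞)
        uniqueDiffOn_halfSpace (by simp) (e.extend_target_subset_range hy)).mono
        e.extend_target_subset_range
  · intro y hy v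
    obtain ⟨E, hE⟩ := hinv y hy
    have h1 : coordMetric g e y ((coordMetric g e y).inverse (σ •
        fderivWithin ℝ (f ∘ (e.extend (𝓡∂ (d + 1))).symm) (range (𝓡∂ (d + 1))) y)) =
        σ • fderivWithin ℝ (f ∘ (e.extend (𝓡∂ (d + 1))).symm) (range (𝓡∂ (d + 1))) y := by
      rw [← hE]
      simp
    rw [h1]
    rfl

/-- At a boundary point where `σ ∂f/∂ν < 0`, the field `σ ∇f` points into the half-space. -/
theorem coord_gradient_pos {A : Euc (d + 1) →L[ℝ] Euc (d + 1) →L[ℝ] ℝ}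
    (hA : ∀ v w, A v w = A w v) {N Y : Euc (d + 1)} (hN0 : N 0 < 0) (hN1 : A N N = 1)
    (hNt : ∀ v : Euc (d + 1), v 0 = 0 → A N v = 0) (hY : A Y N < 0) : 0 < Y 0 := by
  have key : ∀ v : Euc (d + 1), A v N = v 0 * A (inward d) N := by
    intro v
    conv_lhs => rw [← bdryIncl_bdryProj v]
    rw [map_add, map_smul, add_apply, smul_apply, hA (bdryIncl d _) N, hNt _ (bdryIncl_zero _),
      zero_add, smul_eq_mul]
  rw [key] at hY hN1
  by_contra hcon
  have h1 : A (inward d) N < 0 := by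
    by_contra h
    nlinarith
  nlinarith

/-- The expression of a boundary inclusion in charts: smooth, and with injective derivative. -/
theorem exists_coord_boundary [IsManifold (𝓡 d) ∞ B] {j : B → M} (hj : IsBoundaryInclusion d j)
    {κ : OpenPartialHomeomorph B (Euc d)} (hκ : κ ∈ IsManifold.maximalAtlas (𝓡 d) ∞ B)
    {e : OpenPartialHomeomorph M (EuclideanHalfSpace (d + 1))}
    (he : e ∈ IsManifold.maximalAtlas (𝓡∂ (d + 1)) ∞ M) {b : B} (hb : b ∈ κ.source)
    (hbe : j b ∈ e.source) :
    ∃ (β : Euc (d + 1) → Euc (d + 1)) (U : Set (Euc (d + 1))), IsOpen U ∧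
      bdryIncl d (κ b) ∈ U ∧ ContDiffOn ℝ ∞ β U ∧ (∀ p ∈ U, β p 0 = 0) ∧
      (∀ p ∈ U, bdryProj d p ∈ κ.target ∧ j (κ.symm (bdryProj d p)) ∈ e.source ∧
        β p = e.extend (𝓡∂ (d + 1)) (j (κ.symm (bdryProj d p)))) ∧
      ∀ w : Euc (d + 1), w 0 = 0 → fderiv ℝ β (bdryIncl d (κ b)) w = 0 → w = 0 := by
  have hjs := hj.embedding.contMDiff
  let V : Set (Euc d) := κ.target ∩ κ.symm ⁻¹' (j ⁻¹' e.source)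
  have hV : IsOpen V := κ.isOpen_inter_preimage_symm (e.open_source.preimage hjs.continuous)
  let β₀ : Euc d → Euc (d + 1) := fun u ↦ e.extend (𝓡∂ (d + 1)) (j (κ.symm u))
  have hκV : κ b ∈ V := ⟨κ.map_source hb, by
    change j (κ.symm (κ b)) ∈ e.source
    rwa [κ.left_inv hb]⟩
  have hβ₀ : ContDiffOn ℝ ∞ β₀ V := by
    rw [← contMDiffOn_iff_contDiffOn]
    refine ContMDiffOn.comp (t := e.source) (I' := 𝓡∂ (d + 1))
      (OpenPartialHomeomorph.contMDiffOn_extend he) ?_ fun u hu ↦ hu.2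
    exact hjs.comp_contMDiffOn ((contMDiffOn_symm_of_mem_maximalAtlas hκ).mono fun u hu ↦ hu.1)
  have hinj : Function.Injective (fderiv ℝ β₀ (κ b)) := by
    have hκy : κ.extend (𝓡 d) b ∈ (κ.extend (𝓡 d)).target :=
      (κ.extend (𝓡 d)).map_source (by simpa using hb)
    have hκb : (κ.extend (𝓡 d)).symm (κ.extend (𝓡 d) b) = b :=
      (κ.extend (𝓡 d)).left_inv (by simpa using hb)
    obtain ⟨L, hL, hLinj⟩ : ∃ L : Euc d →L[ℝ] Euc (d + 1),
        HasMFDerivAt (𝓡 d) 𝓘(ℝ, Euc (d + 1)) (e.extend (𝓡∂ (d + 1)) ∘ j)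
          ((κ.extend (𝓡 d)).symm (κ.extend (𝓡 d) b)) L ∧ Function.Injective L := by
      rw [hκb]
      refine ⟨_, (mdifferentiableAt_extend he hbe).hasMFDerivAt.comp b
        (hjs.mdifferentiable (by simp) b).hasMFDerivAt, ?_⟩
      exact (Function.LeftInverse.injective (chartSymmDeriv_chartDeriv he hbe)).comp
        (mfderiv_injective_of_isImmersionAt (hj.embedding.isImmersion.isImmersionAt b))
    have h1 : HasFDerivWithinAt β₀ (L ∘L chartSymmDeriv (𝓡 d) κ (κ b)) (range (𝓡 d)) (κ b) :=
      (hL.comp_hasMFDerivWithinAt _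
        (mdifferentiableWithinAt_extend_symm hκ hκy).hasMFDerivWithinAt).hasFDerivWithinAt
    rw [(𝓡 d).range_eq_univ, hasFDerivWithinAt_univ] at h1
    rw [h1.fderiv]
    exact hLinj.comp (Function.LeftInverse.injective (chartDeriv_chartSymmDeriv hκ hκy))
  refine ⟨β₀ ∘ bdryProj d, bdryProj d ⁻¹' V, hV.preimage (bdryProj d).continuous, ?_, ?_, ?_, ?_, ?_⟩
  · change bdryProj d (bdryIncl d (κ b)) ∈ V
    rwa [bdryProj_bdryIncl]
  · exact hβ₀.comp (bdryProj d).contDiff.contDiffOn fun p hp ↦ hp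
  · intro p hp
    refine extend_zero_of_mem_boundary ?_ he hp.2
    rw [← hj.range_eq]
    exact mem_range_self _
  · exact fun p hp ↦ ⟨hp.1, hp.2, rfl⟩
  · intro w hw h
    have h1 : HasFDerivAt β₀ (fderiv ℝ β₀ (κ b)) (bdryProj d (bdryIncl d (κ b))) := by
      rw [bdryProj_bdryIncl]
      exact ((hβ₀.contDiffAt (hV.mem_nhds hκV)).differentiableAt (by simp)).hasFDerivAt
    have h2 := h1.comp (bdryIncl d (κ b)) (bdryProj d).hasFDerivAt
    rw [h2.fderiv] at h
    have h3 : bdryProj d w = 0 := hinj (h.trans (map_zero _).symm)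
    rw [← bdryIncl_bdryProj_of_zero hw, h3, map_zero]

/-- Around a boundary point at which the Neumann data does not vanish, a collar chart over a given
boundary chart exists. -/
theorem exists_collarChart [IsManifold (𝓡 d) ∞ B] {g : Metric (𝓡∂ (d + 1)) M} {f : M → ℝ}
    (hf : ContMDiff (𝓡∂ (d + 1)) 𝓘(ℝ, ℝ) ∞ f) {j : B → M} (hj : IsBoundaryInclusion d j)
    {κ : OpenPartialHomeomorph B (Euc d)} (hκ : κ ∈ IsManifold.maximalAtlas (𝓡 d) ∞ B)
    {b : B} (hb : b ∈ κ.source) {σ c : ℝ} (hc : HasNormalDeriv g f (j b) c) (hσ : σ * c < 0) :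
    ∃ Θ, IsCollarChart g f j κ σ Θ ∧ j b ∈ Θ.source := by
  obtain ⟨e, he, hbe⟩ : ∃ e ∈ IsManifold.maximalAtlas (𝓡∂ (d + 1)) ∞ M, j b ∈ e.source :=
    ⟨_, IsManifold.chart_mem_maximalAtlas (j b), mem_chart_source _ _⟩
  obtain ⟨Y, hY, hYg⟩ := exists_coord_gradient g hf he σ
  obtain ⟨β, U, hU, hbU, hβ, hβ0, hβe, hinj⟩ := exists_coord_boundary hj hκ he hb hbe
  have hβb : β (bdryIncl d (κ b)) = e.extend (𝓡∂ (d + 1)) (j b) := by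
    rw [(hβe _ hbU).2.2, bdryProj_bdryIncl, κ.left_inv hb]
  have hy : e.extend (𝓡∂ (d + 1)) (j b) ∈ (e.extend (𝓡∂ (d + 1))).target :=
    (e.extend (𝓡∂ (d + 1))).map_source (by simpa using hbe)
  have htarget : (e.extend (𝓡∂ (d + 1))).target =
      {x : Euc (d + 1) | 0 ≤ EuclideanSpace.proj (𝕜 := ℝ) (0 : Fin (d + 1)) x} ∩
        (𝓡∂ (d + 1)).symm ⁻¹' e.target := by
    rw [e.extend_target, range_halfSpace, inter_comm]
    rfl
  have hpos : 0 < Y (e.extend (𝓡∂ (d + 1)) (j b)) 0 := by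
    obtain ⟨N, hN0, hN1, hNt, hNc⟩ := exists_coord_normal hf he hy (hβb ▸ hβ0 _ hbU) (c := c) (by
      rw [(e.extend (𝓡∂ (d + 1))).left_inv (by simpa using hbe)]
      exact hc)
    refine coord_gradient_pos (coordMetric_symm g e _) hN0 hN1 hNt ?_
    rw [hYg _ hy, hNc]
    exact hσ
  obtain ⟨T, hT1, hT2, hT3, hT4, hT5, hT6, hT7, hT8⟩ := exists_halfSpace_flowBox
    (EuclideanSpace.proj (𝕜 := ℝ) (0 : Fin (d + 1))) (e := inward d) (by simp)
    (e.open_target.preimage (𝓡∂ (d + 1)).continuous_symm) (htarget ▸ hY) hU hβ hβ0 hbU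
    (by simp)
    (by
      change β (bdryIncl d (κ b)) ∈ _
      rw [hβb]
      exact (htarget ▸ hy).2)
    (by rw [hβb]; exact hpos) hinj
  have hTH : ∀ y ∈ T.source, 0 ≤ T y 0 ↔ 0 ≤ y 0 := hT4
  set G := halfSpaceRestrict T hTH
  have hG : G ∈ contDiffGroupoid ∞ (𝓡∂ (d + 1)) :=
    halfSpaceRestrict_mem_contDiffGroupoid hTH hT6 hT7
  have hG' : G.symm ∈ contDiffGroupoid ∞ (𝓡∂ (d + 1)) := StructureGroupoid.symm _ hG
  have hmem := trans_mem_maximalAtlas he hG'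
  -- the inverse of the new chart is the inverse of the old one precomposed with `T`
  have hsub : ∀ y ∈ ((e.trans G.symm).extend (𝓡∂ (d + 1))).target,
      y ∈ T.source ∧ 0 ≤ y 0 ∧ T y ∈ (e.extend (𝓡∂ (d + 1))).target ∧
      ((e.trans G.symm).extend (𝓡∂ (d + 1))).symm y = (e.extend (𝓡∂ (d + 1))).symm (T y) := by
    intro y hy
    rw [OpenPartialHomeomorph.extend_target] at hy
    obtain ⟨⟨h1, h2⟩, h3⟩ := hy
    change (𝓡∂ (d + 1)) ((𝓡∂ (d + 1)).symm y) ∈ T.source at h1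
    change (𝓡∂ (d + 1)).symm (T ((𝓡∂ (d + 1)) ((𝓡∂ (d + 1)).symm y))) ∈ e.target at h2
    rw [(𝓡∂ (d + 1)).right_inv h3] at h1 h2
    have h4 := mem_range_halfSpace.1 h3
    refine ⟨h1, h4, ?_, ?_⟩
    · rw [e.extend_target]
      exact ⟨h2, mem_range_halfSpace.2 ((hTH y h1).2 h4)⟩
    · change e.symm ((𝓡∂ (d + 1)).symm (T ((𝓡∂ (d + 1)) ((𝓡∂ (d + 1)).symm y)))) = _
      rw [(𝓡∂ (d + 1)).right_inv h3]
      rfl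
  refine ⟨e.trans G.symm, ⟨hmem, ?_, ?_, ?_⟩, ?_⟩
  · intro u hu
    obtain ⟨h1, -, -⟩ := hsub _ hu
    have h2 := hT2 _ h1
    have h3 := (hβe _ h2).1
    simpa using h3
  · intro u hu
    obtain ⟨h1, -, -, h2⟩ := hsub _ hu
    have h3 := hT2 _ h1
    rw [show EuclideanSpace.proj (𝕜 := ℝ) (0 : Fin (d + 1)) (bdryIncl d u) = 0 from by simp,
      zero_smul, sub_zero] at h3
    obtain ⟨-, h4, h5⟩ := hβe _ h3
    rw [h2, hT5 _ h1 (by simp), h5, bdryProj_bdryIncl]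
    rw [bdryProj_bdryIncl] at h4
    exact (e.extend (𝓡∂ (d + 1))).left_inv (by simpa using h4)
  · intro y hy v
    obtain ⟨h1, h2, h3, h4⟩ := hsub y hy
    have hyr := mem_range_halfSpace.2 h2
    have hTd : DifferentiableWithinAt ℝ T (range (𝓡∂ (d + 1))) y := by
      have h5 := (hT6 y ⟨h2, h1⟩).differentiableWithinAt (by simp)
      rw [range_halfSpace]
      exact (differentiableWithinAt_inter (T.open_source.mem_nhds h1)).1 h5
    have hTe : fderivWithin ℝ T (range (𝓡∂ (d + 1))) y (inward d) = Y (T y) := by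
      rw [range_halfSpace]
      exact hT8 y ⟨h2, h1⟩
    have hev : ((e.trans G.symm).extend (𝓡∂ (d + 1))).symm =ᶠ[𝓝[range (𝓡∂ (d + 1))] y]
        (e.extend (𝓡∂ (d + 1))).symm ∘ T := by
      filter_upwards [target_mem_nhdsWithin_range hy] with z hz using (hsub z hz).2.2.2
    have hmaps : ∀ᶠ z in 𝓝[range (𝓡∂ (d + 1))] y, T z ∈ range (𝓡∂ (d + 1)) := by
      filter_upwards [target_mem_nhdsWithin_range hy] with z hz using
        e.extend_target_subset_range (hsub z hz).2.2.1
    have hu := uniqueDiffOn_halfSpace (d := d) y hyr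
    have h6 : coordMetric g (e.trans G.symm) y (inward d) v = coordMetric g e (T y) (Y (T y))
        (fderivWithin ℝ T (range (𝓡∂ (d + 1))) y v) := by
      rw [coordMetric, pullForm_congr g hev h4,
        pullForm_comp g (mdifferentiableWithinAt_extend_symm he h3) hTd hmaps hu, hTe]
      rfl
    rw [h6, hYg _ h3]
    congr 1
    have h7 := (contDiffWithinAt_comp_extend_symm hf he h3).differentiableWithinAt (by simp)
    have h8 := h7.hasFDerivWithinAt.comp_of_tendsto y hTd.hasFDerivWithinAt
      (tendsto_nhdsWithin_iff.2 ⟨hTd.continuousWithinAt, hmaps⟩)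
    have h9 : f ∘ ((e.trans G.symm).extend (𝓡∂ (d + 1))).symm =ᶠ[𝓝[range (𝓡∂ (d + 1))] y]
        (f ∘ (e.extend (𝓡∂ (d + 1))).symm) ∘ T := by
      filter_upwards [hev] with z hz using congrArg f hz
    rw [h9.fderivWithin_eq (congrArg f h4), h8.fderivWithin hu]
    rfl
  · refine ⟨hbe, ?_⟩
    change (𝓡∂ (d + 1)) (e (j b)) ∈ T.target
    have h1 := T.map_source hT1
    rw [hT5 _ hT1 (by simp), hβb] at h1
    exact h1

/-! ### Local isometries near the boundary -/

variable {d : ℕ} {B : Type*} [TopologicalSpace B] [ChartedSpace (Euc d) B]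
  {M : Type*} [TopologicalSpace M] [ChartedSpace (EuclideanHalfSpace (d + 1)) M]
  [IsManifold (𝓡∂ (d + 1)) ∞ M]
  {M' : Type*} [TopologicalSpace M'] [ChartedSpace (EuclideanHalfSpace (d + 1)) M']
  [IsManifold (𝓡∂ (d + 1)) ∞ M']

omit [ChartedSpace (Euc d) B] in
theorem IsCollarChart.restr {g : Metric (𝓡∂ (d + 1)) M} {f : M → ℝ} {j : B → M}
    {κ : OpenPartialHomeomorph B (Euc d)} {σ : ℝ}
    {Θ : OpenPartialHomeomorph M (EuclideanHalfSpace (d + 1))} (h : IsCollarChart g f j κ σ Θ)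
    {s : Set M} (hs : IsOpen s) : IsCollarChart g f j κ σ (Θ.restr s) := by
  have hsub : ((Θ.restr s).extend (𝓡∂ (d + 1))).target ⊆ (Θ.extend (𝓡∂ (d + 1))).target := by
    intro y hy
    rw [OpenPartialHomeomorph.extend_target] at hy ⊢
    refine ⟨?_, hy.2⟩
    have h1 : (𝓡∂ (d + 1)).symm y ∈ (Θ.restr s).target := hy.1
    rw [OpenPartialHomeomorph.restr_target] at h1
    exact h1.1
  exact ⟨restr_mem_maximalAtlas _ h.mem_maximalAtlas hs, fun u hu ↦ h.boundary_mem u (hsub hu),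
    fun u hu ↦ h.boundary_eq u (hsub hu), fun y hy ↦ h.grad y (hsub hy)⟩

/-- A collar chart can be shrunk so that its image is any sufficiently small half-ball. -/
theorem IsCollarChart.exists_shrink {g : Metric (𝓡∂ (d + 1)) M} {f : M → ℝ} {j : B → M}
    {κ : OpenPartialHomeomorph B (Euc d)} {σ : ℝ}
    {Θ : OpenPartialHomeomorph M (EuclideanHalfSpace (d + 1))} (h : IsCollarChart g f j κ σ Θ)
    (hj : IsBoundaryInclusion d j) {b : B} (hb : j b ∈ Θ.source) :
    ∃ R > 0, ∀ r, 0 < r → r ≤ R → ∃ Θ', IsCollarChart g f j κ σ Θ' ∧ j b ∈ Θ'.source ∧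
      (Θ'.extend (𝓡∂ (d + 1))).target =
        range (𝓡∂ (d + 1)) ∩ Metric.ball (bdryIncl d (κ b)) r := by
  have hb' := (h.apply_boundary hj hb).2
  have hy : bdryIncl d (κ b) ∈ (Θ.extend (𝓡∂ (d + 1))).target := by
    rw [← hb']
    exact (Θ.extend (𝓡∂ (d + 1))).map_source (by simpa using hb)
  obtain ⟨R, hR, hball⟩ := Metric.mem_nhdsWithin_iff.1 (target_mem_nhdsWithin_range hy)
  refine ⟨R, hR, fun r hr hrR ↦ ?_⟩
  let s := Θ.source ∩ Θ ⁻¹' ((𝓡∂ (d + 1)) ⁻¹' Metric.ball (bdryIncl d (κ b)) r)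
  have hs : IsOpen s := Θ.isOpen_inter_preimage
    (Metric.isOpen_ball.preimage (𝓡∂ (d + 1)).continuous)
  refine ⟨Θ.restr s, h.restr hs, ?_, ?_⟩
  · rw [OpenPartialHomeomorph.restr_source, hs.interior_eq]
    refine ⟨hb, hb, ?_⟩
    change Θ.extend (𝓡∂ (d + 1)) (j b) ∈ Metric.ball (bdryIncl d (κ b)) r
    rw [hb']
    exact Metric.mem_ball_self hr
  · ext y
    rw [OpenPartialHomeomorph.extend_target, OpenPartialHomeomorph.restr_target, hs.interior_eq]
    constructor
    · rintro ⟨⟨h1, h2, h3⟩, h4⟩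
      refine ⟨h4, ?_⟩
      change (𝓡∂ (d + 1)) (Θ (Θ.symm ((𝓡∂ (d + 1)).symm y))) ∈
        Metric.ball (bdryIncl d (κ b)) r at h3
      rwa [Θ.right_inv h1, (𝓡∂ (d + 1)).right_inv h4] at h3
    · rintro ⟨h4, h5⟩
      have h1 := hball ⟨Metric.ball_subset_ball hrR h5, h4⟩
      rw [OpenPartialHomeomorph.extend_target] at h1
      refine ⟨⟨h1.1, Θ.map_target h1.1, ?_⟩, h4⟩
      change (𝓡∂ (d + 1)) (Θ (Θ.symm ((𝓡∂ (d + 1)).symm y))) ∈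
        Metric.ball (bdryIncl d (κ b)) r
      rwa [Θ.right_inv h1.1, (𝓡∂ (d + 1)).right_inv h4]

/-- The transition map between two charts of different manifolds with the same image pulls back one
metric to the other if the charts induce the same metric coefficients. -/
theorem pullback_trans_symm {g : Metric (𝓡∂ (d + 1)) M} {g' : Metric (𝓡∂ (d + 1)) M'}
    {Θ : OpenPartialHomeomorph M (EuclideanHalfSpace (d + 1))}
    {Θ' : OpenPartialHomeomorph M' (EuclideanHalfSpace (d + 1))}
    (h : Θ ∈ IsManifold.maximalAtlas (𝓡∂ (d + 1)) ∞ M)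
    (h' : Θ' ∈ IsManifold.maximalAtlas (𝓡∂ (d + 1)) ∞ M') {x : M'} (hx : x ∈ Θ'.source)
    (ht : Θ'.extend (𝓡∂ (d + 1)) x ∈ (Θ.extend (𝓡∂ (d + 1))).target)
    (heq : coordMetric g Θ (Θ'.extend (𝓡∂ (d + 1)) x) =
      coordMetric g' Θ' (Θ'.extend (𝓡∂ (d + 1)) x)) (v w : TangentSpace (𝓡∂ (d + 1)) x) :
    pullback (𝓡∂ (d + 1)) g (Θ'.trans Θ.symm) x v w = g'.inner x v w := by
  have h1 : HasMFDerivWithinAt (𝓡∂ (d + 1)) 𝓘(ℝ, Euc (d + 1)) (Θ'.extend (𝓡∂ (d + 1))) univ x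
      (chartDeriv (𝓡∂ (d + 1)) Θ' x) :=
    (mdifferentiableAt_extend h' hx).hasMFDerivAt.hasMFDerivWithinAt
  have h2 := ((mdifferentiableWithinAt_extend_symm h ht).hasMFDerivWithinAt.comp x h1
    (fun z _ ↦ mem_range_self _))
  rw [hasMFDerivWithinAt_univ] at h2
  have h3 : (Θ.extend (𝓡∂ (d + 1))).symm ∘ Θ'.extend (𝓡∂ (d + 1)) = Θ'.trans Θ.symm := by
    funext z
    change Θ.symm ((𝓡∂ (d + 1)).symm ((𝓡∂ (d + 1)) (Θ' z))) = Θ.symm (Θ' z)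
    rw [(𝓡∂ (d + 1)).left_inv]
  rw [h3] at h2
  rw [pullback, h2.mfderiv]
  have h4 := coordMetric_chartDeriv g' h' hx v w
  rw [← heq] at h4
  rw [← congrFun h3 x]
  exact h4

/-- Near every boundary point there is an isometry from `M'` to `M` which is compatible with the
boundary inclusions and with the solutions of `∇²f + φ(f) g = 0`; any two of these isometries agree
near the boundary points at which both are defined. -/
theorem exists_local_isometries [IsManifold (𝓡 d) ∞ B]
    {g : Metric (𝓡∂ (d + 1)) M} {f : M → ℝ} {j : B → M}
    {g' : Metric (𝓡∂ (d + 1)) M'} {f' : M' → ℝ} {j' : B → M'}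
    (hj : IsBoundaryInclusion d j) (hj' : IsBoundaryInclusion d j')
    (hf : ContMDiff (𝓡∂ (d + 1)) 𝓘(ℝ, ℝ) ∞ f) (hf' : ContMDiff (𝓡∂ (d + 1)) 𝓘(ℝ, ℝ) ∞ f')
    (hgg' : ∀ b v w, pullback (𝓡 d) g j b v w = pullback (𝓡 d) g' j' b v w)
    (hff' : ∀ b, f (j b) = f' (j' b)) {c : B → ℝ} (hc : ∀ b, HasNormalDeriv g f (j b) (c b))
    (hc' : ∀ b, HasNormalDeriv g' f' (j' b) (c b)) (hc0 : ∀ b, c b ≠ 0)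
    {φ : ℝ → ℝ} (hφ : ContDiff ℝ ∞ φ) (ho : SolvesObata g φ f) (ho' : SolvesObata g' φ f') :
    ∃ Φ : B → OpenPartialHomeomorph M' M,
      (∀ b, j' b ∈ (Φ b).source) ∧
      (∀ b a, j' a ∈ (Φ b).source ↔ j a ∈ (Φ b).target) ∧
      (∀ b a, j' a ∈ (Φ b).source → Φ b (j' a) = j a) ∧
      (∀ b, ContMDiffOn (𝓡∂ (d + 1)) (𝓡∂ (d + 1)) ∞ (Φ b) (Φ b).source) ∧
      (∀ b, ∀ x ∈ (Φ b).source, f (Φ b x) = f' x) ∧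
      (∀ b, ∀ x ∈ (Φ b).source, ∀ v w, pullback (𝓡∂ (d + 1)) g (Φ b) x v w = g'.inner x v w) ∧
      ∀ b b' a, j' a ∈ (Φ b).source → j' a ∈ (Φ b').source → Φ b =ᶠ[𝓝 (j' a)] Φ b' := by
  have hloc : ∀ b, ∃ (κ : OpenPartialHomeomorph B (Euc d)) (σ r : ℝ)
      (Θ : OpenPartialHomeomorph M (EuclideanHalfSpace (d + 1)))
      (Θ' : OpenPartialHomeomorph M' (EuclideanHalfSpace (d + 1))),
      κ ∈ IsManifold.maximalAtlas (𝓡 d) ∞ B ∧ σ * σ = 1 ∧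
      IsCollarChart g f j κ σ Θ ∧ IsCollarChart g' f' j' κ σ Θ' ∧ j b ∈ Θ.source ∧
      j' b ∈ Θ'.source ∧
      (Θ.extend (𝓡∂ (d + 1))).target =
        range (𝓡∂ (d + 1)) ∩ Metric.ball (bdryIncl d (κ b)) r ∧
      (Θ'.extend (𝓡∂ (d + 1))).target =
        range (𝓡∂ (d + 1)) ∩ Metric.ball (bdryIncl d (κ b)) r := by
    intro b
    -- the sign for which `σ ∇f` points inwards at the boundary point
    obtain ⟨σ, hσ, hσc⟩ : ∃ σ : ℝ, σ * σ = 1 ∧ σ * c b < 0 := by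
      rcases (hc0 b).lt_or_gt with h | h
      · exact ⟨1, by norm_num, by linarith⟩
      · exact ⟨-1, by norm_num, by linarith⟩
    have hκ := IsManifold.chart_mem_maximalAtlas (I := 𝓡 d) (n := ∞) b
    obtain ⟨Θ, hΘ, hb⟩ := exists_collarChart hf hj hκ (mem_chart_source _ b) (hc b) hσc
    obtain ⟨Θ', hΘ', hb'⟩ := exists_collarChart hf' hj' hκ (mem_chart_source _ b) (hc' b) hσc
    obtain ⟨R, hR, h1⟩ := hΘ.exists_shrink hj hb
    obtain ⟨R', hR', h2⟩ := hΘ'.exists_shrink hj' hb'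
    obtain ⟨Ψ, hΨ, hΨb, hΨt⟩ := h1 (min R R') (lt_min hR hR') (min_le_left _ _)
    obtain ⟨Ψ', hΨ', hΨb', hΨt'⟩ := h2 (min R R') (lt_min hR hR') (min_le_right _ _)
    exact ⟨_, σ, min R R', Ψ, Ψ', hκ, hσ, hΨ, hΨ', hΨb, hΨb', hΨt, hΨt'⟩
  choose κ σ r Θ Θ' hκ hσ h h' hb hb' ht ht' using hloc
  have htt : ∀ b, (Θ' b).target = (Θ b).target := by
    intro b
    have h1 := (ht' b).trans (ht b).symm
    rw [OpenPartialHomeomorph.extend_target', OpenPartialHomeomorph.extend_target'] at h1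
    exact (𝓡∂ (d + 1)).injective.image_injective h1
  have hsource : ∀ b, ((Θ' b).trans (Θ b).symm).source = (Θ' b).source := by
    intro b
    rw [OpenPartialHomeomorph.trans_source, OpenPartialHomeomorph.symm_source, ← htt]
    exact inter_eq_left.2 fun x hx ↦ (Θ' b).map_source hx
  have htarget : ∀ b, ((Θ' b).trans (Θ b).symm).target = (Θ b).source := by
    intro b
    rw [OpenPartialHomeomorph.trans_target, OpenPartialHomeomorph.symm_target,
      OpenPartialHomeomorph.symm_symm, htt]
    exact inter_eq_left.2 fun x hx ↦ (Θ b).map_source hx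
  have hmem : ∀ b, ∀ x ∈ (Θ' b).source,
      (Θ' b).extend (𝓡∂ (d + 1)) x ∈ ((Θ b).extend (𝓡∂ (d + 1))).target := by
    intro b x hx
    rw [ht, ← ht']
    exact ((Θ' b).extend (𝓡∂ (d + 1))).map_source (by simpa using hx)
  have hΦ : ∀ b x, ((Θ b).extend (𝓡∂ (d + 1))).symm ((Θ' b).extend (𝓡∂ (d + 1)) x) =
      ((Θ' b).trans (Θ b).symm) x := by
    intro b x
    change (Θ b).symm ((𝓡∂ (d + 1)).symm ((𝓡∂ (d + 1)) (Θ' b x))) = (Θ b).symm (Θ' b x)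
    rw [(𝓡∂ (d + 1)).left_inv]
  -- both collar charts restrict to the same chart of `B`, and their images are the same half-ball
  have hiff : ∀ b a, j' a ∈ (Θ' b).source ↔ j a ∈ (Θ b).source := by
    intro b a
    constructor
    · intro ha
      obtain ⟨h1, h2⟩ := (h' b).apply_boundary hj' ha
      have h3 := hmem b _ ha
      rw [h2] at h3
      have h4 := (h b).boundary_eq _ h3
      rw [(κ b).left_inv h1] at h4
      rw [← h4]
      simpa using ((Θ b).extend (𝓡∂ (d + 1))).map_target h3
    · intro ha
      obtain ⟨h1, h2⟩ := (h b).apply_boundary hj ha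
      have h3 : (Θ b).extend (𝓡∂ (d + 1)) (j a) ∈ ((Θ' b).extend (𝓡∂ (d + 1))).target := by
        rw [ht', ← ht]
        exact ((Θ b).extend (𝓡∂ (d + 1))).map_source (by simpa using ha)
      rw [h2] at h3
      have h4 := (h' b).boundary_eq _ h3
      rw [(κ b).left_inv h1] at h4
      rw [← h4]
      simpa using ((Θ' b).extend (𝓡∂ (d + 1))).map_target h3
  have hΦj : ∀ b a, j' a ∈ (Θ' b).source → ((Θ' b).trans (Θ b).symm) (j' a) = j a := by
    intro b a ha
    obtain ⟨h1, h2⟩ := (h' b).apply_boundary hj' ha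
    have h3 := hmem b _ ha
    rw [← hΦ, h2]
    rw [h2] at h3
    rw [(h b).boundary_eq _ h3, (κ b).left_inv h1]
  have hdata : ∀ b, ∀ x ∈ (Θ' b).source,
      f (((Θ' b).trans (Θ b).symm) x) = f' x ∧
      coordMetric g (Θ b) ((Θ' b).extend (𝓡∂ (d + 1)) x) =
        coordMetric g' (Θ' b) ((Θ' b).extend (𝓡∂ (d + 1)) x) := by
    intro b x hx
    have h1 := (h b).data_eq (h' b) (hσ b) (hκ b) hj hj' hf hf' hgg' hff' hc hc' hφ ho ho' (ht b)
      (ht' b) (hmem b x hx)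
    rw [((Θ' b).extend (𝓡∂ (d + 1))).left_inv (by simpa using hx), hΦ] at h1
    exact h1
  refine ⟨fun b ↦ (Θ' b).trans (Θ b).symm, fun b ↦ ?_, fun b a ↦ ?_, fun b a ha ↦ ?_, fun b ↦ ?_,
    fun b x hx ↦ ?_, fun b x hx v w ↦ ?_, fun b b' a ha ha' ↦ ?_⟩
  · rw [hsource]
    exact hb' b
  · rw [hsource, htarget]
    exact hiff b a
  · rw [hsource] at ha
    exact hΦj b a ha
  · rw [hsource]
    exact (contMDiffOn_symm_of_mem_maximalAtlas (h b).mem_maximalAtlas).comp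
      (contMDiffOn_of_mem_maximalAtlas (h' b).mem_maximalAtlas)
      fun x hx ↦ htt b ▸ (Θ' b).map_source hx
  · rw [hsource] at hx
    exact (hdata b x hx).1
  · rw [hsource] at hx
    exact pullback_trans_symm (h b).mem_maximalAtlas (h' b).mem_maximalAtlas hx (hmem b x hx)
      (hdata b x hx).2 v w
  · rw [hsource] at ha ha'
    -- both signs are opposite to the sign of the Neumann data at `a`
    have hσσ : σ b' = σ b := by
      have h1 := (h b).mul_normalDeriv_neg hf hj ((hiff b a).1 ha) (hc a)
      have h2 := (h b').mul_normalDeriv_neg hf hj ((hiff b' a).1 ha') (hc a)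
      rcases mul_self_eq_mul_self_iff.1 ((hσ b').trans (hσ b).symm) with h3 | h3
      · exact h3
      · rw [h3] at h2
        linarith
    have e := (h b).eventually_eq (hσσ ▸ h b') hj hf ((hiff b a).1 ha) ((hiff b' a).1 ha')
    have e' := (h' b).eventually_eq (hσσ ▸ h' b') hj' hf' ha ha'
    have hcont : Tendsto ((Θ' b).trans (Θ b).symm) (𝓝 (j' a)) (𝓝 (j a)) := by
      have := ((Θ' b).trans (Θ b).symm).continuousAt (x := j' a) (by rwa [hsource])
      rwa [ContinuousAt, hΦj b a ha] at this
    filter_upwards [e', hcont e, hcont ((Θ b').open_source.mem_nhds ((hiff b' a).1 ha')),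
      (Θ' b).open_source.mem_nhds ha, (Θ' b').open_source.mem_nhds ha'] with x h1 h2 h3 h4 h5
    have h6 : (Θ b).extend (𝓡∂ (d + 1)) (((Θ' b).trans (Θ b).symm) x) =
        (Θ' b).extend (𝓡∂ (d + 1)) x := by
      rw [← hΦ, ((Θ b).extend (𝓡∂ (d + 1))).right_inv (hmem b x h4)]
    have h2' : (Θ b').extend (𝓡∂ (d + 1)) (((Θ' b).trans (Θ b).symm) x) =
        (Θ' b').extend (𝓡∂ (d + 1)) x := by
      rw [h1, ← h6]
      exact h2
    change ((Θ' b).trans (Θ b).symm) x = ((Θ' b').trans (Θ b').symm) x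
    rw [← hΦ b' x, ← h2', ((Θ b').extend (𝓡∂ (d + 1))).left_inv (by simpa using h3)]

/-! ### Metric atlases -/

/-- A family of bilinear forms on the tangent spaces is smooth if it is smooth in the coordinates
of the preferred charts. -/
theorem contMDiff_form_of_coord {n : ℕ} {H : Type*} [TopologicalSpace H]
    {I : ModelWithCorners ℝ (Euc n) H} {N : Type*} [TopologicalSpace N] [ChartedSpace H N]
    [IsManifold I ∞ N] (G : ∀ x : N, TangentSpace I x →L[ℝ] TangentSpace I x →L[ℝ] ℝ)
    (hG : ∀ x₀ : N, ∃ A : N → Euc n →L[ℝ] Euc n →L[ℝ] ℝ,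
      ContMDiffAt I 𝓘(ℝ, Euc n →L[ℝ] Euc n →L[ℝ] ℝ) ∞ A x₀ ∧
      ∀ᶠ x in 𝓝 x₀, ∀ v w : Euc n, G x (chartSymmDeriv I (chartAt H x₀) (extChartAt I x₀ x) v)
        (chartSymmDeriv I (chartAt H x₀) (extChartAt I x₀ x) w) = A x v w) :
    ContMDiff I (I.prod 𝓘(ℝ, Euc n →L[ℝ] Euc n →L[ℝ] ℝ)) ∞
      (fun x ↦ Bundle.TotalSpace.mk' (Euc n →L[ℝ] Euc n →L[ℝ] ℝ)
        (E := fun x : N ↦ TangentSpace I x →L[ℝ] TangentSpace I x →L[ℝ] ℝ) x (G x)) := by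
  intro x₀
  obtain ⟨A, hA, hAG⟩ := hG x₀
  rw [contMDiffAt_hom_bundle]
  refine ⟨contMDiffAt_id, hA.congr_of_eventuallyEq ?_⟩
  filter_upwards [hAG, (chartAt H x₀).open_source.mem_nhds (mem_chart_source H x₀)] with x hx hxs
  ext v w
  rw [← hx v w]
  have := inCoordinates_apply_eq₂ (F₁ := Euc n) (F₂ := Euc n) (F₃ := ℝ)
    (E₁ := fun x : N ↦ TangentSpace I x) (E₂ := fun x : N ↦ TangentSpace I x)
    (E₃ := Bundle.Trivial N ℝ) (x₀ := x₀) (x := x) (ϕ := G x) (v := v) (w := w) hxs hxs (mem_univ _)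
  have h1 : ∀ u : Euc n, (trivializationAt (Euc n) (TangentSpace I) x₀).symm x u =
      chartSymmDeriv I (chartAt H x₀) (extChartAt I x₀ x) u := by
    intro u
    have h2 := congrArg (fun L : Euc n →L[ℝ] Euc n ↦ L u)
      (TangentBundle.symmL_trivializationAt (𝕜 := ℝ) (I := I) hxs)
    exact (Bundle.Trivialization.symmL_apply (R := ℝ) (trivializationAt (Euc n) (TangentSpace I) x₀)
      hxs u).symm.trans h2
  refine this.trans ?_
  rw [h1, h1]
  simp

/-- A positive definite bilinear form on a Euclidean space has a bounded unit ball. -/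
theorem isVonNBounded_of_pos {k : ℕ} (A : Euc k →L[ℝ] Euc k →L[ℝ] ℝ)
    (hA : ∀ v, v ≠ 0 → 0 < A v v) : Bornology.IsVonNBounded ℝ {v : Euc k | A v v < 1} := by
  -- the unit sphere is empty if `k = 0`
  obtain h | h := (Metric.sphere (0 : Euc k) 1).eq_empty_or_nonempty
  · refine (Bornology.isVonNBounded_singleton (0 : Euc k)).subset fun v _ ↦ ?_
    by_contra hv
    have hv' : ‖v‖ ≠ 0 := norm_ne_zero_iff.2 hv
    have : ‖v‖⁻¹ • v ∈ Metric.sphere (0 : Euc k) 1 := by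
      simp [norm_smul, hv']
    exact h.subset this
  · obtain ⟨u, hu, hmin⟩ := (isCompact_sphere (0 : Euc k) 1).exists_isMinOn h
      (f := fun v ↦ A v v) (by fun_prop)
    have hu0 : u ≠ 0 := by
      rintro rfl
      simp at hu
    have hm := hA u hu0
    -- with `m = A u u` the minimum on the sphere, `‖v‖² ≤ 1 / m`, and `‖v‖ ≤ ‖v‖² + 1`
    refine (NormedSpace.isVonNBounded_closedBall ℝ (Euc k) (1 / A u u + 1)).subset fun v hv ↦ ?_
    rw [mem_closedBall_zero_iff]
    obtain rfl | hv0 := eq_or_ne v 0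
    · rw [norm_zero]
      positivity
    have hv' : 0 < ‖v‖ := norm_pos_iff.2 hv0
    have h1 : A u u ≤ A (‖v‖⁻¹ • v) (‖v‖⁻¹ • v) := by
      refine hmin (?_ : ‖v‖⁻¹ • v ∈ Metric.sphere (0 : Euc k) 1)
      simp [norm_smul, hv'.ne']
    have h2 : A (‖v‖⁻¹ • v) (‖v‖⁻¹ • v) = (‖v‖ ^ 2)⁻¹ * A v v := by
      simp only [map_smul, smul_apply, smul_eq_mul]
      field_simp
    rw [h2, inv_mul_eq_div, le_div_iff₀ (by positivity)] at h1
    have h3 : ‖v‖ ^ 2 ≤ 1 / A u u := by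
      rw [le_div_iff₀ hm, mul_comm]
      exact h1.trans (le_of_lt hv)
    nlinarith [sq_nonneg (‖v‖ - 1)]

section MetricAtlas

variable {k : ℕ} {N : Type*} [TopologicalSpace N]
  {S : Set (OpenPartialHomeomorph N (Euc k) × (Euc k → Euc k →L[ℝ] Euc k →L[ℝ] ℝ))}

/-- A set of charts of the space `N`, each with a metric on its target, that cover `N` and are
related to each other by smooth isometric coordinate changes. -/
structure IsMetricAtlas
    (S : Set (OpenPartialHomeomorph N (Euc k) × (Euc k → Euc k →L[ℝ] Euc k →L[ℝ] ℝ))) : Prop where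
  cover : ∀ z, ∃ p ∈ S, z ∈ p.1.source
  transition : ∀ p ∈ S, ∀ p' ∈ S, ∀ z ∈ p.1.source, z ∈ p'.1.source →
    ContDiffAt ℝ ∞ (p'.1 ∘ p.1.symm) (p.1 z)
  smooth : ∀ p ∈ S, ContDiffOn ℝ ∞ p.2 p.1.target
  symm : ∀ p ∈ S, ∀ z ∈ p.1.source, ∀ v w, p.2 (p.1 z) v w = p.2 (p.1 z) w v
  pos : ∀ p ∈ S, ∀ z ∈ p.1.source, ∀ v, v ≠ 0 → 0 < p.2 (p.1 z) v v
  compat : ∀ p ∈ S, ∀ p' ∈ S, ∀ z ∈ p.1.source, z ∈ p'.1.source → ∀ v w,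
    p'.2 (p'.1 z) (fderiv ℝ (p'.1 ∘ p.1.symm) (p.1 z) v) (fderiv ℝ (p'.1 ∘ p.1.symm) (p.1 z) w) =
      p.2 (p.1 z) v w

/-- The charted space structure whose atlas is a given set of charts that cover the space. -/
abbrev chartedSpaceOfCover {H : Type*} [TopologicalSpace H] (𝒜 : Set (OpenPartialHomeomorph N H))
    (h : ∀ z, ∃ e ∈ 𝒜, z ∈ e.source) : ChartedSpace H N where
  atlas := 𝒜
  chartAt z := (h z).choose
  mem_chart_source z := (h z).choose_spec.2
  chart_mem_atlas z := (h z).choose_spec.1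

theorem IsMetricAtlas.isManifold [ChartedSpace (Euc k) N] (h : IsMetricAtlas S)
    (hS : atlas (Euc k) N = Prod.fst '' S) : IsManifold (𝓡 k) ∞ N := by
  refine isManifold_of_contDiffOn _ _ _ ?_
  rw [hS]
  rintro _ _ ⟨p, hp, rfl⟩ ⟨p', hp', rfl⟩ y hy
  replace hy := hy.1
  simp only [modelWithCornersSelf_coe_symm, preimage_id, mem_preimage,
    OpenPartialHomeomorph.trans_source, OpenPartialHomeomorph.symm_source, mem_inter_iff] at hy
  have := h.transition p hp p' hp' _ (p.1.map_target hy.1) hy.2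
  rw [p.1.right_inv hy.1] at this
  exact this.contDiffWithinAt

theorem chartSymmDeriv_self [ChartedSpace (Euc k) N] [IsManifold (𝓡 k) ∞ N]
    {e : OpenPartialHomeomorph N (Euc k)} (he : e ∈ IsManifold.maximalAtlas (𝓡 k) ∞ N)
    {y : Euc k} (hy : y ∈ e.target) :
    chartSymmDeriv (𝓡 k) e y = fderiv ℝ (chartAt (Euc k) (e.symm y) ∘ e.symm) y := by
  have h := mdifferentiableWithinAt_extend_symm (I := 𝓡 k) he (y := y) (by simpa using hy)
  refine h.mfderivWithin.trans ?_
  simp only [modelWithCornersSelf_coe, range_id, mfld_simps]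
  exact congrFun (fderivWithin_univ (𝕜 := ℝ) (f := chartAt (Euc k) (e.symm y) ∘ e.symm)) y

/-- The metrics on the charts of a metric atlas are the coordinate expressions of one metric. -/
theorem IsMetricAtlas.exists_metric [ChartedSpace (Euc k) N] [IsManifold (𝓡 k) ∞ N]
    (h : IsMetricAtlas S) (hS : atlas (Euc k) N = Prod.fst '' S) :
    ∃ G : Metric (𝓡 k) N, ∀ p ∈ S, ∀ y ∈ p.1.target, coordMetric G p.1 y = p.2 y := by
  have hmem : ∀ p ∈ S, p.1 ∈ IsManifold.maximalAtlas (𝓡 k) ∞ N := fun p hp ↦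
    IsManifold.subset_maximalAtlas (hS ▸ mem_image_of_mem _ hp)
  have hex : ∀ z : N, ∃ p ∈ S, p.1 = chartAt (Euc k) z := fun z ↦ by
    have := chart_mem_atlas (Euc k) z
    rwa [hS] at this
  choose P hPS hP using hex
  have hsrc : ∀ z, z ∈ (P z).1.source := fun z ↦ by
    rw [hP]
    exact mem_chart_source _ z
  have key : ∀ p ∈ S, ∀ y ∈ p.1.target, ∀ v w,
      (P (p.1.symm y)).2 ((P (p.1.symm y)).1 (p.1.symm y)) (chartSymmDeriv (𝓡 k) p.1 y v)
        (chartSymmDeriv (𝓡 k) p.1 y w) = p.2 y v w := by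
    intro p hp y hy v w
    rw [chartSymmDeriv_self (hmem p hp) hy, ← hP]
    have := h.compat p hp _ (hPS (p.1.symm y)) _ (p.1.map_target hy) (hsrc _) v w
    rwa [p.1.right_inv hy] at this
  -- the tangent space at `z` is the model space by way of the preferred chart, `P z`
  refine ⟨⟨fun z ↦ (P z).2 ((P z).1 z), fun z ↦ h.symm _ (hPS z) z (hsrc z),
    fun z ↦ h.pos _ (hPS z) z (hsrc z),
    fun z ↦ isVonNBounded_of_pos _ (h.pos _ (hPS z) z (hsrc z)), ?_⟩, ?_⟩
  · refine contMDiff_form_of_coord _ fun z ↦ ⟨fun x ↦ (P z).2 ((P z).1 x), ?_, ?_⟩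
    · have h1 := ((h.smooth _ (hPS z)).contDiffAt
        ((P z).1.open_target.mem_nhds ((P z).1.map_source (hsrc z)))).contMDiffAt
      have h2 := contMDiffAt_of_mem_maximalAtlas (hmem _ (hPS z)) (hsrc z)
      exact h1.comp z h2
    · filter_upwards [(P z).1.open_source.mem_nhds (hsrc z)] with x hx v w
      have := key _ (hPS z) _ ((P z).1.map_source hx) v w
      rw [(P z).1.left_inv hx] at this
      rw [← hP]
      refine Eq.trans ?_ this
      rw [extChartAt, ← hP]
      rfl
  · intro p hp y hy
    ext v w
    exact key p hp y hy v w

end MetricAtlas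

/-! ### Isometric sides and transition maps -/

section Side

variable {n : ℕ} {H : Type*} [TopologicalSpace H] {I : ModelWithCorners ℝ (Euc n) H}
  {M : Type*} [TopologicalSpace M] [ChartedSpace H M]

/-- The derivative of a map from `M` to a Euclidean space, as a map of model spaces. -/
def mapDeriv (I : ModelWithCorners ℝ (Euc n) H) {k : ℕ} (h : M → Euc k) (x : M) :
    Euc n →L[ℝ] Euc k :=
  mfderiv I 𝓘(ℝ, Euc k) h x

variable [IsManifold I ∞ M] {N : Type*} [TopologicalSpace N]

/-- The map `σ` from the Riemannian manifold `(M, g)` to the space `N`, read in the chart `E` of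
`N`, is smooth and pulls the metric `A` on the target of `E` back to `g`. -/
structure IsIsometricIn (g : Metric I M) (σ : M → N) (E : OpenPartialHomeomorph N (Euc n))
    (A : Euc n → Euc n →L[ℝ] Euc n →L[ℝ] ℝ) : Prop where
  smooth : ∀ x, σ x ∈ E.source → ContMDiffAt I 𝓘(ℝ, Euc n) ∞ (E ∘ σ) x
  form : ∀ x, σ x ∈ E.source → ∀ v w,
    A (E (σ x)) (mapDeriv I (E ∘ σ) x v) (mapDeriv I (E ∘ σ) x w) = metricAt g x v w

variable {g : Metric I M} {σ : M → N} {E E' : OpenPartialHomeomorph N (Euc n)}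
    {A A' : Euc n → Euc n →L[ℝ] Euc n →L[ℝ] ℝ}

theorem IsIsometricIn.injective (h : IsIsometricIn g σ E A) {x : M} (hx : σ x ∈ E.source) :
    Function.Injective (mapDeriv I (E ∘ σ) x) := by
  refine (injective_iff_map_eq_zero _).2 fun v hv ↦ by_contra fun hv0 ↦ ?_
  have h1 := h.form x hx v v
  rw [hv, map_zero] at h1
  exact (metricAt_pos g x hv0).ne h1

theorem IsIsometricIn.surjective (h : IsIsometricIn g σ E A) {x : M} (hx : σ x ∈ E.source) :
    Function.Surjective (mapDeriv I (E ∘ σ) x) :=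
  (LinearMap.injective_iff_surjective (f := (mapDeriv I (E ∘ σ) x).toLinearMap)).1
    (h.injective hx)

/-- At the image of an interior point, the change between two charts in which `σ` is an isometry is
smooth: by the inverse function theorem, `σ` is a local diffeomorphism there. -/
theorem IsIsometricIn.contDiffAt_transition (h : IsIsometricIn g σ E A)
    (h' : IsIsometricIn g σ E' A') (hσ : Continuous σ) {x : M} (hx : σ x ∈ E.source)
    (hx' : σ x ∈ E'.source) (hint : I.IsInteriorPoint x) :
    ContDiffAt ℝ ∞ (E' ∘ E.symm) (E (σ x)) := by
  obtain ⟨y, hy⟩ : ∃ y, extChartAt I x x = y := ⟨_, rfl⟩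
  obtain ⟨ψ, hψ⟩ : ∃ ψ : Euc n → M, ψ = (extChartAt I x).symm := ⟨_, rfl⟩
  have he : chartAt H x ∈ IsManifold.maximalAtlas I ∞ M := IsManifold.chart_mem_maximalAtlas x
  have hyt : y ∈ (extChartAt I x).target := hy ▸ mem_extChartAt_target x
  have hr : range I ∈ 𝓝 y := by
    rw [← hy]
    exact mem_interior_iff_mem_nhds.1 hint
  have htn : (extChartAt I x).target ∈ 𝓝 y := by
    have h1 := target_mem_nhdsWithin_range (e := chartAt H x) (I := I) hyt
    rwa [nhdsWithin_eq_nhds.2 hr] at h1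
  have hψy : ψ y = x := by
    rw [hψ, ← hy]
    exact extChartAt_to_inv x
  have hψs : ContMDiffAt 𝓘(ℝ, Euc n) I ∞ ψ y := by
    rw [hψ]
    exact (contMDiffOn_extend_target_symm he).contMDiffAt htn
  have hsm : ContDiffAt ℝ ∞ ((E ∘ σ) ∘ ψ) y :=
    (ContMDiffAt.comp y (by rw [hψy]; exact h.smooth x hx) hψs).contDiffAt
  have hsm' : ContDiffAt ℝ ∞ ((E' ∘ σ) ∘ ψ) y :=
    (ContMDiffAt.comp y (by rw [hψy]; exact h'.smooth x hx') hψs).contDiffAt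
  obtain ⟨D, hD⟩ : ∃ D : Euc n →L[ℝ] Euc n, D = fderiv ℝ ((E ∘ σ) ∘ ψ) y := ⟨_, rfl⟩
  have hderiv : HasFDerivAt ((E ∘ σ) ∘ ψ) D y := by
    rw [hD]
    exact (hsm.differentiableAt (by simp)).hasFDerivAt
  have hDeq : D = mapDeriv I (E ∘ σ) x ∘L chartSymmDeriv I (chartAt H x) y := by
    have h1 : HasMFDerivAt I 𝓘(ℝ, Euc n) (E ∘ σ) (ψ y) (mapDeriv I (E ∘ σ) (ψ y)) := by
      rw [hψy]
      exact ((h.smooth x hx).mdifferentiableAt (by simp)).hasMFDerivAt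
    have h2 := (mdifferentiableWithinAt_extend_symm he hyt).hasMFDerivWithinAt.hasMFDerivAt hr
    rw [hψ] at h1
    have h3 := (h1.comp y h2).hasFDerivAt
    rw [← hψ] at h3
    have h4 := hderiv.unique h3
    rw [hψy] at h4
    exact h4
  have hinj : Function.Injective D := by
    rw [hDeq]
    refine (h.injective hx).comp ?_
    intro v w hvw
    have h1 := chartDeriv_chartSymmDeriv he hyt v
    have h2 := chartDeriv_chartSymmDeriv he hyt w
    rw [← h1, ← h2]
    exact congrArg _ hvw
  obtain ⟨D', hD'⟩ : ∃ D' : Euc n ≃L[ℝ] Euc n, (D' : Euc n →L[ℝ] Euc n) = D :=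
    ⟨(LinearEquiv.ofInjectiveEndo D.toLinearMap hinj).toContinuousLinearEquiv, by ext; rfl⟩
  rw [← hD'] at hderiv
  obtain ⟨s, hs⟩ : ∃ s, s = hsm.localInverse hderiv (by simp) := ⟨_, rfl⟩
  have hsy : s (E (σ x)) = y := by
    have h1 := hsm.localInverse_apply_image hderiv (by simp)
    simp only [Function.comp_apply, hψy] at h1
    rw [hs]
    exact h1
  have hss : ContDiffAt ℝ ∞ s (E (σ x)) := by
    have h1 := hsm.to_localInverse hderiv (by simp)
    simp only [Function.comp_apply, hψy] at h1
    rw [hs]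
    exact h1
  have hsr : ∀ᶠ z in 𝓝 (E (σ x)), E (σ (ψ (s z))) = z := by
    have h1 := (hsm.hasStrictFDerivAt' hderiv (by simp)).eventually_right_inverse
    simp only [Function.comp_apply, hψy] at h1
    rw [hs]
    exact h1
  have hcont : ContinuousAt (fun z ↦ σ (ψ (s z))) (E (σ x)) := by
    refine hσ.continuousAt.comp (ContinuousAt.comp ?_ hss.continuousAt)
    rw [hsy]
    exact hψs.continuousAt
  have hsrc : ∀ᶠ z in 𝓝 (E (σ x)), σ (ψ (s z)) ∈ E.source := by
    refine hcont.eventually_mem (E.open_source.mem_nhds ?_)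
    rwa [hsy, hψy]
  -- near `E (σ x)` the inverse of `E` is `σ ∘ ψ ∘ s`
  refine ContDiffAt.congr_of_eventuallyEq (f := ((E' ∘ σ) ∘ ψ) ∘ s) (ContDiffAt.comp _ (by rwa [hsy]) hss) ?_
  filter_upwards [hsr, hsrc] with z hz1 hz2
  simp only [Function.comp_apply]
  nth_rewrite 1 [← hz1]
  rw [E.left_inv hz2]

theorem IsIsometricIn.mapDeriv_transition (h : IsIsometricIn g σ E A) (hσ : Continuous σ) {x : M}
    (hx : σ x ∈ E.source) (ht : ContDiffAt ℝ ∞ (E' ∘ E.symm) (E (σ x))) (v : Euc n) :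
    mapDeriv I (E' ∘ σ) x v = fderiv ℝ (E' ∘ E.symm) (E (σ x)) (mapDeriv I (E ∘ σ) x v) := by
  have h1 := ((h.smooth x hx).mdifferentiableAt (by simp)).hasMFDerivAt
  have h2 := (ht.differentiableAt (by simp)).hasFDerivAt.hasMFDerivAt
  have h3 := HasMFDerivAt.comp x h2 h1
  have h4 : (E' ∘ σ) =ᶠ[𝓝 x] (E' ∘ E.symm) ∘ (E ∘ σ) := by
    filter_upwards [hσ.continuousAt.eventually_mem (E.open_source.mem_nhds hx)] with z hz
    simp only [Function.comp_apply, E.left_inv hz]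
  exact congrArg (fun L : Euc n →L[ℝ] Euc n ↦ L v) (h3.congr_of_eventuallyEq h4).mfderiv

/-- Two charts in which `σ` is an isometry are related by an isometry, because the derivative of `σ` is
onto. -/
theorem IsIsometricIn.compat (h : IsIsometricIn g σ E A)
    (h' : IsIsometricIn g σ E' A') (hσ : Continuous σ) {x : M} (hx : σ x ∈ E.source)
    (hx' : σ x ∈ E'.source) (ht : ContDiffAt ℝ ∞ (E' ∘ E.symm) (E (σ x))) (v w : Euc n) :
    A' (E' (σ x)) (fderiv ℝ (E' ∘ E.symm) (E (σ x)) v) (fderiv ℝ (E' ∘ E.symm) (E (σ x)) w) =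
      A (E (σ x)) v w := by
  obtain ⟨v, rfl⟩ := h.surjective hx v
  obtain ⟨w, rfl⟩ := h.surjective hx w
  rw [← h.mapDeriv_transition hσ hx ht, ← h.mapDeriv_transition hσ hx ht, h.form x hx, h'.form x hx']

theorem IsIsometricIn.symm (h : IsIsometricIn g σ E A) {x : M} (hx : σ x ∈ E.source)
    (v w : Euc n) : A (E (σ x)) v w = A (E (σ x)) w v := by
  obtain ⟨v, rfl⟩ := h.surjective hx v
  obtain ⟨w, rfl⟩ := h.surjective hx w
  rw [h.form x hx, h.form x hx]
  exact g.symm x v w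

theorem IsIsometricIn.pos (h : IsIsometricIn g σ E A) {x : M} (hx : σ x ∈ E.source)
    {v : Euc n} (hv : v ≠ 0) : 0 < A (E (σ x)) v v := by
  obtain ⟨v, rfl⟩ := h.surjective hx v
  rw [h.form x hx]
  refine metricAt_pos g x ?_
  rintro rfl
  simp at hv

variable [ChartedSpace (Euc n) N] [IsManifold (𝓡 n) ∞ N]

omit [IsManifold (𝓡 n) ∞ N] in
theorem contMDiff_of_isIsometricIn (hσ : Continuous σ)
    (h : ∀ x, ∃ E ∈ IsManifold.maximalAtlas (𝓡 n) ∞ N, ∃ A, σ x ∈ E.source ∧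
      IsIsometricIn g σ E A) : ContMDiff I (𝓡 n) ∞ σ := by
  intro x
  obtain ⟨E, hE, A, hx, hA⟩ := h x
  have h1 := contMDiffAt_symm_of_mem_maximalAtlas hE (E.map_source hx)
  refine (ContMDiffAt.comp x h1 (hA.smooth x hx)).congr_of_eventuallyEq ?_
  filter_upwards [hσ.continuousAt.eventually_mem (E.open_source.mem_nhds hx)] with z hz
  simp only [Function.comp_apply, E.left_inv hz]

theorem IsIsometricIn.pullback_eq (h : IsIsometricIn g σ E A) {G : Metric (𝓡 n) N}
    (hE : E ∈ IsManifold.maximalAtlas (𝓡 n) ∞ N) {x : M} (hx : σ x ∈ E.source)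
    (hG : coordMetric G E (E (σ x)) = A (E (σ x))) (hσ : ContMDiff I (𝓡 n) ∞ σ) (v w : Euc n) :
    pullback I G σ x v w = g.inner x v w := by
  have h1 := (mdifferentiableAt_extend hE hx).hasMFDerivAt.comp x
    ((hσ.mdifferentiable (by simp)) x).hasMFDerivAt
  have h2 : ∀ u : Euc n, mapDeriv I (E ∘ σ) x u =
      chartDeriv (𝓡 n) E (σ x) (mfderiv I (𝓡 n) σ x u) := fun u ↦
    congrArg (fun L : Euc n →L[ℝ] Euc n ↦ L u) h1.mfderiv
  refine Eq.trans ?_ (h.form x hx v w)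
  rw [h2, h2, ← hG]
  exact (coordMetric_chartDeriv G hE hx _ _).symm

end Side

/-- A space covered by two isometric sides, with a metric atlas that is smooth across the common
boundary, is a Riemannian manifold that contains both sides isometrically. -/
theorem exists_riemannian_structure {n : ℕ} {H H' : Type*} [TopologicalSpace H] [TopologicalSpace H']
    {I : ModelWithCorners ℝ (Euc n) H} {I' : ModelWithCorners ℝ (Euc n) H'}
    {M M' : Type*} [TopologicalSpace M] [ChartedSpace H M] [IsManifold I ∞ M]
    [TopologicalSpace M'] [ChartedSpace H' M'] [IsManifold I' ∞ M']
    {N : Type*} [TopologicalSpace N] {g : Metric I M} {g' : Metric I' M'}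
    {σ : M → N} {σ' : M' → N} (hσ : Continuous σ) (hσ' : Continuous σ') {F : N → ℝ}
    (hsurj : ∀ z, (∃ x, σ x = z) ∨ ∃ x, σ' x = z)
    (hbdry : ∀ x ∈ I'.boundary M', ∃ x₁ ∈ I.boundary M, σ x₁ = σ' x)
    (S : Set (OpenPartialHomeomorph N (Euc n) × (Euc n → Euc n →L[ℝ] Euc n →L[ℝ] ℝ)))
    (hcover : ∀ z, ∃ p ∈ S, z ∈ p.1.source)
    (hsmooth : ∀ p ∈ S, ContDiffOn ℝ ∞ p.2 p.1.target)
    (hF : ∀ p ∈ S, ContDiffOn ℝ ∞ (F ∘ p.1.symm) p.1.target)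
    (hS : ∀ p ∈ S, IsIsometricIn g σ p.1 p.2) (hS' : ∀ p ∈ S, IsIsometricIn g' σ' p.1 p.2)
    (htrans : ∀ p ∈ S, ∀ p' ∈ S, ∀ x ∈ I.boundary M, σ x ∈ p.1.source → σ x ∈ p'.1.source →
      ContDiffAt ℝ ∞ (p'.1 ∘ p.1.symm) (p.1 (σ x))) :
    ∃ (_ : ChartedSpace (Euc n) N) (_ : IsManifold (𝓡 n) ∞ N) (G : Metric (𝓡 n) N),
      ContMDiff (𝓡 n) 𝓘(ℝ, ℝ) ∞ F ∧ ContMDiff I (𝓡 n) ∞ σ ∧ ContMDiff I' (𝓡 n) ∞ σ' ∧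
      (∀ x v w, pullback I G σ x v w = g.inner x v w) ∧
      ∀ x v w, pullback I' G σ' x v w = g'.inner x v w := by
  have htr : ∀ p ∈ S, ∀ p' ∈ S, ∀ z ∈ p.1.source, z ∈ p'.1.source →
      ContDiffAt ℝ ∞ (p'.1 ∘ p.1.symm) (p.1 z) := by
    intro p hp p' hp' z hz hz'
    obtain ⟨x, rfl⟩ | ⟨x, rfl⟩ := hsurj z
    · obtain hx | hx := I.isInteriorPoint_or_isBoundaryPoint x
      · exact (hS p hp).contDiffAt_transition (hS p' hp') hσ hz hz' hx
      · exact htrans p hp p' hp' x hx hz hz'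
    · obtain hx | hx := I'.isInteriorPoint_or_isBoundaryPoint x
      · exact (hS' p hp).contDiffAt_transition (hS' p' hp') hσ' hz hz' hx
      · obtain ⟨x₁, hx₁, h⟩ := hbdry x hx
        rw [← h] at hz hz' ⊢
        exact htrans p hp p' hp' x₁ hx₁ hz hz'
  have hatl : IsMetricAtlas S :=
    { cover := hcover
      transition := htr
      smooth := hsmooth
      symm := by
        intro p hp z hz v w
        obtain ⟨x, rfl⟩ | ⟨x, rfl⟩ := hsurj z
        · exact (hS p hp).symm hz v w
        · exact (hS' p hp).symm hz v w
      pos := by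
        intro p hp z hz v hv
        obtain ⟨x, rfl⟩ | ⟨x, rfl⟩ := hsurj z
        · exact (hS p hp).pos hz hv
        · exact (hS' p hp).pos hz hv
      compat := by
        intro p hp p' hp' z hz hz' v w
        have ht := htr p hp p' hp' z hz hz'
        obtain ⟨x, rfl⟩ | ⟨x, rfl⟩ := hsurj z
        · exact (hS p hp).compat (hS p' hp') hσ hz hz' ht v w
        · exact (hS' p hp).compat (hS' p' hp') hσ' hz hz' ht v w }
  let _ : ChartedSpace (Euc n) N := chartedSpaceOfCover (Prod.fst '' S) fun z ↦ by
    obtain ⟨p, hp, hz⟩ := hcover z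
    exact ⟨p.1, mem_image_of_mem _ hp, hz⟩
  have hat : atlas (Euc n) N = Prod.fst '' S := rfl
  have _ : IsManifold (𝓡 n) ∞ N := hatl.isManifold hat
  obtain ⟨G, hG⟩ := hatl.exists_metric hat
  have hmem : ∀ p ∈ S, p.1 ∈ IsManifold.maximalAtlas (𝓡 n) ∞ N := fun p hp ↦
    IsManifold.subset_maximalAtlas (hat ▸ mem_image_of_mem _ hp)
  have h1 : ContMDiff I (𝓡 n) ∞ σ := contMDiff_of_isIsometricIn (g := g) hσ fun x ↦ by
    obtain ⟨p, hp, hz⟩ := hcover (σ x)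
    exact ⟨p.1, hmem p hp, p.2, hz, hS p hp⟩
  have h2 : ContMDiff I' (𝓡 n) ∞ σ' := contMDiff_of_isIsometricIn (g := g') hσ' fun x ↦ by
    obtain ⟨p, hp, hz⟩ := hcover (σ' x)
    exact ⟨p.1, hmem p hp, p.2, hz, hS' p hp⟩
  refine ⟨_, ‹_›, G, fun z ↦ ?_, h1, h2, fun x v w ↦ ?_, fun x v w ↦ ?_⟩
  · obtain ⟨p, hp, hz⟩ := hcover z
    have h3 := contMDiffAt_of_mem_maximalAtlas (hmem p hp) hz
    have h4 := ((hF p hp).contDiffAt (p.1.open_target.mem_nhds (p.1.map_source hz))).contMDiffAt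
    refine (ContMDiffAt.comp z h4 h3).congr_of_eventuallyEq ?_
    filter_upwards [p.1.open_source.mem_nhds hz] with y hy
    simp only [Function.comp_apply, p.1.left_inv hy]
  · obtain ⟨p, hp, hz⟩ := hcover (σ x)
    exact (hS p hp).pullback_eq (hmem p hp) hz (hG p hp _ (p.1.map_source hz)) h1 v w
  · obtain ⟨p, hp, hz⟩ := hcover (σ' x)
    exact (hS' p hp).pullback_eq (hmem p hp) hz (hG p hp _ (p.1.map_source hz)) h2 v w

/-! ### The glued space -/

section GluedSpace

variable {B M M' P : Type*} [TopologicalSpace M] [TopologicalSpace M'] [TopologicalSpace P]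

omit [TopologicalSpace M] [TopologicalSpace M'] in
theorem glueLeft_eq_glueRight (j : B → M) (j' : B → M') (b : B) :
    glueLeft j j' (j b) = glueRight j j' (j' b) := Quot.sound ⟨b, rfl, rfl⟩

theorem continuous_glueLeft (j : B → M) (j' : B → M') : Continuous (glueLeft j j') :=
  continuous_quot_mk.comp continuous_inl

theorem continuous_glueRight (j : B → M) (j' : B → M') : Continuous (glueRight j j') :=
  continuous_quot_mk.comp continuous_inr

omit [TopologicalSpace M] [TopologicalSpace M'] in
theorem glue_cases {j : B → M} {j' : B → M'} (z : GluedSpace j j') :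
    (∃ x, glueLeft j j' x = z) ∨ ∃ x, glueRight j j' x = z := by
  obtain ⟨s | s, rfl⟩ := Quot.exists_rep z
  exacts [Or.inl ⟨s, rfl⟩, Or.inr ⟨s, rfl⟩]

theorem isOpen_glued_iff {j : B → M} {j' : B → M'} {U : Set (GluedSpace j j')} :
    IsOpen U ↔ IsOpen (glueLeft j j' ⁻¹' U) ∧ IsOpen (glueRight j j' ⁻¹' U) :=
  isOpen_coinduced.trans isOpen_sum_iff

/-- The map on the glued space defined by two maps that agree on the boundary. -/
def glueLift {X : Type*} {j : B → M} {j' : B → M'} (F : M → X) (F' : M' → X)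
    (h : ∀ b, F (j b) = F' (j' b)) : GluedSpace j j' → X :=
  Quot.lift (Sum.elim F F') (by rintro _ _ ⟨b, rfl, rfl⟩; exact h b)

/-- The subset of the glued space defined by two subsets that agree on the boundary. -/
def glueSet {j : B → M} {j' : B → M'} (V : Set M) (W : Set M') (h : ∀ b, j b ∈ V ↔ j' b ∈ W) :
    Set (GluedSpace j j') :=
  {z | glueLift (· ∈ V) (· ∈ W) (fun b ↦ propext (h b)) z}

theorem isOpen_glueSet {j : B → M} {j' : B → M'} {V : Set M} {W : Set M'}
    (hV : IsOpen V) (hW : IsOpen W) (h : ∀ b, j b ∈ V ↔ j' b ∈ W) : IsOpen (glueSet V W h) :=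
  isOpen_glued_iff.2 ⟨hV, hW⟩

theorem continuousOn_glued {X : Type*} [TopologicalSpace X] {j : B → M} {j' : B → M'}
    {U : Set (GluedSpace j j')} (hU : IsOpen U) {F : GluedSpace j j' → X}
    (h : ContinuousOn (F ∘ glueLeft j j') (glueLeft j j' ⁻¹' U))
    (h' : ContinuousOn (F ∘ glueRight j j') (glueRight j j' ⁻¹' U)) : ContinuousOn F U := by
  obtain ⟨h1, h2⟩ := isOpen_glued_iff.1 hU
  rw [continuousOn_open_iff hU]
  intro t ht
  exact isOpen_glued_iff.2 ⟨(continuousOn_open_iff h1).1 h t ht, (continuousOn_open_iff h2).1 h' t ht⟩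

omit [TopologicalSpace M] [TopologicalSpace M'] in
theorem glueLeft_inj {j : B → M} {j' : B → M'} {x y : M} (hx : x ∉ range j)
    (h : glueLeft j j' y = glueLeft j j' x) : y = x := by
  have h1 : ∀ b, j b ∈ ({x} : Set M) ↔ j' b ∈ (∅ : Set M') := fun b ↦
    ⟨fun hb ↦ hx ⟨b, hb⟩, fun hb ↦ hb.elim⟩
  have h2 : glueLeft j j' x ∈ glueSet {x} ∅ h1 := mem_singleton x
  rw [← h] at h2
  exact h2

omit [TopologicalSpace M] [TopologicalSpace M'] in
theorem glueRight_inj {j : B → M} {j' : B → M'} {x y : M'} (hx : x ∉ range j')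
    (h : glueRight j j' y = glueRight j j' x) : y = x := by
  have h1 : ∀ b, j b ∈ (∅ : Set M) ↔ j' b ∈ ({x} : Set M') := fun b ↦
    ⟨fun hb ↦ hb.elim, fun hb ↦ hx ⟨b, hb⟩⟩
  have h2 : glueRight j j' x ∈ glueSet ∅ {x} h1 := mem_singleton x
  rw [← h] at h2
  exact h2

omit [TopologicalSpace M] [TopologicalSpace M'] in
theorem glueLeft_ne_glueRight {j : B → M} {j' : B → M'} {x : M} {y : M'} (hx : x ∉ range j) :
    glueRight j j' y ≠ glueLeft j j' x := by
  intro h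
  have h1 : ∀ b, j b ∈ ({x} : Set M) ↔ j' b ∈ (∅ : Set M') := fun b ↦
    ⟨fun hb ↦ hx ⟨b, hb⟩, fun hb ↦ hb.elim⟩
  have h2 : glueLeft j j' x ∈ glueSet {x} ∅ h1 := mem_singleton x
  rw [← h] at h2
  exact h2

omit [TopologicalSpace M] [TopologicalSpace M'] in
theorem glueRight_ne_glueLeft {j : B → M} {j' : B → M'} {x : M} {y : M'} (hy : y ∉ range j') :
    glueLeft j j' x ≠ glueRight j j' y := by
  intro h
  have h1 : ∀ b, j b ∈ (∅ : Set M) ↔ j' b ∈ ({y} : Set M') := fun b ↦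
    ⟨fun hb ↦ hb.elim, fun hb ↦ hy ⟨b, hb⟩⟩
  have h2 : glueRight j j' y ∈ glueSet ∅ {y} h1 := mem_singleton y
  rw [← h] at h2
  exact h2

theorem isOpen_image_glueLeft {j : B → M} {j' : B → M'} {V : Set M} (hV : IsOpen V)
    (hj : Disjoint V (range j)) : IsOpen (glueLeft j j' '' V) := by
  rw [isOpen_glued_iff]
  have h1 : glueLeft j j' ⁻¹' (glueLeft j j' '' V) = V := by
    refine subset_antisymm ?_ (subset_preimage_image _ _)
    rintro y ⟨x, hx, h⟩
    rwa [glueLeft_inj (disjoint_left.1 hj hx) h.symm]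
  have h2 : glueRight j j' ⁻¹' (glueLeft j j' '' V) = ∅ := by
    refine eq_empty_of_forall_notMem ?_
    rintro y ⟨x, hx, h⟩
    exact glueLeft_ne_glueRight (disjoint_left.1 hj hx) h.symm
  rw [h1, h2]
  exact ⟨hV, isOpen_empty⟩

theorem isOpen_image_glueRight {j : B → M} {j' : B → M'} {V : Set M'} (hV : IsOpen V)
    (hj : Disjoint V (range j')) : IsOpen (glueRight j j' '' V) := by
  rw [isOpen_glued_iff]
  have h1 : glueRight j j' ⁻¹' (glueRight j j' '' V) = V := by
    refine subset_antisymm ?_ (subset_preimage_image _ _)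
    rintro y ⟨x, hx, h⟩
    rwa [glueRight_inj (disjoint_left.1 hj hx) h.symm]
  have h2 : glueLeft j j' ⁻¹' (glueRight j j' '' V) = ∅ := by
    refine eq_empty_of_forall_notMem ?_
    rintro y ⟨x, hx, h⟩
    exact glueRight_ne_glueLeft (disjoint_left.1 hj hx) h.symm
  rw [h1, h2]
  exact ⟨isOpen_empty, hV⟩

/-- A partial homeomorphism `Φ` between `M` and `M'` and an open subset `W` of `P` fit together to a
partial homeomorphism between the spaces obtained by gluing `M` and `M'` to `P`. -/
structure IsGlueable (j : B → M) (j' : B → M') (k : B → P) (Φ : OpenPartialHomeomorph M M')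
    (W : Set P) : Prop where
  isOpen : IsOpen W
  mem_iff : ∀ b, j b ∈ Φ.source ↔ k b ∈ W
  mem_iff' : ∀ b, j' b ∈ Φ.target ↔ k b ∈ W
  apply_eq : ∀ b, j b ∈ Φ.source → Φ (j b) = j' b

variable {j : B → M} {j' : B → M'} {k : B → P} {Φ : OpenPartialHomeomorph M M'} {W : Set P}

theorem IsGlueable.symm (h : IsGlueable j j' k Φ W) : IsGlueable j' j k Φ.symm W where
  isOpen := h.isOpen
  mem_iff := h.mem_iff'
  mem_iff' := h.mem_iff
  apply_eq b hb := by
    have h1 := (h.mem_iff b).2 ((h.mem_iff' b).1 hb)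
    rw [← h.apply_eq b h1, Φ.left_inv h1]

open Classical in
/-- The map between glued spaces that is `Φ` on one side and the identity of `W` on the other; it
takes the value `x₀` elsewhere. -/
def IsGlueable.map (h : IsGlueable j j' k Φ W) (x₀ : GluedSpace j' k) :
    GluedSpace j k → GluedSpace j' k :=
  glueLift (fun x ↦ if x ∈ Φ.source then glueLeft j' k (Φ x) else x₀)
    (fun y ↦ if y ∈ W then glueRight j' k y else x₀) fun b ↦ by
      by_cases hb : j b ∈ Φ.source
      · rw [if_pos hb, if_pos ((h.mem_iff b).1 hb), h.apply_eq b hb, glueLeft_eq_glueRight]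
      · rw [if_neg hb, if_neg (mt (h.mem_iff b).2 hb)]

theorem IsGlueable.map_left (h : IsGlueable j j' k Φ W) (x₀ : GluedSpace j' k) {x : M}
    (hx : x ∈ Φ.source) : h.map x₀ (glueLeft j k x) = glueLeft j' k (Φ x) := if_pos hx

theorem IsGlueable.map_right (h : IsGlueable j j' k Φ W) (x₀ : GluedSpace j' k) {y : P}
    (hy : y ∈ W) : h.map x₀ (glueRight j k y) = glueRight j' k y := if_pos hy

theorem IsGlueable.mapsTo (h : IsGlueable j j' k Φ W) (x₀ : GluedSpace j' k) :
    MapsTo (h.map x₀) (glueSet Φ.source W h.mem_iff) (glueSet Φ.target W h.mem_iff') := by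
  intro z hz
  obtain ⟨x, rfl⟩ | ⟨x, rfl⟩ := glue_cases z
  · rw [h.map_left x₀ hz]
    exact Φ.map_source hz
  · rw [h.map_right x₀ hz]
    exact hz

theorem IsGlueable.leftInvOn (h : IsGlueable j j' k Φ W) (x₀ : GluedSpace j' k)
    (y₀ : GluedSpace j k) : LeftInvOn (h.symm.map y₀) (h.map x₀) (glueSet Φ.source W h.mem_iff) := by
  intro z hz
  obtain ⟨x, rfl⟩ | ⟨x, rfl⟩ := glue_cases z
  · rw [h.map_left x₀ hz, h.symm.map_left y₀ (Φ.map_source hz)]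
    exact congrArg _ (Φ.left_inv hz)
  · rw [h.map_right x₀ hz, h.symm.map_right y₀ hz]

theorem IsGlueable.continuousOn (h : IsGlueable j j' k Φ W) (x₀ : GluedSpace j' k) :
    ContinuousOn (h.map x₀) (glueSet Φ.source W h.mem_iff) := by
  refine continuousOn_glued (isOpen_glueSet Φ.open_source h.isOpen _) ?_ ?_
  · exact ((continuous_glueLeft j' k).comp_continuousOn Φ.continuousOn).congr
      fun x hx ↦ h.map_left x₀ hx
  · exact (continuous_glueRight j' k).continuousOn.congr fun x hx ↦ h.map_right x₀ hx

/-- The partial homeomorphism between glued spaces that is `Φ` on one side and the identity of `W`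
on the other. -/
def IsGlueable.homeo (h : IsGlueable j j' k Φ W) (x₀ : GluedSpace j' k) (y₀ : GluedSpace j k) :
    OpenPartialHomeomorph (GluedSpace j k) (GluedSpace j' k) where
  toFun := h.map x₀
  invFun := h.symm.map y₀
  source := glueSet Φ.source W h.mem_iff
  target := glueSet Φ.target W h.mem_iff'
  map_source' := h.mapsTo x₀
  map_target' := h.symm.mapsTo y₀
  left_inv' := h.leftInvOn x₀ y₀
  right_inv' := h.symm.leftInvOn y₀ x₀
  open_source := isOpen_glueSet Φ.open_source h.isOpen _
  open_target := isOpen_glueSet Φ.open_target h.isOpen _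
  continuousOn_toFun := h.continuousOn x₀
  continuousOn_invFun := h.symm.continuousOn y₀

end GluedSpace

/-! ### Charts of the glued space -/

/-- Around the image of an interior point, a map that is an open embedding away from the boundary
gives a chart in which it is an isometry. -/
theorem exists_interior_chart {d : ℕ} {M : Type*} [TopologicalSpace M]
    [ChartedSpace (EuclideanHalfSpace (d + 1)) M] [IsManifold (𝓡∂ (d + 1)) ∞ M]
    {N : Type*} [TopologicalSpace N] (g : Metric (𝓡∂ (d + 1)) M) {σ : M → N}
    (hσ : Continuous σ)
    (hinj : ∀ x y, x ∉ (𝓡∂ (d + 1)).boundary M → σ y = σ x → y = x)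
    (hopen : ∀ V, IsOpen V → Disjoint V ((𝓡∂ (d + 1)).boundary M) → IsOpen (σ '' V))
    {F : N → ℝ} (hF : ContMDiff (𝓡∂ (d + 1)) 𝓘(ℝ, ℝ) ∞ (F ∘ σ))
    {x : M} (hx : x ∉ (𝓡∂ (d + 1)).boundary M) :
    ∃ E : OpenPartialHomeomorph N (Euc (d + 1)), ∃ A : Euc (d + 1) →
      Euc (d + 1) →L[ℝ] Euc (d + 1) →L[ℝ] ℝ, σ x ∈ E.source ∧
      E.source ⊆ σ '' ((𝓡∂ (d + 1)).boundary M)ᶜ ∧ ContDiffOn ℝ ∞ A E.target ∧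
      ContDiffOn ℝ ∞ (F ∘ E.symm) E.target ∧ IsIsometricIn g σ E A := by
  obtain ⟨e, he⟩ : ∃ e, chartAt (EuclideanHalfSpace (d + 1)) x = e := ⟨_, rfl⟩
  have hem : e ∈ IsManifold.maximalAtlas (𝓡∂ (d + 1)) ∞ M :=
    he ▸ IsManifold.chart_mem_maximalAtlas x
  have hxe : x ∈ e.source := he ▸ mem_chart_source _ x
  -- the part of the chart domain away from the boundary
  obtain ⟨V, hV⟩ : ∃ V : Set M, V = {p | p ∈ e.source ∧ 0 < e.extend (𝓡∂ (d + 1)) p 0} := ⟨_, rfl⟩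
  have hVe : ∀ p ∈ V, p ∈ e.source := by
    intro p hp
    rw [hV] at hp
    exact hp.1
  have hVb : ∀ p ∈ V, p ∉ (𝓡∂ (d + 1)).boundary M := by
    intro p hp hpb
    rw [hV] at hp
    exact hp.2.ne' (extend_zero_of_mem_boundary hpb hem hp.1)
  have hVd : Disjoint V ((𝓡∂ (d + 1)).boundary M) := disjoint_left.2 hVb
  have hcont : ContinuousOn (e.extend (𝓡∂ (d + 1))) V := by
    have h1 := e.continuousOn_extend (I := 𝓡∂ (d + 1))
    rw [e.extend_source] at h1
    exact h1.mono hVe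
  have hVo : IsOpen V := by
    have h1 := e.continuousOn_extend (I := 𝓡∂ (d + 1))
    rw [e.extend_source] at h1
    rw [hV]
    exact h1.isOpen_inter_preimage e.open_source
      (isOpen_lt continuous_const (by fun_prop : Continuous fun y : Euc (d + 1) ↦ y 0))
  have hxV : x ∈ V := by
    rw [hV]
    refine ⟨hxe, lt_of_le_of_ne ?_ fun h ↦ hx ?_⟩
    · exact mem_range_halfSpace.1 (e.extend_target_subset_range
        ((e.extend (𝓡∂ (d + 1))).map_source (by simpa using hxe)))
    · change extChartAt (𝓡∂ (d + 1)) x x ∈ frontier (range (𝓡∂ (d + 1)))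
      rw [frontier_range_modelWithCornersEuclideanHalfSpace, extChartAt, he]
      exact h
  obtain ⟨T, hT⟩ : ∃ T : Set (Euc (d + 1)),
      T = {y | y ∈ (e.extend (𝓡∂ (d + 1))).target ∧ 0 < y 0} := ⟨_, rfl⟩
  have hTo : IsOpen T := by
    have h1 : T = (𝓡∂ (d + 1)).symm ⁻¹' e.target ∩ {y | 0 < y 0} := by
      rw [hT, e.extend_target]
      ext y
      constructor
      · exact fun h ↦ ⟨h.1.1, h.2⟩
      · exact fun h ↦ ⟨⟨h.1, mem_range_halfSpace.2 (le_of_lt h.2)⟩, h.2⟩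
    rw [h1]
    exact (e.open_target.preimage (𝓡∂ (d + 1)).continuous_symm).inter
      (isOpen_lt continuous_const (by fun_prop : Continuous fun y : Euc (d + 1) ↦ y 0))
  have hTe : ∀ y ∈ T, y ∈ (e.extend (𝓡∂ (d + 1))).target := by
    intro y hy
    rw [hT] at hy
    exact hy.1
  have hVT : ∀ p ∈ V, e.extend (𝓡∂ (d + 1)) p ∈ T := by
    intro p hp
    rw [hV] at hp
    rw [hT]
    exact ⟨(e.extend _).map_source (by simpa using hp.1), hp.2⟩
  have hTV : ∀ y ∈ T, (e.extend (𝓡∂ (d + 1))).symm y ∈ V := by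
    intro y hy
    rw [hT] at hy
    rw [hV]
    refine ⟨by simpa using (e.extend (𝓡∂ (d + 1))).map_target hy.1, ?_⟩
    rw [(e.extend (𝓡∂ (d + 1))).right_inv hy.1]
    exact hy.2
  have hlinv : ∀ p ∈ V, (e.extend (𝓡∂ (d + 1))).symm (e.extend (𝓡∂ (d + 1)) p) = p :=
    fun p hp ↦ (e.extend _).left_inv (by simpa using hVe p hp)
  have hexr : ∃ r : N → M, ∀ p ∈ V, r (σ p) = p := by
    have : Nonempty M := ⟨x⟩
    refine ⟨Function.invFunOn σ V, fun p hp ↦ ?_⟩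
    exact hinj p _ (hVb p hp) (Function.invFunOn_eq ⟨p, hp, rfl⟩)
  obtain ⟨r, hr⟩ := hexr
  let E : OpenPartialHomeomorph N (Euc (d + 1)) :=
    { toFun := fun z ↦ e.extend (𝓡∂ (d + 1)) (r z)
      invFun := fun y ↦ σ ((e.extend (𝓡∂ (d + 1))).symm y)
      source := σ '' V
      target := T
      map_source' := by
        rintro _ ⟨p, hp, rfl⟩
        rw [hr p hp]
        exact hVT p hp
      map_target' := fun y hy ↦ mem_image_of_mem _ (hTV y hy)
      left_inv' := by
        rintro _ ⟨p, hp, rfl⟩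
        rw [hr p hp, hlinv p hp]
      right_inv' := by
        intro y hy
        rw [hr _ (hTV y hy), (e.extend (𝓡∂ (d + 1))).right_inv (hTe y hy)]
      open_source := hopen V hVo hVd
      open_target := hTo
      continuousOn_toFun := by
        rw [continuousOn_open_iff (hopen V hVo hVd)]
        intro t ht
        have h1 := hopen _ ((continuousOn_open_iff hVo).1 hcont t ht)
          (hVd.mono_left inter_subset_left)
        convert h1 using 1
        ext z
        constructor
        · rintro ⟨⟨p, hp, rfl⟩, hz⟩
          rw [mem_preimage, hr p hp] at hz
          exact ⟨p, ⟨hp, hz⟩, rfl⟩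
        · rintro ⟨p, ⟨hp, hz⟩, rfl⟩
          refine ⟨⟨p, hp, rfl⟩, ?_⟩
          rw [mem_preimage, hr p hp]
          exact hz
      continuousOn_invFun := hσ.comp_continuousOn
        ((contMDiffOn_extend_target_symm hem).continuousOn.mono hTe) }
  have hEσ : ∀ p ∈ V, (E ∘ σ) p = e.extend (𝓡∂ (d + 1)) p := fun p hp ↦
    congrArg (e.extend (𝓡∂ (d + 1))) (hr p hp)
  have hsrc : ∀ p, σ p ∈ E.source → p ∈ V := by
    rintro p ⟨q, hq, h⟩
    rwa [hinj q p (hVb q hq) h.symm]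
  refine ⟨E, coordMetric g e, mem_image_of_mem _ hxV, image_mono hVb,
    (contDiffOn_coordMetric g hem).mono hTe, (contDiffOn_comp_extend_symm hF hem).mono hTe, ?_, ?_⟩
  · intro p hp
    refine (OpenPartialHomeomorph.contMDiffAt_extend hem (hVe p (hsrc p hp))).congr_of_eventuallyEq ?_
    filter_upwards [hVo.mem_nhds (hsrc p hp)] with q hq using hEσ q hq
  · intro p hp v w
    have hpV := hsrc p hp
    have h1 : mapDeriv (𝓡∂ (d + 1)) (E ∘ σ) p = chartDeriv (𝓡∂ (d + 1)) e p := by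
      refine Filter.EventuallyEq.mfderiv_eq ?_
      filter_upwards [hVo.mem_nhds hpV] with q hq using hEσ q hq
    rw [h1]
    have h2 : E (σ p) = e.extend (𝓡∂ (d + 1)) p := hEσ p hpV
    rw [h2]
    exact coordMetric_chartDeriv g hem (hVe p hpV) v w

/-- A partial homeomorphism `h` into a Riemannian manifold turns its charts into charts of the
source, in which every map `σ` is an isometry for which `h ∘ σ` is one. -/
theorem isIsometricIn_trans {n : ℕ} {H : Type*} [TopologicalSpace H]
    {I : ModelWithCorners ℝ (Euc n) H} {M : Type*} [TopologicalSpace M] [ChartedSpace H M]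
    [IsManifold I ∞ M] {N N' : Type*} [TopologicalSpace N] [TopologicalSpace N']
    [ChartedSpace (Euc n) N'] [IsManifold (𝓡 n) ∞ N'] {g : Metric I M} {G : Metric (𝓡 n) N'}
    {σ : M → N} {h : OpenPartialHomeomorph N N'} {E : OpenPartialHomeomorph N' (Euc n)}
    (hE : E ∈ IsManifold.maximalAtlas (𝓡 n) ∞ N')
    (hs : ∀ x, σ x ∈ h.source → ContMDiffAt I (𝓡 n) ∞ (h ∘ σ) x)
    (hg : ∀ x, σ x ∈ h.source → ∀ v w, pullback I G (h ∘ σ) x v w = g.inner x v w) :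
    IsIsometricIn g σ (h.trans E) (coordMetric G E) := by
  have hm : ∀ x, σ x ∈ (h.trans E).source → σ x ∈ h.source ∧ h (σ x) ∈ E.source := fun x hx ↦ by
    simpa using hx
  refine ⟨fun x hx ↦ ?_, fun x hx v w ↦ ?_⟩
  · obtain ⟨h1, h2⟩ := hm x hx
    exact ContMDiffAt.comp (g := E) (f := h ∘ σ) x (contMDiffAt_of_mem_maximalAtlas hE h2) (hs x h1)
  · obtain ⟨h1, h2⟩ := hm x hx
    have h3 := (mdifferentiableAt_extend (I := 𝓡 n) hE h2).hasMFDerivAt.comp x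
      ((hs x h1).mdifferentiableAt (by simp)).hasMFDerivAt
    have h4 : ∀ u : Euc n, mapDeriv I (h.trans E ∘ σ) x u =
        chartDeriv (𝓡 n) E (h (σ x)) (mfderiv I (𝓡 n) (h ∘ σ) x u) := fun u ↦
      congrArg (fun L : Euc n →L[ℝ] Euc n ↦ L u) h3.mfderiv
    rw [h4, h4]
    exact (coordMetric_chartDeriv G hE h2 _ _).trans (hg x h1 v w)

/-! ### Transfer of the gluing -/

section Pullback

variable {n k : ℕ} {H K : Type*} [TopologicalSpace H] [TopologicalSpace K]
  {I : ModelWithCorners ℝ (Euc n) H} {J : ModelWithCorners ℝ (Euc k) K}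
  {M : Type*} [TopologicalSpace M] [ChartedSpace H M] [IsManifold I ∞ M]
  {P : Type*} [TopologicalSpace P] [ChartedSpace K P]

theorem pullback_congr (g : Metric I M) {τ τ' : P → M} {x : P} (h : τ =ᶠ[𝓝 x] τ') (v w : Euc k) :
    pullback J g τ x v w = pullback J g τ' x v w := by
  have h1 : (mfderiv J I τ x : Euc k →L[ℝ] Euc n) = mfderiv J I τ' x := h.mfderiv_eq
  change metricAt g (τ x) ((mfderiv J I τ x : Euc k →L[ℝ] Euc n) v)
    ((mfderiv J I τ x : Euc k →L[ℝ] Euc n) w) = _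
  rw [h1, h.eq_of_nhds]
  rfl

theorem pullback_comp (g : Metric I M) {l : ℕ} {L : Type*} [TopologicalSpace L]
    {J' : ModelWithCorners ℝ (Euc l) L} {Q : Type*} [TopologicalSpace Q] [ChartedSpace L Q]
    {τ : P → M} {ρ : Q → P} {x : Q} (hτ : MDifferentiableAt J I τ (ρ x))
    (hρ : MDifferentiableAt J' J ρ x) (v w : Euc l) :
    pullback J' g (τ ∘ ρ) x v w =
      pullback J g τ (ρ x) (mfderiv J' J ρ x v) (mfderiv J' J ρ x w) := by
  have h1 : (mfderiv J' I (τ ∘ ρ) x : Euc l →L[ℝ] Euc n) =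
      (mfderiv J I τ (ρ x) : Euc k →L[ℝ] Euc n) ∘L (mfderiv J' J ρ x : Euc l →L[ℝ] Euc k) :=
    mfderiv_comp x hτ hρ
  change metricAt g (τ (ρ x)) ((mfderiv J' I (τ ∘ ρ) x : Euc l →L[ℝ] Euc n) v)
    ((mfderiv J' I (τ ∘ ρ) x : Euc l →L[ℝ] Euc n) w) = _
  rw [h1]
  rfl

end Pullback

/-- If two partial homeomorphisms into a manifold agree near a point, they turn charts of the
manifold into smoothly compatible charts there. -/
theorem contDiffAt_trans_symm {n : ℕ} {N N' : Type*} [TopologicalSpace N] [TopologicalSpace N']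
    [ChartedSpace (Euc n) N'] [IsManifold (𝓡 n) ∞ N'] {h h' : OpenPartialHomeomorph N N'}
    {E E' : OpenPartialHomeomorph N' (Euc n)} (hE : E ∈ IsManifold.maximalAtlas (𝓡 n) ∞ N')
    (hE' : E' ∈ IsManifold.maximalAtlas (𝓡 n) ∞ N') {z : N} (hz : z ∈ (h.trans E).source)
    (hz' : z ∈ (h'.trans E').source) (hh : h =ᶠ[𝓝 z] h') :
    ContDiffAt ℝ ∞ (h'.trans E' ∘ (h.trans E).symm) (h.trans E z) := by
  have hm : z ∈ h.source ∧ h z ∈ E.source := by simpa using hz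
  have hm' : z ∈ h'.source ∧ h' z ∈ E'.source := by simpa using hz'
  have h1 := contMDiffAt_symm_of_mem_maximalAtlas hE (E.map_source hm.2)
  have h2 : ContMDiffAt (𝓡 n) (𝓡 n) ∞ E' (E.symm (E (h z))) := by
    rw [E.left_inv hm.2, hh.eq_of_nhds]
    exact contMDiffAt_of_mem_maximalAtlas hE' hm'.2
  have h3 : ContDiffAt ℝ ∞ (E' ∘ E.symm) (E (h z)) :=
    (ContMDiffAt.comp (E (h z)) h2 h1).contDiffAt
  refine h3.congr_of_eventuallyEq ?_
  have h4 : Tendsto (h.trans E).symm (𝓝 (h.trans E z)) (𝓝 z) := (h.trans E).tendsto_symm hz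
  filter_upwards [h4.eventually hh,
    (h.trans E).open_target.mem_nhds ((h.trans E).map_source hz)] with y hy1 hy2
  have hy3 : y ∈ E.target ∧ E.symm y ∈ h.target := by simpa using hy2
  have h5 : h ((h.trans E).symm y) = E.symm y := h.right_inv hy3.2
  rw [h5] at hy1
  exact congrArg E' hy1.symm

section Transfer

variable {d : ℕ} {B M₁ M₂ M₃ : Type*} [TopologicalSpace B] [ChartedSpace (Euc d) B]
    [TopologicalSpace M₁] [ChartedSpace (EuclideanHalfSpace (d + 1)) M₁]
    [IsManifold (𝓡∂ (d + 1)) ∞ M₁]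
    [TopologicalSpace M₂] [ChartedSpace (EuclideanHalfSpace (d + 1)) M₂]
    [IsManifold (𝓡∂ (d + 1)) ∞ M₂]
    [TopologicalSpace M₃] [ChartedSpace (EuclideanHalfSpace (d + 1)) M₃]
    [IsManifold (𝓡∂ (d + 1)) ∞ M₃]

/-- If the glued space `M₁ ∪ M₃` is a smooth Riemannian manifold and `M₂` is isometric to `M₁` near
each point of the boundary, by isometries that match the boundary identifications and have the same
germs, then `M₂ ∪ M₃` is a smooth Riemannian manifold as well. -/
theorem SmoothlyGlues.of_local_isometries {g₁ : Metric (𝓡∂ (d + 1)) M₁}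
    {g₂ : Metric (𝓡∂ (d + 1)) M₂} {g₃ : Metric (𝓡∂ (d + 1)) M₃}
    {j₁ : B → M₁} {j₂ : B → M₂} {j₃ : B → M₃}
    (hj₂ : IsBoundaryInclusion d j₂) (hj₃ : IsBoundaryInclusion d j₃)
    {f₁ : M₁ → ℝ} {f₂ : M₂ → ℝ} {f₃ : M₃ → ℝ}
    (hf₂ : ContMDiff (𝓡∂ (d + 1)) 𝓘(ℝ, ℝ) ∞ f₂) (hf₃ : ContMDiff (𝓡∂ (d + 1)) 𝓘(ℝ, ℝ) ∞ f₃)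
    (hff : ∀ b, f₁ (j₁ b) = f₂ (j₂ b))
    (Φ : B → OpenPartialHomeomorph M₂ M₁) (hb : ∀ b, j₂ b ∈ (Φ b).source)
    (hst : ∀ b a, j₂ a ∈ (Φ b).source ↔ j₁ a ∈ (Φ b).target)
    (hΦj : ∀ b a, j₂ a ∈ (Φ b).source → Φ b (j₂ a) = j₁ a)
    (hΦ : ∀ b, ContMDiffOn (𝓡∂ (d + 1)) (𝓡∂ (d + 1)) ∞ (Φ b) (Φ b).source)
    (hΦf : ∀ b, ∀ x ∈ (Φ b).source, f₁ (Φ b x) = f₂ x)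
    (hΦg : ∀ b, ∀ x ∈ (Φ b).source, ∀ v w, pullback (𝓡∂ (d + 1)) g₁ (Φ b) x v w = g₂.inner x v w)
    (hgerm : ∀ b b' a, j₂ a ∈ (Φ b).source → j₂ a ∈ (Φ b').source → Φ b =ᶠ[𝓝 (j₂ a)] Φ b')
    (h : SmoothlyGlues j₁ g₁ f₁ j₃ g₃ f₃) : SmoothlyGlues j₂ g₂ f₂ j₃ g₃ f₃ := by
  obtain ⟨_, _, G, F, hF, hl, hr, hGl, hGr, hFl, hFr⟩ := h
  have hW : ∀ b, ∃ W : Set M₃, IsOpen W ∧ ∀ a, j₂ a ∈ (Φ b).source ↔ j₃ a ∈ W := by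
    intro b
    have h1 : IsOpen (j₂ ⁻¹' (Φ b).source) :=
      (Φ b).open_source.preimage hj₂.embedding.isEmbedding.continuous
    obtain ⟨W, hW, h2⟩ := hj₃.embedding.isEmbedding.isInducing.isOpen_iff.1 h1
    exact ⟨W, hW, fun a ↦ (Set.ext_iff.1 h2 a).symm⟩
  -- `W b` is an open subset of `M₃` that meets `B` in the same set as the source of `Φ b`
  choose W hWo hWj using hW
  have hglue : ∀ b, IsGlueable j₂ j₁ j₃ (Φ b) (W b) := fun b ↦
    { isOpen := hWo b
      mem_iff := hWj b
      mem_iff' := fun a ↦ (hst b a).symm.trans (hWj b a)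
      apply_eq := hΦj b }
  obtain ⟨θ, hθ⟩ : ∃ θ : ∀ b, OpenPartialHomeomorph (GluedSpace j₂ j₃) (GluedSpace j₁ j₃),
      θ = fun b ↦ (hglue b).homeo (glueLeft _ _ (j₁ b)) (glueLeft _ _ (j₂ b)) := ⟨_, rfl⟩
  have hθl : ∀ b x, glueLeft j₂ j₃ x ∈ (θ b).source ↔ x ∈ (Φ b).source := fun b x ↦ by
    rw [hθ]
    rfl
  have hθr : ∀ b y, glueRight j₂ j₃ y ∈ (θ b).source ↔ y ∈ W b := fun b y ↦ by
    rw [hθ]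
    rfl
  have hθl' : ∀ b, ∀ x ∈ (Φ b).source, θ b (glueLeft j₂ j₃ x) = glueLeft j₁ j₃ (Φ b x) :=
    fun b x hx ↦ by
      rw [hθ]
      exact (hglue b).map_left _ hx
  have hθr' : ∀ b, ∀ y ∈ W b, θ b (glueRight j₂ j₃ y) = glueRight j₁ j₃ y := fun b y hy ↦ by
    rw [hθ]
    exact (hglue b).map_right _ hy
  have hf23 : ∀ b, f₂ (j₂ b) = f₃ (j₃ b) := fun b ↦ by
    rw [← hff, ← hFl, ← hFr, glueLeft_eq_glueRight]
  obtain ⟨F₂, hF₂⟩ : ∃ F₂ : GluedSpace j₂ j₃ → ℝ, F₂ = glueLift f₂ f₃ hf23 := ⟨_, rfl⟩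
  have hF₂l : ∀ x, F₂ (glueLeft j₂ j₃ x) = f₂ x := fun x ↦ by rw [hF₂]; rfl
  have hF₂r : ∀ x, F₂ (glueRight j₂ j₃ x) = f₃ x := fun x ↦ by rw [hF₂]; rfl
  have hF₂θ : ∀ b, ∀ z ∈ (θ b).source, F₂ z = F (θ b z) := by
    intro b z hz
    obtain ⟨x, rfl⟩ | ⟨y, rfl⟩ := glue_cases z
    · have hx := (hθl b x).1 hz
      rw [hθl' b x hx, hFl, hF₂l, hΦf b x hx]
    · rw [hθr' b y ((hθr b y).1 hz), hFr, hF₂r]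
  -- germs of the local isometries agree along the boundary, hence so do those of their extensions
  have hθgerm : ∀ b b' a, j₂ a ∈ (Φ b).source → j₂ a ∈ (Φ b').source →
      θ b =ᶠ[𝓝 (glueLeft j₂ j₃ (j₂ a))] θ b' := by
    intro b b' a ha ha'
    obtain ⟨V, hV⟩ : ∃ V : Set M₂, V = {x | (∀ᶠ y in 𝓝 x, Φ b y = Φ b' y)} ∩
      ((Φ b).source ∩ (Φ b').source) := ⟨_, rfl⟩
    have hVo : IsOpen V := by
      rw [hV]
      exact isOpen_setOfPred_eventually_nhds.inter ((Φ b).open_source.inter (Φ b').open_source)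
    have hVj : ∀ c, j₂ c ∈ V ↔ j₃ c ∈ W b ∩ W b' := by
      intro c
      rw [hV]
      refine ⟨fun hc ↦ ⟨(hWj b c).1 hc.2.1, (hWj b' c).1 hc.2.2⟩, fun hc ↦ ?_⟩
      have h1 := (hWj b c).2 hc.1
      have h2 := (hWj b' c).2 hc.2
      exact ⟨hgerm b b' c h1 h2, h1, h2⟩
    have hU := isOpen_glueSet hVo ((hWo b).inter (hWo b')) hVj
    have haU : glueLeft j₂ j₃ (j₂ a) ∈ glueSet V (W b ∩ W b') hVj :=
      (hVj a).2 ⟨(hWj b a).1 ha, (hWj b' a).1 ha'⟩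
    filter_upwards [hU.mem_nhds haU] with z hz
    obtain ⟨x, rfl⟩ | ⟨y, rfl⟩ := glue_cases z
    · have hx : x ∈ V := hz
      rw [hV] at hx
      rw [hθl' b x hx.2.1, hθl' b' x hx.2.2]
      exact congrArg _ hx.1.self_of_nhds
    · have hy : y ∈ W b ∩ W b' := hz
      rw [hθr' b y hy.1, hθr' b' y hy.2]
  have hmemb : ∀ b, j₂ b ∈ (𝓡∂ (d + 1)).boundary M₂ := fun b ↦ hj₂.range_eq ▸ mem_range_self b
  have hθS : ∀ b, ∀ E ∈ atlas (Euc (d + 1)) (GluedSpace j₁ j₃),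
      IsIsometricIn g₂ (glueLeft j₂ j₃) ((θ b).trans E) (coordMetric G E) := by
    intro b E hE
    have hloc : ∀ x ∈ (Φ b).source,
        θ b ∘ glueLeft j₂ j₃ =ᶠ[𝓝 x] glueLeft j₁ j₃ ∘ Φ b := fun x hx ↦ by
      filter_upwards [(Φ b).open_source.mem_nhds hx] with y hy using hθl' b y hy
    have hsm : ∀ x ∈ (Φ b).source, ContMDiffAt (𝓡∂ (d + 1)) (𝓡∂ (d + 1)) ∞ (Φ b) x := fun x hx ↦
      (hΦ b).contMDiffAt ((Φ b).open_source.mem_nhds hx)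
    refine isIsometricIn_trans (IsManifold.subset_maximalAtlas hE) (fun x hx ↦ ?_)
      fun x hx v w ↦ ?_
    · have hx' := (hθl b x).1 hx
      exact ((hl _).comp x (hsm x hx')).congr_of_eventuallyEq (hloc x hx')
    · have hx' := (hθl b x).1 hx
      refine (pullback_congr G (hloc x hx') v w).trans ?_
      refine (pullback_comp G ((hl.mdifferentiable (by simp)) _)
        ((hsm x hx').mdifferentiableAt (by simp)) v w).trans ?_
      exact (hGl _ _ _).trans (hΦg b x hx' v w)
  have hθS' : ∀ b, ∀ E ∈ atlas (Euc (d + 1)) (GluedSpace j₁ j₃),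
      IsIsometricIn g₃ (glueRight j₂ j₃) ((θ b).trans E) (coordMetric G E) := by
    intro b E hE
    have hloc : ∀ x ∈ W b, θ b ∘ glueRight j₂ j₃ =ᶠ[𝓝 x] glueRight j₁ j₃ := fun x hx ↦ by
      filter_upwards [(hWo b).mem_nhds hx] with y hy using hθr' b y hy
    refine isIsometricIn_trans (IsManifold.subset_maximalAtlas hE) (fun x hx ↦ ?_)
      fun x hx v w ↦ ?_
    · exact (hr x).congr_of_eventuallyEq (hloc x ((hθr b x).1 hx))
    · exact (pullback_congr G (hloc x ((hθr b x).1 hx)) v w).trans (hGr x v w)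
  -- the charts are those that avoid the boundary and those of `M₁ ∪ M₃` transported by some `θ b`
  obtain ⟨S, hS⟩ : ∃ S : Set (OpenPartialHomeomorph (GluedSpace j₂ j₃) (Euc (d + 1)) ×
      (Euc (d + 1) → Euc (d + 1) →L[ℝ] Euc (d + 1) →L[ℝ] ℝ)), S = {p |
        ((∀ a, glueLeft j₂ j₃ (j₂ a) ∉ p.1.source) ∧ ContDiffOn ℝ ∞ p.2 p.1.target ∧
          ContDiffOn ℝ ∞ (F₂ ∘ p.1.symm) p.1.target ∧
          IsIsometricIn g₂ (glueLeft j₂ j₃) p.1 p.2 ∧ IsIsometricIn g₃ (glueRight j₂ j₃) p.1 p.2) ∨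
        ∃ b, ∃ E ∈ atlas (Euc (d + 1)) (GluedSpace j₁ j₃), p = ((θ b).trans E, coordMetric G E)} :=
    ⟨_, rfl⟩
  have hSb : ∀ b, ∃ p ∈ S, glueLeft j₂ j₃ (j₂ b) ∈ p.1.source := by
    intro b
    refine ⟨((θ b).trans (chartAt _ (glueLeft j₁ j₃ (j₁ b))),
      coordMetric G (chartAt _ (glueLeft j₁ j₃ (j₁ b)))), ?_, ?_⟩
    · rw [hS]
      exact Or.inr ⟨b, _, chart_mem_atlas _ _, rfl⟩
    · rw [OpenPartialHomeomorph.trans_source]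
      refine ⟨(hθl b _).2 (hb b), ?_⟩
      rw [mem_preimage, hθl' b _ (hb b), hΦj b b (hb b)]
      exact mem_chart_source _ _
  obtain ⟨c1, c2, G₂, hF₂s, hl₂, hr₂, hGl₂, hGr₂⟩ := exists_riemannian_structure (g := g₂) (g' := g₃)
    (σ := glueLeft j₂ j₃) (σ' := glueRight j₂ j₃) (F := F₂)
    (continuous_glueLeft j₂ j₃) (continuous_glueRight j₂ j₃) glue_cases (by
      rw [← hj₃.range_eq]
      rintro _ ⟨b, rfl⟩
      exact ⟨j₂ b, hmemb b, glueLeft_eq_glueRight _ _ b⟩) S (by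
      intro z
      obtain ⟨x, rfl⟩ | ⟨y, rfl⟩ := glue_cases z
      · by_cases hx : x ∈ (𝓡∂ (d + 1)).boundary M₂
        · rw [← hj₂.range_eq] at hx
          obtain ⟨b, rfl⟩ := hx
          exact hSb b
        · obtain ⟨E, A, h1, h2, h3, h4, h5⟩ := exists_interior_chart g₂ (continuous_glueLeft j₂ j₃)
            (fun x y hx hxy ↦ glueLeft_inj (by rwa [hj₂.range_eq]) hxy)
            (fun V hV hVb ↦ isOpen_image_glueLeft hV (by rwa [hj₂.range_eq])) (F := F₂)
            (hf₂.congr hF₂l) hx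
          have h6 : ∀ y, glueRight j₂ j₃ y ∉ E.source := by
            intro y hy
            obtain ⟨x', hx', h7⟩ := h2 hy
            exact glueLeft_ne_glueRight (by rw [hj₂.range_eq]; exact hx') h7.symm
          refine ⟨(E, A), ?_, h1⟩
          rw [hS]
          refine Or.inl ⟨fun a ↦ ?_, h3, h4, h5, fun y hy ↦ (h6 y hy).elim,
            fun y hy ↦ (h6 y hy).elim⟩
          rw [glueLeft_eq_glueRight]
          exact h6 _
      · by_cases hy : y ∈ (𝓡∂ (d + 1)).boundary M₃
        · rw [← hj₃.range_eq] at hy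
          obtain ⟨b, rfl⟩ := hy
          rw [← glueLeft_eq_glueRight]
          exact hSb b
        · obtain ⟨E, A, h1, h2, h3, h4, h5⟩ := exists_interior_chart g₃ (continuous_glueRight j₂ j₃)
            (fun x y hx hxy ↦ glueRight_inj (by rwa [hj₃.range_eq]) hxy)
            (fun V hV hVb ↦ isOpen_image_glueRight hV (by rwa [hj₃.range_eq])) (F := F₂)
            (hf₃.congr hF₂r) hy
          have h6 : ∀ x, glueLeft j₂ j₃ x ∉ E.source := by
            intro x hx
            obtain ⟨y', hy', h7⟩ := h2 hx
            exact glueRight_ne_glueLeft (by rw [hj₃.range_eq]; exact hy') h7.symm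
          refine ⟨(E, A), ?_, h1⟩
          rw [hS]
          exact Or.inl ⟨fun a ↦ h6 _, h3, h4, ⟨fun x hx ↦ (h6 x hx).elim,
            fun x hx ↦ (h6 x hx).elim⟩, h5⟩) (by
      rw [hS]
      rintro p (hp | ⟨b, E, hE, rfl⟩)
      · exact hp.2.1
      · refine (contDiffOn_coordMetric G (IsManifold.subset_maximalAtlas hE)).mono fun y hy ↦ ?_
        have : y ∈ E.target := (OpenPartialHomeomorph.trans_target (θ b) E ▸ hy).1
        simpa using this) (by
      rw [hS]
      rintro p (hp | ⟨b, E, hE, rfl⟩)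
      · exact hp.2.2.1
      · have h1 : ContDiffOn ℝ ∞ (F ∘ E.symm) E.target := (hF.comp_contMDiffOn
          (contMDiffOn_symm_of_mem_maximalAtlas (IsManifold.subset_maximalAtlas hE))).contDiffOn
        refine (h1.mono fun y hy ↦ ?_).congr fun y hy ↦ ?_
        · exact (OpenPartialHomeomorph.trans_target (θ b) E ▸ hy).1
        · have hy2 : E.symm y ∈ (θ b).target := (OpenPartialHomeomorph.trans_target (θ b) E ▸ hy).2
          refine (hF₂θ b _ ((θ b).map_target hy2)).trans ?_
          rw [(θ b).right_inv hy2]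
          rfl) (by
      rw [hS]
      rintro p (hp | ⟨b, E, hE, rfl⟩)
      · exact hp.2.2.2.1
      · exact hθS b E hE) (by
      rw [hS]
      rintro p (hp | ⟨b, E, hE, rfl⟩)
      · exact hp.2.2.2.2
      · exact hθS' b E hE) (by
      rw [hS, ← hj₂.range_eq]
      rintro p hp p' hp' _ ⟨a, rfl⟩ ha ha'
      obtain hp | ⟨b, E, hE, rfl⟩ := hp
      · exact (hp.1 a ha).elim
      obtain hp' | ⟨b', E', hE', rfl⟩ := hp'
      · exact (hp'.1 a ha').elim
      refine contDiffAt_trans_symm (IsManifold.subset_maximalAtlas hE)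
        (IsManifold.subset_maximalAtlas hE') ha ha' ?_
      refine hθgerm b b' a ?_ ?_
      · exact (hθl b _).1 (OpenPartialHomeomorph.trans_source (θ b) E ▸ ha).1
      · exact (hθl b' _).1 (OpenPartialHomeomorph.trans_source (θ b') E' ▸ ha').1)
  exact ⟨c1, c2, G₂, F₂, hF₂s, hl₂, hr₂, hGl₂, hGr₂, hF₂l, hF₂r⟩

end Transfer

end Gluing

end

theorem theorem6p2 {d : ℕ} {B M₁ M₂ M₃ : Type*}
    [TopologicalSpace B] [ChartedSpace (EuclideanSpace ℝ (Fin d)) B] [IsManifold (𝓡 d) ∞ B]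
    [TopologicalSpace M₁] [T2Space M₁] [CompactSpace M₁]
    [ChartedSpace (EuclideanHalfSpace (d + 1)) M₁] [IsManifold (𝓡∂ (d + 1)) ∞ M₁]
    [TopologicalSpace M₂] [T2Space M₂] [CompactSpace M₂]
    [ChartedSpace (EuclideanHalfSpace (d + 1)) M₂] [IsManifold (𝓡∂ (d + 1)) ∞ M₂]
    [TopologicalSpace M₃] [T2Space M₃] [CompactSpace M₃]
    [ChartedSpace (EuclideanHalfSpace (d + 1)) M₃] [IsManifold (𝓡∂ (d + 1)) ∞ M₃]
    (g₁ : Gluing.Metric (𝓡∂ (d + 1)) M₁) (g₂ : Gluing.Metric (𝓡∂ (d + 1)) M₂)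
    (g₃ : Gluing.Metric (𝓡∂ (d + 1)) M₃)
    (j₁ : B → M₁) (j₂ : B → M₂) (j₃ : B → M₃)
    (hj₁ : Gluing.IsBoundaryInclusion d j₁) (hj₂ : Gluing.IsBoundaryInclusion d j₂)
    (hj₃ : Gluing.IsBoundaryInclusion d j₃)
    (hg₁₂ : ∀ b v w, Gluing.pullback (𝓡 d) g₁ j₁ b v w = Gluing.pullback (𝓡 d) g₂ j₂ b v w)
    (hg₂₃ : ∀ b v w, Gluing.pullback (𝓡 d) g₂ j₂ b v w = Gluing.pullback (𝓡 d) g₃ j₃ b v w)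
    (f₁ : M₁ → ℝ) (f₂ : M₂ → ℝ) (f₃ : M₃ → ℝ)
    (hf₁ : ContMDiff (𝓡∂ (d + 1)) 𝓘(ℝ, ℝ) ∞ f₁) (hf₂ : ContMDiff (𝓡∂ (d + 1)) 𝓘(ℝ, ℝ) ∞ f₂)
    (hf₃ : ContMDiff (𝓡∂ (d + 1)) 𝓘(ℝ, ℝ) ∞ f₃)
    (φ : ℝ → ℝ) (hφ : ContDiff ℝ ∞ φ)
    (hobata₁ : Gluing.SolvesObata g₁ φ f₁) (hobata₂ : Gluing.SolvesObata g₂ φ f₂)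
    (hdirichlet : ∀ b, f₁ (j₁ b) = f₂ (j₂ b))
    (u : B → ℝ) (hneumann₁ : ∀ b, Gluing.HasNormalDeriv g₁ f₁ (j₁ b) (u b))
    (hneumann₂ : ∀ b, Gluing.HasNormalDeriv g₂ f₂ (j₂ b) (u b)) (hu : ∀ b, u b ≠ 0) :
    Gluing.SmoothlyGlues j₁ g₁ f₁ j₃ g₃ f₃ ↔ Gluing.SmoothlyGlues j₂ g₂ f₂ j₃ g₃ f₃ := by
  constructor
  · obtain ⟨Φ, h1, h2, h3, h4, h5, h6, h7⟩ := Gluing.exists_local_isometries hj₁ hj₂ hf₁ hf₂ hg₁₂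
      hdirichlet hneumann₁ hneumann₂ hu hφ hobata₁ hobata₂
    exact Gluing.SmoothlyGlues.of_local_isometries hj₂ hj₃ hf₂ hf₃ hdirichlet Φ h1 h2 h3 h4 h5 h6 h7
  · obtain ⟨Φ, h1, h2, h3, h4, h5, h6, h7⟩ := Gluing.exists_local_isometries hj₂ hj₁ hf₂ hf₁
      (fun b v w ↦ (hg₁₂ b v w).symm) (fun b ↦ (hdirichlet b).symm) hneumann₂ hneumann₁ hu hφ
      hobata₂ hobata₁
    exact Gluing.SmoothlyGlues.of_local_isometries hj₁ hj₃ hf₁ hf₃ (fun b ↦ (hdirichlet b).symm) Φ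
      h1 h2 h3 h4 h5 h6 h7
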